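/- **Conventions.** $G=(V,E)$ is a finite undirected loopless multigraph with $n$ vertices and $m$ edges. $w(A,B)$ is the number of edges between disjoint $A,B\subseteq V$; $\partial_H T=w_H(T,V(H)\setminus T)$, and $\partial=\partial_G$; $\mathrm{vol}(S)$ is the sum of the degrees in $G$ of the vertices of $S$; $G[C]$ is the induced subgraph. A set $U\subsetneq A$ is *$(1-\delta)$-boundary sparse in $A$* if $$w(U,A\setminus U)<(1-\delta)\min\{w(U,V\setminus A),\,w(A\setminus U,V\setminus A)\}.$$ **Data structures.** A partition of $V$ into clusters is given, and $G'$ is $G$ without the edges between different clusters. A *LocalKCut data structure* on $G'$ with parameters $\lambda_{\max},\nu,\beta$ answers a query on a vertex $v$ by a list of vertex sets $S\ni v$, each with $\partial_{G'}S\le\lambda_{\max}$, $\mathrm{vol}_{G'}(S)\le\nu$ and $G'[S]$ connected; the list contains every such $S$ with $\partial_{G'}S\neq 0$ that is a $\beta$-approximate minimum proper cut of the connected component of $v$ in $G'$. A query takes $\tilde O(\beta^2(\nu\lambda_{\max})^{O(\beta)})$ time, including the time to write down the answer. Here and below $\tilde O$ hides factors polylogarithmic in $n+m$. **Theorem (Fragmenting).**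 There is a deterministic algorithm with the following property. Let $C$ be a cluster of the given partition, let $\lambda_{\max},\lambda_{\min},\nu,\beta$ be integers with $1\le\lambda_{\max}<\nu$, $\beta\ge1$ and $\lambda_{\max}\le1.2\,\lambda_{\min}$, and let $0<\delta\le0.04$ be rational. Assume that 1. every $\emptyset\ne T\subsetneq C$ has $\partial_{G[C]}T\ge\lambda_{\min}$, and $\lambda_{\min}\ge\lambda_{\max}/\beta$; 2. $\partial C\le6\lambda_{\max}$; 3. a LocalKCut data structure on $G'$ with parameters $\lambda_{\max},\nu,\beta$ is available. The algorithm has random access to the parameters, $|C|$, $\partial C$, the adjacency lists of $G$, the ends of each edge, the cluster of each vertex, and the list of the edges leaving $C$. It outputs the list of the edges of $G[C]$ that are cut; the connected components that remain are clusters $C_1,\dots,C_k$, which partition $C$, and the edges cut are exactly those between different $C_i$. Moreover: 1. for every $S\subseteq C$ with $\mathrm{vol}(S)\le\nu$ and $\partial_{G[C]}S\le\lambda_{\max}$ there is a partition $\mathcal A$ of $\{C_1,\dots,C_k\}$ such that for every $A\in\mathcal A$ the set $S\cap\bigcup_{A'\in A}A'$ is not $(1-\delta)$-boundary sparse in $\bigcup_{A'\in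 A}A'$; 2. $k\le K\,\delta^{-2}(1+\log|C|)^{K}$, and $\partial C_i\le\partial C$ for all $i$; 3. the running time is $\tilde O\big(\delta^{-2}\beta^2(\nu\lambda_{\max})^{O(\beta)}\big)$; explicitly, it is at most $T=K\delta^{-2}\beta^2(\nu\lambda_{\max})^{K\beta}(1+\log(n+m))^{K}$. The running time is the number of steps of a fixed program on a unit-cost word RAM, including the time of the LocalKCut queries; all words are integers of size at most $(n+m+q+T)^{K}$, where $q$ is the denominator of $\delta$. The program does not depend on any of the data, and the constant $K$ depends only on the constants in the query time of the LocalKCut data structure. -/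

import Mathlib

/-! ## Cuts in multigraphs

Graphs are Mathlib's multigraphs `Graph α β` (parallel edges allowed). -/

namespace Fragment

open scoped Graph

/-- `E(A, B)`: the edges of `G` with one end in `A` and the other end in `B`. -/
def edgesBetween {α β : Type*} (G : Graph α β) (A B : Set α) : Set β :=
  {e | ∃ a ∈ A, ∃ b ∈ B, G.IsLink e a b}

/-- `w(A, B) = |E(A, B)|`. -/
noncomputable def weight {α β : Type*} (G : Graph α β) (A B : Set α) : ℕ :=
  (edgesBetween G A B).ncard

/-- The boundary-size (or cut-size) `∂_G T = |E(T, V(G) \ T)|`. -/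
noncomputable def boundary {α β : Type*} (G : Graph α β) (T : Set α) : ℕ :=
  weight G T (V(G) \ T)

/-- The volume of `S`: the sum of the degrees of its vertices (for graphs without loops). -/
noncomputable def vol {α β : Type*} (G : Graph α β) (S : Finset α) : ℕ :=
  ∑ v ∈ S, (G.incidenceSet v).ncard

/-- `U` is `(1 - δ)`-boundary sparse in `C`. -/
def BoundarySparse {α β : Type*} [DecidableEq α] (G : Graph α β) (δ : ℝ) (C U : Finset α) :
    Prop :=
  U ⊂ C ∧ (weight G U (C \ U) : ℝ) <
    (1 - δ) * min (weight G U (V(G) \ C) : ℝ) (weight G (C \ U) (V(G) \ C) : ℝ)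

/-- The induced subgraph `G[S]` is (nonempty and) connected. -/
def ConnectedOn {α β : Type*} (G : Graph α β) (S : Set α) : Prop :=
  S.Nonempty ∧ ∀ x ∈ S, ∀ y ∈ S, Relation.ReflTransGen (G.induce S).Adj x y

/-- The vertex set of the connected component of `v` in `G`. -/
def component {α β : Type*} (G : Graph α β) (v : α) : Set α :=
  {u | Relation.ReflTransGen G.Adj v u}

/-- The subgraph of `G` consisting of all the vertices and of the intracluster edges of the
partition `P`, that is, of the edges with both ends in the same part of `P`. -/
def intracluster {α β : Type*} [DecidableEq α] {X : Finset α} (G : Graph α β)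
    (P : Finpartition X) : Graph α β :=
  G.restrict {e | ∃ D ∈ P.parts, ∃ x ∈ D, ∃ y ∈ D, G.IsLink e x y}

/-- `S` is a proper cut of `H` whose size is at most `b` times the minimum proper cut of the
connected component of `v` in `H`. -/
def IsApproxMinCut {α β : Type*} (H : Graph α β) (b : ℕ) (v : α) (S : Set α) : Prop :=
  boundary H S ≠ 0 ∧
    ∀ T : Set α, T ⊆ component H v → boundary H T ≠ 0 → boundary H S ≤ b * boundary H T

/-! ## A word RAM with a data structure that answers queries

A machine has registers and arrays, both named by natural numbers; a program is a fixed expression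
and can only refer to finitely many of them by name. Every number that occurs in an execution has
to be at most the word bound `M`, otherwise the execution is stuck. Each operation on words takes
one step. -/

/-- The contents of the memory. -/
structure State where
  reg : ℕ → ℕ
  arr : ℕ → ℕ → ℕ

/-- Operations on words: sum, truncated difference, product, integer quotient, and the
comparisons `<` and `=` with values `0` and `1`. -/
inductive Op where
  | add | sub | mul | div | lt | eq

def Op.eval : Op → ℕ → ℕ → ℕ
  | .add, x, y => x + y
  | .sub, x, y => x - y
  | .mul, x, y => x * y
  | .div, x, y => x / y
  | .lt, x, y => if x < y then 1 else 0
  | .eq, x, y => if x = y then 1 else 0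

/-- Expressions: constants, registers, array cells, operations. -/
inductive Expr where
  | lit (k : ℕ)
  | reg (x : ℕ)
  | get (a : ℕ) (i : Expr)
  | op (o : Op) (e f : Expr)

/-- The value of an expression. -/
def Expr.eval (s : State) : Expr → ℕ
  | .lit k => k
  | .reg x => s.reg x
  | .get a i => s.arr a (i.eval s)
  | .op o e f => o.eval (e.eval s) (f.eval s)

/-- All the values that occur in the evaluation of an expression are at most `M`. -/
def Expr.Fits (M : ℕ) (s : State) : Expr → Prop
  | .lit k => k ≤ M
  | .reg x => s.reg x ≤ M
  | .get a i => i.Fits M s ∧ s.arr a (i.eval s) ≤ M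
  | .op o e f => e.Fits M s ∧ f.Fits M s ∧ o.eval (e.eval s) (f.eval s) ≤ M

/-- The number of steps that the evaluation of an expression takes. -/
def Expr.cost : Expr → ℕ
  | .lit _ => 1
  | .reg _ => 1
  | .get _ i => i.cost + 1
  | .op _ e f => e.cost + f.cost + 1

/-- Programs. `query e` asks the data structure the query whose argument is the value of `e`; the
condition of `ite` and of `loop` (a while loop) holds when the value of `e` is not zero. -/
inductive Prog where
  | skip
  | set (x : ℕ) (e : Expr)
  | put (a : ℕ) (i e : Expr)
  | query (e : Expr)
  | seq (p q : Prog)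
  | ite (e : Expr) (p q : Prog)
  | loop (e : Expr) (p : Prog)

/-- Set a register. -/
def State.set (s : State) (x k : ℕ) : State :=
  { s with reg := Function.update s.reg x k }

/-- Set a cell of an array. -/
def State.put (s : State) (a i k : ℕ) : State :=
  { s with arr := Function.update s.arr a (Function.update (s.arr a) i k) }

/-- Write a list at the beginning of an array. -/
def State.write (s : State) (a : ℕ) (l : List ℕ) : State :=
  { s with arr := Function.update s.arr a fun i => l.getD i (s.arr a i) }

/-- The array where the answers to queries appear. -/
def answerArray : ℕ := 7

/-- `Exec ans time M p s s' t`: started in `s`, the program `p` halts in `s'` after `t` steps, with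
all numbers at most `M`, when the data structure answers a query on `v` by writing the list
`ans v` into the answer array in `time v` steps. -/
inductive Exec (ans : ℕ → List ℕ) (time : ℕ → ℕ) (M : ℕ) : Prog → State → State → ℕ → Prop
  | skip (s : State) : Exec ans time M .skip s s 1
  | set (s : State) (x : ℕ) (e : Expr) (he : e.Fits M s) :
      Exec ans time M (.set x e) s (s.set x (e.eval s)) (e.cost + 1)
  | put (s : State) (a : ℕ) (i e : Expr) (hi : i.Fits M s) (he : e.Fits M s) :
      Exec ans time M (.put a i e) s (s.put a (i.eval s) (e.eval s)) (i.cost + e.cost + 1)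
  | query (s : State) (e : Expr) (he : e.Fits M s) (hlen : (ans (e.eval s)).length ≤ M)
      (hans : ∀ k ∈ ans (e.eval s), k ≤ M) :
      Exec ans time M (.query e) s (s.write answerArray (ans (e.eval s)))
        (e.cost + time (e.eval s) + 1)
  | seq (p q : Prog) (s s₁ s₂ : State) (t₁ t₂ : ℕ) (hp : Exec ans time M p s s₁ t₁)
      (hq : Exec ans time M q s₁ s₂ t₂) : Exec ans time M (.seq p q) s s₂ (t₁ + t₂)
  | ite_true (e : Expr) (p q : Prog) (s s₁ : State) (t : ℕ) (he : e.Fits M s)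
      (hc : e.eval s ≠ 0) (hp : Exec ans time M p s s₁ t) :
      Exec ans time M (.ite e p q) s s₁ (e.cost + t + 1)
  | ite_false (e : Expr) (p q : Prog) (s s₁ : State) (t : ℕ) (he : e.Fits M s)
      (hc : e.eval s = 0) (hq : Exec ans time M q s s₁ t) :
      Exec ans time M (.ite e p q) s s₁ (e.cost + t + 1)
  | loop_true (e : Expr) (p : Prog) (s s₁ s₂ : State) (t₁ t₂ : ℕ) (he : e.Fits M s)
      (hc : e.eval s ≠ 0) (hp : Exec ans time M p s s₁ t₁)
      (hl : Exec ans time M (.loop e p) s₁ s₂ t₂) :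
      Exec ans time M (.loop e p) s s₂ (e.cost + t₁ + t₂ + 1)
  | loop_false (e : Expr) (p : Prog) (s : State) (he : e.Fits M s) (hc : e.eval s = 0) :
      Exec ans time M (.loop e p) s s (e.cost + 1)

/-! ## LocalKCut data structures -/

/-- A collection of sets, each given by a list of its elements, as a list of words: the number of
sets, and then for each set its cardinality followed by its elements. -/
def encodeSets (A : List (List ℕ)) : List ℕ :=
  A.length :: A.flatMap fun L => L.length :: L

/-- A LocalKCut data structure on the graph `H` with parameters `lmax`, `ν`, `b`: `answer v` is the
collection of cuts that is returned by the query on the vertex `v` (each cut as a list of its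
vertices), and `time v` is the number of steps that this query takes. -/
structure LocalKCut (H : Graph ℕ ℕ) (lmax ν b : ℕ) where
  answer : ℕ → List (List ℕ)
  time : ℕ → ℕ
  nodup : ∀ v ∈ V(H), ∀ L ∈ answer v, L.Nodup
  sound : ∀ v ∈ V(H), ∀ L ∈ answer v, v ∈ L ∧ (∀ u ∈ L, u ∈ V(H)) ∧
    boundary H L.toFinset ≤ lmax ∧ vol H L.toFinset ≤ ν ∧ ConnectedOn H L.toFinset
  complete : ∀ v ∈ V(H), ∀ S : Finset ℕ, v ∈ S → (∀ u ∈ S, u ∈ V(H)) → boundary H S ≤ lmax →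
    vol H S ≤ ν → ConnectedOn H S → IsApproxMinCut H b v S → ∃ L ∈ answer v, L.toFinset = S
  /-- Writing down the answer is part of the query. -/
  writes : ∀ v ∈ V(H), (encodeSets (answer v)).length ≤ time v

/-- The bound `k b² (ν lmax)^(k b) (1 + log (n + m))^k`; some `k` makes it a bound of the form
`Õ(b² (ν lmax)^O(b))`, where `Õ` hides factors that are polylogarithmic in the size of the graph. -/
noncomputable def queryBound (k n m lmax ν b : ℕ) : ℝ :=
  k * (b : ℝ) ^ 2 * ((ν : ℝ) * lmax) ^ (k * b) * (1 + Real.log (n + m)) ^ k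

/-! ## Input and output of the algorithm -/

/-- The list `f i, f (i + 1), …, f (i + len - 1)`. -/
def segment (f : ℕ → ℕ) (i len : ℕ) : List ℕ :=
  (List.range len).map fun j => f (i + j)

/-- The memory `s` holds the input: a graph `G` with vertices `0, …, n - 1` and edges
`0, …, m - 1`, a partition `P` of its vertices, a cluster `C` of `P`, and the parameters.
* Array `0`: `n`, `m`, `lmax`, `ν`, `b`, numerator and denominator of `δ`, `|C|`, `∂C`, and the
  name of `C`.
* Arrays `1` and `2`: the two ends of each edge.
* Arrays `3` and `4`: for each vertex `v`, the edges that are incident to `v`, in the cells of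
  array `4` from the one numbered by cell `v` of array `3` up to, but not including, the one
  numbered by cell `v + 1` of array `3`.
* Array `5`: for each vertex, the name of its cluster, a number less than `n`.
* Array `6`: the edges between `C` and the rest of the graph.
* All the registers and the remaining arrays are zero. -/
structure IsInput (s : State) (G : Graph ℕ ℕ) (n m : ℕ) (P : Finpartition (Finset.range n))
    (C : Finset ℕ) (lmax ν b : ℕ) (δ : ℚ) : Prop where
  params : segment (s.arr 0) 0 9 =
    [n, m, lmax, ν, b, δ.num.toNat, δ.den, C.card, boundary G C]
  ends : ∀ e < m, G.IsLink e (s.arr 1 e) (s.arr 2 e)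
  offset_zero : s.arr 3 0 = 0
  offset_mono : ∀ v < n, s.arr 3 v ≤ s.arr 3 (v + 1)
  incident_nodup : ∀ v < n, (segment (s.arr 4) (s.arr 3 v) (s.arr 3 (v + 1) - s.arr 3 v)).Nodup
  incident : ∀ v < n, ∀ e,
    e ∈ segment (s.arr 4) (s.arr 3 v) (s.arr 3 (v + 1) - s.arr 3 v) ↔ G.Inc e v
  name_lt : ∀ v < n, s.arr 5 v < n
  name : ∀ u < n, ∀ v < n, s.arr 5 u = s.arr 5 v ↔ P.part u = P.part v
  name_C : ∀ v < n, s.arr 5 v = s.arr 0 9 ↔ v ∈ C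
  boundary_nodup : (segment (s.arr 6) 0 (boundary G C)).Nodup
  boundary_mem : ∀ e, e ∈ segment (s.arr 6) 0 (boundary G C) ↔ e ∈ edgesBetween G C (V(G) \ C)
  reg_zero : ∀ x, s.reg x = 0
  arr_zero : ∀ a, 7 ≤ a → ∀ i, s.arr a i = 0

/-- The array where the output appears. -/
def outputArray : ℕ := 8

/-- The memory `s` holds the decomposition `D` of `C`: cell `0` of the output array is the number
of edges of `G[C]` that join different parts of `D`, and the cells after it list these edges; the
parts of `D` are the connected components that remain after these edges are cut. -/
structure IsOutput (s : State) (G : Graph ℕ ℕ) {C : Finset ℕ} (D : Finpartition C) : Prop where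
  connected : ∀ A ∈ D.parts, ConnectedOn G A
  nodup : (segment (s.arr outputArray) 1 (s.arr outputArray 0)).Nodup
  mem : ∀ e, e ∈ segment (s.arr outputArray) 1 (s.arr outputArray 0) ↔
    ∃ A ∈ D.parts, ∃ B ∈ D.parts, A ≠ B ∧ e ∈ edgesBetween G A B

end Fragment

/-! ### Uncrossing for cuts, and the number of near-minimum cuts. -/

namespace Fragment

/-! Call an edge of `G[C]` internal and an edge leaving `C` external. For a set `Y`, `cut Y` counts
the internal edges separated by `Y`, and `mass Y` counts the external edges whose inner end lies in
`Y`; the boundary in `G` of `Y ∩ C` is `bdry Y = cut Y + mass Y`. The distance of two sets is the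
mass of their symmetric difference.

The program queries the inner end of every external edge. Let `F` be the family of all the sets
returned; each has cut at most `lmax`. If `S` is boundary sparse in `C`, then an external edge ends
in `S`, so `S` is a member of `F` (`Setting.exists_answer`); if it is not, one group consisting of
all clusters will do. A greedy pass selects a net `J` of `F`: its members are at pairwise distance
more than `η = δ * lmax / 5`, and every member of `F` is within `η` of one of them. For each `j` in
`J` the program finds a set `Y j` at which `price (F j) Y = cut Y + mass (Y ∆ F j)` is locally
minimal. The moves are intersection and union with a member of `F`, and addition and removal of a
cell of the partition by the earlier approximations. The edges separated by some `Y j` are cut.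

Uncrossing turns local optimality into all the structural claims. The moves by `F j` itself give
`cut (Y j) ≤ lmax` (`cut_le_of_price_le`). The moves by cells show that splitting a cell by `Y j`
does not increase its boundary, so no cell has a larger boundary than `C` (`bdry_cell_le`). If `S =
F f` is within `η` of `F j`, the moves by `S` show that the boundary of `Y j` exceeds that of `Y j ∩
S` by at most `2η`, and likewise for the complements (`bdry_le_inter`, `bdry_compl_le_inter`). Group
the clusters by the side of `Y j` on which they lie: one side of the cut by `S` has almost the
boundary of the group, and as all proper cuts are at least `lmin` and `4η ≤ δ * lmin`, this cut is
not sparse (`not_boundarySparse`).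

Every cluster has cut at least `lmin` if there is more than one, and these cuts add up to at most `2
* |J| * lmax`, so it remains to bound `|J|`. The members of `J` have at most `6/5` times the minimum
cut. Complemented so as to avoid a fixed vertex, such cuts have VC dimension at most 2, because
three shattered points would give four proper cuts of total size at most `18/5 < 4` times the
minimum (`not_three_cuts`). By Sauer–Shelah their number is quadratic in the number of points that
tell them apart, and since they are far from each other, a greedy hitting set of `O(log |C| / δ)`
points does so (`card_separated_cuts_le`).

For the running time, all the vertices outside the members of `F` share slot `0`, and the search
runs on slots; `IsNet.preimage` carries its result back to the graph. The price is an integer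
bounded by the number of recorded edges and external edges, so the search makes polynomially many
moves, in terms of the length of the answers and not of the size of `C`. A program logic (`Ok`)
bounds time by a fixed power of one base `B`, which is compared with the query time at the end. -/

open scoped Classical in
/-- The number of the indices `k ∈ X` whose vertex `x k` lies in `Y`. -/
noncomputable def mass (X : Finset ℕ) (x : ℕ → ℕ) (Y : Set ℕ) : ℕ :=
  ∑ k ∈ X, if x k ∈ Y then 1 else 0

open scoped Classical in
/-- The number of the edges in `I`, with ends `a e` and `b e`, that are separated by `Y`. -/
noncomputable def cut (I : Finset ℕ) (a b : ℕ → ℕ) (Y : Set ℕ) : ℕ :=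
  ∑ e ∈ I, if (a e ∈ Y ↔ b e ∈ Y) then 0 else 1

section Cuts

variable {I X : Finset ℕ} {a b x : ℕ → ℕ}

theorem cut_congr {Y Z : Set ℕ} (h : ∀ e ∈ I, (a e ∈ Y ↔ a e ∈ Z) ∧ (b e ∈ Y ↔ b e ∈ Z)) :
    cut I a b Y = cut I a b Z := by
  refine Finset.sum_congr rfl fun e he => ?_
  obtain ⟨h1, h2⟩ := h e he
  by_cases h3 : a e ∈ Z <;> by_cases h4 : b e ∈ Z <;> simp [h1.2, h2.2, mt h1.1, mt h2.1, h3, h4]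

theorem mass_congr {Y Z : Set ℕ} (h : ∀ k ∈ X, (x k ∈ Y ↔ x k ∈ Z)) :
    mass X x Y = mass X x Z := by
  refine Finset.sum_congr rfl fun k hk => ?_
  by_cases h1 : x k ∈ Z <;> simp [(h k hk).2, mt (h k hk).1, h1]

theorem cut_compl (Y : Set ℕ) : cut I a b Yᶜ = cut I a b Y := by
  refine Finset.sum_congr rfl fun e _ => ?_
  by_cases h1 : a e ∈ Y <;> by_cases h2 : b e ∈ Y <;> simp [h1, h2]

theorem cut_inter_add_union (Y Z : Set ℕ) :
    cut I a b (Y ∩ Z) + cut I a b (Y ∪ Z) ≤ cut I a b Y + cut I a b Z := by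
  simp only [cut, ← Finset.sum_add_distrib]
  refine Finset.sum_le_sum fun e _ => ?_
  by_cases h1 : a e ∈ Y <;> by_cases h2 : a e ∈ Z <;> by_cases h3 : b e ∈ Y <;>
    by_cases h4 : b e ∈ Z <;> simp [h1, h2, h3, h4]

/-- The size of the cut `Y` plus the price of moving it away from `T`. -/
noncomputable def price (I : Finset ℕ) (a b : ℕ → ℕ) (X : Finset ℕ) (x : ℕ → ℕ) (T Y : Set ℕ) :
    ℕ :=
  cut I a b Y + mass X x (symmDiff Y T)

/-- The boundary of a set of vertices. -/
noncomputable def bdry (I : Finset ℕ) (a b : ℕ → ℕ) (X : Finset ℕ) (x : ℕ → ℕ) (Y : Set ℕ) : ℕ :=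
  cut I a b Y + mass X x Y

theorem price_compl (T Y : Set ℕ) : price I a b X x Tᶜ Yᶜ = price I a b X x T Y := by
  rw [price, price, cut_compl, compl_symmDiff_compl]

/-- The distances of `Y ∩ T` and `Y ∪ T` to `T` add up to that of `Y`, as they measure `T \ Y` and
`Y \ T`. Adding the hypotheses and using submodularity of `cut`, one copy of the price of `Y`
remains below `cut T`. -/
theorem cut_le_of_price_le {T Y : Set ℕ}
    (h1 : price I a b X x T Y ≤ price I a b X x T (Y ∩ T))
    (h2 : price I a b X x T Y ≤ price I a b X x T (Y ∪ T)) : cut I a b Y ≤ cut I a b T := by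
  have h3 := cut_inter_add_union (I := I) (a := a) (b := b) Y T
  have h4 : mass X x (symmDiff (Y ∩ T) T) + mass X x (symmDiff (Y ∪ T) T)
      ≤ mass X x (symmDiff Y T) := by
    simp only [mass, ← Finset.sum_add_distrib]
    refine Finset.sum_le_sum fun e _ => ?_
    by_cases h1 : x e ∈ Y <;> by_cases h2 : x e ∈ T <;> simp [h1, h2, Set.mem_symmDiff]
  unfold price at h1 h2
  omega

/-- Uncrossing of `Z` with `W`: joining `Z` to `W` raises the distance to `T` by at most the mass of
`Z \ W`, which is what `Z` loses when it is cut down to `Z ∩ W`. With `Z` a cell and `W` the next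
approximation, this is one half of the step that keeps the boundaries of cells from growing. -/
theorem bdry_inter_le {T W Z : Set ℕ} (h : price I a b X x T W ≤ price I a b X x T (W ∪ Z)) :
    bdry I a b X x (Z ∩ W) ≤ bdry I a b X x Z := by
  have h1 := cut_inter_add_union (I := I) (a := a) (b := b) Z W
  have h2 : mass X x (Z ∩ W) + mass X x (symmDiff (W ∪ Z) T)
      ≤ mass X x Z + mass X x (symmDiff W T) := by
    simp only [mass, ← Finset.sum_add_distrib]
    refine Finset.sum_le_sum fun e _ => ?_
    by_cases h1 : x e ∈ W <;> by_cases h2 : x e ∈ T <;> by_cases h3 : x e ∈ Z <;>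
      simp [h1, h2, h3, Set.mem_symmDiff]
  rw [Set.union_comm Z W] at h1
  unfold price at h
  unfold bdry
  omega

/-- The price is invariant under complementing both arguments, so this is the previous inequality
for `Wᶜ` and `Tᶜ`. -/
theorem bdry_inter_compl_le {T W Z : Set ℕ}
    (h : price I a b X x T W ≤ price I a b X x T (W ∩ Zᶜ)) :
    bdry I a b X x (Z ∩ Wᶜ) ≤ bdry I a b X x Z := by
  refine bdry_inter_le (T := Tᶜ) ?_
  rw [price_compl]
  convert h using 1
  rw [← price_compl, compl_compl]
  congr 1
  ext v
  simp

/-- Passing from `Y` to `Y ∩ S` loses the mass of `Y \ S`. There a point outside `T` also gets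
cheaper, which cancels; a point of `T` gets dearer, so it counts twice, but it belongs to `S ∆ T`.
-/
theorem bdry_le_inter {T S Y : Set ℕ}
    (h : price I a b X x T Y ≤ price I a b X x T (Y ∩ S)) :
    bdry I a b X x Y ≤ bdry I a b X x (Y ∩ S) + 2 * mass X x (symmDiff S T) := by
  have h2 : mass X x Y + mass X x (symmDiff (Y ∩ S) T)
      ≤ mass X x (Y ∩ S) + mass X x (symmDiff Y T) + 2 * mass X x (symmDiff S T) := by
    simp only [mass, Finset.mul_sum, ← Finset.sum_add_distrib]
    refine Finset.sum_le_sum fun e _ => ?_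
    by_cases h1 : x e ∈ Y <;> by_cases h2 : x e ∈ T <;> by_cases h3 : x e ∈ S <;>
      simp [h1, h2, h3, Set.mem_symmDiff]
  unfold price at h
  unfold bdry
  omega

theorem bdry_compl_le_inter {T S Y : Set ℕ}
    (h : price I a b X x T Y ≤ price I a b X x T (Y ∪ S)) :
    bdry I a b X x Yᶜ ≤ bdry I a b X x (Yᶜ ∩ Sᶜ) + 2 * mass X x (symmDiff S T) := by
  rw [← compl_symmDiff_compl]
  refine bdry_le_inter ?_
  rwa [price_compl, ← Set.compl_union, price_compl]

/-! ### The number of the cuts -/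

/-- The four sets are the cells at the vertices of even weight of the cube. An edge between cells at
Hamming distance `d` contributes `d` on the right; on the left it contributes `1` for odd `d`, at
most `2` for `d = 2`, and nothing for `d = 0`. -/
theorem four_cells_le (P Q S : Set ℕ) :
    cut I a b (P ∩ Q ∩ Sᶜ) + cut I a b (P ∩ Qᶜ ∩ S) + cut I a b (Pᶜ ∩ Q ∩ S) +
      cut I a b (Pᶜ ∩ Qᶜ ∩ Sᶜ) ≤ cut I a b P + cut I a b Q + cut I a b S := by
  simp only [cut, ← Finset.sum_add_distrib]
  refine Finset.sum_le_sum fun e _ => ?_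
  by_cases h1 : a e ∈ P <;> by_cases h2 : a e ∈ Q <;> by_cases h3 : a e ∈ S <;>
    by_cases h4 : b e ∈ P <;> by_cases h5 : b e ∈ Q <;> by_cases h6 : b e ∈ S <;>
      simp [h1, h2, h3, h4, h5, h6]

/-- Every proper cut of `C` has size at least `l`. -/
def MinCut (I : Finset ℕ) (a b : ℕ → ℕ) (C : Finset ℕ) (l : ℕ) : Prop :=
  ∀ Y : Set ℕ, (∃ u ∈ C, u ∈ Y) → (∃ u ∈ C, u ∉ Y) → l ≤ cut I a b Y

/-- The points `p`, `q`, `s`, `z` lie one in each of the four even cells, so these are proper cuts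
of total size at least `4 * l`, whereas three cuts of size `6/5 * l` add up to only `18/5 * l`. -/
theorem not_three_cuts {C : Finset ℕ} {l : ℕ} (hl : 0 < l) (hC : MinCut I a b C l)
    {P Q S : Set ℕ} (hP : 5 * cut I a b P ≤ 6 * l) (hQ : 5 * cut I a b Q ≤ 6 * l)
    (hS : 5 * cut I a b S ≤ 6 * l) {p q s z : ℕ} (hp : p ∈ C) (hq : q ∈ C) (hs : s ∈ C)
    (hz : z ∈ C) (hp1 : p ∈ P) (hp2 : p ∈ Q) (hp3 : p ∉ S) (hq1 : q ∈ P) (hq2 : q ∉ Q)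
    (hq3 : q ∈ S) (hs1 : s ∉ P) (hs2 : s ∈ Q) (hs3 : s ∈ S) (hz1 : z ∉ P) (hz2 : z ∉ Q)
    (hz3 : z ∉ S) : False := by
  have h := four_cells_le (I := I) (a := a) (b := b) P Q S
  have h1 := hC (P ∩ Q ∩ Sᶜ) ⟨p, hp, by simp [*]⟩ ⟨z, hz, by simp [*]⟩
  have h2 := hC (P ∩ Qᶜ ∩ S) ⟨q, hq, by simp [*]⟩ ⟨z, hz, by simp [*]⟩
  have h3 := hC (Pᶜ ∩ Q ∩ S) ⟨s, hs, by simp [*]⟩ ⟨z, hz, by simp [*]⟩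
  have h4 := hC (Pᶜ ∩ Qᶜ ∩ Sᶜ) ⟨z, hz, by simp [*]⟩ ⟨p, hp, by simp [*]⟩
  omega

-- The traces on `R` are distinct and have VC dimension at most 2, so Sauer–Shelah applies. Avoiding
-- the common point `z` is what supplies the all-zero cell in the excluded pattern.
open scoped Classical in
theorem card_cuts_avoiding_le {C R : Finset ℕ} {l : ℕ} (hl : 0 < l) (hC : MinCut I a b C l)
    (hR : R ⊆ C) {z : ℕ} (hz : z ∈ C) {J : Finset ℕ} {T : ℕ → Set ℕ}
    (hT : ∀ i ∈ J, 5 * cut I a b (T i) ≤ 6 * l) (hzT : ∀ i ∈ J, z ∉ T i)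
    (hsep : ∀ i ∈ J, ∀ j ∈ J, i ≠ j → ∃ v ∈ R, ¬(v ∈ T i ↔ v ∈ T j)) :
    J.card ≤ 1 + R.card + R.card ^ 2 := by
  let tr : ℕ → Finset R := fun i => Finset.univ.filter fun v => (v : ℕ) ∈ T i
  have hinj : Set.InjOn tr J := by
    intro i hi j hj hij
    by_contra hne
    obtain ⟨v, hv, hvT⟩ := hsep i hi j hj hne
    apply hvT
    have := congrArg (fun s => (⟨v, hv⟩ : R) ∈ s) hij
    simpa [tr] using this
  set 𝒜 := J.image tr with h𝒜
  have hdim : 𝒜.vcDim ≤ 2 := by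
    refine Finset.sup_le fun s hs => ?_
    rw [Finset.mem_shatterer] at hs
    by_contra hcard
    obtain ⟨s', hs's, hs'⟩ := Finset.exists_subset_card_eq (show 3 ≤ s.card by omega)
    have hsh := hs.mono_right hs's
    obtain ⟨p, q, r, hpq, hpr, hqr, rfl⟩ := Finset.card_eq_three.1 hs'
    have key : ∀ t ⊆ ({p, q, r} : Finset R), ∃ i ∈ J, ∀ v ∈ ({p, q, r} : Finset R),
        ((v : ℕ) ∈ T i ↔ v ∈ t) := by
      intro t ht
      obtain ⟨u, hu, hut⟩ := hsh ht
      obtain ⟨i, hi, rfl⟩ := Finset.mem_image.1 hu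
      refine ⟨i, hi, fun v hv => ?_⟩
      rw [← hut]
      simp only [Finset.mem_inter, hv, true_and, tr, Finset.mem_filter, Finset.mem_univ]
    -- The three two-element traces on a shattered triple form, together with `z`, the pattern of
    -- `not_three_cuts`.
    obtain ⟨i, hi, hi'⟩ := key {p, q} (by simp)
    obtain ⟨j, hj, hj'⟩ := key {p, r} (by simp [Finset.insert_subset_iff])
    obtain ⟨k, hk, hk'⟩ := key {q, r} (by simp)
    simp only [Finset.mem_insert, Finset.mem_singleton, forall_eq_or_imp, forall_eq, true_or,
      or_true, iff_true, hpq, hpr, hqr, hpq.symm, hpr.symm, hqr.symm, or_self, iff_false]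
      at hi' hj' hk'
    exact not_three_cuts hl hC (hT i hi) (hT j hj) (hT k hk) (hR p.2) (hR q.2) (hR r.2) hz
      hi'.1 hj'.1 hk'.1 hi'.2.1 hj'.2.1 hk'.2.1 hi'.2.2 hj'.2.2 hk'.2.2
      (hzT i hi) (hzT j hj) (hzT k hk)
  calc J.card = 𝒜.card := (Finset.card_image_of_injOn hinj).symm
    _ ≤ 𝒜.shatterer.card := Finset.card_le_card_shatterer 𝒜
    _ ≤ ∑ k ∈ Finset.Iic 𝒜.vcDim, (Fintype.card R).choose k :=
      Finset.card_shatterer_le_sum_vcDim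
    _ ≤ ∑ k ∈ Finset.Iic 2, (Fintype.card R).choose k :=
      Finset.sum_le_sum_of_subset (Finset.Iic_subset_Iic.2 hdim)
    _ = 1 + R.card + R.card.choose 2 := by
      rw [show Finset.Iic 2 = ({0, 1, 2} : Finset ℕ) by decide]
      simp [add_assoc]
    _ ≤ _ := by
      have := Nat.choose_le_pow R.card 2
      omega

open scoped Classical in
/-- The number of the cuts of size at most `6/5` times the minimum that are told apart by `R`. -/
theorem card_cuts_le {C R : Finset ℕ} {l : ℕ} (hl : 0 < l) (hC : MinCut I a b C l)
    (hR : R ⊆ C) (hne : C.Nonempty) {J : Finset ℕ} {T : ℕ → Set ℕ}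
    (hT : ∀ i ∈ J, 5 * cut I a b (T i) ≤ 6 * l)
    (hsep : ∀ i ∈ J, ∀ j ∈ J, i ≠ j → ∃ v ∈ R, ¬(v ∈ T i ↔ v ∈ T j)) :
    J.card ≤ 2 * (1 + R.card + R.card ^ 2) := by
  obtain ⟨z, hz⟩ := hne
  -- Complements have the same cut and separate the same points, so the cuts containing `z` are
  -- counted through their complements; hence the factor 2.
  have h1 : (J.filter fun i => z ∈ T i).card ≤ 1 + R.card + R.card ^ 2 := by
    refine card_cuts_avoiding_le hl hC hR hz (T := fun i => (T i)ᶜ) ?_ ?_ ?_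
    · intro i hi
      rw [cut_compl]
      exact hT i (Finset.mem_filter.1 hi).1
    · intro i hi
      simpa using (Finset.mem_filter.1 hi).2
    · intro i hi j hj hij
      obtain ⟨v, hv, h⟩ := hsep i (Finset.mem_filter.1 hi).1 j (Finset.mem_filter.1 hj).1 hij
      exact ⟨v, hv, by simpa [not_iff_not] using h⟩
  have h2 : (J.filter fun i => ¬ z ∈ T i).card ≤ 1 + R.card + R.card ^ 2 := by
    refine card_cuts_avoiding_le hl hC hR hz (T := T) ?_ ?_ ?_
    · intro i hi
      exact hT i (Finset.mem_filter.1 hi).1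
    · intro i hi
      exact (Finset.mem_filter.1 hi).2
    · intro i hi j hj hij
      exact hsep i (Finset.mem_filter.1 hi).1 j (Finset.mem_filter.1 hj).1 hij
  have := Finset.card_filter_add_card_filter_not (s := J) (fun i => z ∈ T i)
  omega

open scoped Classical in
/-- A greedy hitting set. -/
theorem exists_hitting_set {ι : Type*} (X : Finset ℕ) (U₀ : Finset ι) (hit : ℕ → ι → Prop) (θ : ℝ)
    (hθ1 : θ ≤ 1) (hX : X.Nonempty)
    (h : ∀ p ∈ U₀, θ * X.card ≤ ((X.filter fun k => hit k p).card : ℝ))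
    (t : ℕ) : ∃ R ⊆ X, R.card ≤ t ∧
      ((U₀.filter fun p => ∀ k ∈ R, ¬ hit k p).card : ℝ) ≤ (1 - θ) ^ t * U₀.card := by
  induction t with
  | zero => exact ⟨∅, by simp, by simp, by simp [Finset.filter_true_of_mem]⟩
  | succ t ih =>
    obtain ⟨R, hRX, hRt, hR⟩ := ih
    set U := U₀.filter fun p => ∀ k ∈ R, ¬ hit k p with hU
    have hsum : ∑ k ∈ X, θ * (U.card : ℝ) ≤ ∑ k ∈ X, ((U.filter fun p => hit k p).card : ℝ) := by
      have e1 : ∑ k ∈ X, ((U.filter fun p => hit k p).card : ℝ)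
          = ∑ p ∈ U, ((X.filter fun k => hit k p).card : ℝ) := by
        simp only [Finset.card_filter, Nat.cast_sum]
        exact Finset.sum_comm
      rw [e1, Finset.sum_const, nsmul_eq_mul]
      calc (X.card : ℝ) * (θ * U.card) = ∑ p ∈ U, θ * X.card := by
            rw [Finset.sum_const, nsmul_eq_mul]; ring
        _ ≤ _ := Finset.sum_le_sum fun p hp => h p (Finset.mem_filter.1 hp).1
    -- Averaging: each remaining element is hit by a fraction `θ` of the indices, so some index hits
    -- a fraction `θ` of the remaining elements.
    obtain ⟨k, hk, hkU⟩ := Finset.exists_le_of_sum_le hX hsum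
    refine ⟨insert k R, Finset.insert_subset hk hRX, (Finset.card_insert_le _ _).trans (by omega),
      ?_⟩
    have e2 : (U₀.filter fun p => ∀ k' ∈ insert k R, ¬ hit k' p) = U.filter fun p => ¬ hit k p := by
      ext p
      simp only [Finset.mem_filter, Finset.forall_mem_insert, hU]
      tauto
    have e3 : ((U.filter fun p => hit k p).card : ℝ) + (U.filter fun p => ¬ hit k p).card
        = U.card := by
      exact_mod_cast Finset.card_filter_add_card_filter_not (s := U) (fun p => hit k p)
    rw [e2, pow_succ]
    have : (1 - θ) * U.card ≤ (1 - θ) * ((1 - θ) ^ t * U₀.card) :=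
      mul_le_mul_of_nonneg_left hR (by linarith)
    nlinarith

open scoped Classical in
/-- The number of the cuts of size at most `6/5` times the minimum that differ pairwise in many of
the indices in `X`. -/
theorem card_separated_cuts_le {C : Finset ℕ} {l : ℕ} (hl : 0 < l) (hC : MinCut I a b C l)
    (hx : ∀ k ∈ X, x k ∈ C) (hne : C.Nonempty) {J : Finset ℕ} {T : ℕ → Set ℕ}
    (hT : ∀ i ∈ J, 5 * cut I a b (T i) ≤ 6 * l) {θ : ℝ} (hθ : 0 < θ) (hθ1 : θ ≤ 1)
    (hsep : ∀ i ∈ J, ∀ j ∈ J, i ≠ j → θ * X.card < mass X x (symmDiff (T i) (T j))) :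
    (J.card : ℝ) ≤ 216 * (θ⁻¹) ^ 2 * (1 + Real.log C.card) ^ 2 := by
  have hc1 : (1 : ℝ) ≤ C.card := by exact_mod_cast hne.card_pos
  have hlog : 0 ≤ Real.log C.card := Real.log_nonneg hc1
  have hθi : 1 ≤ θ⁻¹ := (one_le_inv₀ hθ).2 hθ1
  have hmass : ∀ Y : Set ℕ, mass X x Y = (X.filter fun k => x k ∈ Y).card := by
    intro Y
    rw [mass, Finset.card_filter]
  have hex : ∀ i ∈ J, ∀ j ∈ J, i ≠ j → ∃ k ∈ X, x k ∈ symmDiff (T i) (T j) := by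
    intro i hi j hj hij
    have h := hsep i hi j hj hij
    rw [hmass] at h
    have : 0 < ((X.filter fun k => x k ∈ symmDiff (T i) (T j)).card : ℝ) :=
      lt_of_le_of_lt (by positivity) h
    obtain ⟨k, hk⟩ := Finset.card_pos.1 (by exact_mod_cast this)
    exact ⟨k, (Finset.mem_filter.1 hk).1, (Finset.mem_filter.1 hk).2⟩
  have hiff : ∀ i j v, v ∈ symmDiff (T i) (T j) ↔ ¬(v ∈ T i ↔ v ∈ T j) := by
    intro i j v
    rw [Set.mem_symmDiff]
    tauto
  -- Two different members differ at some index, which makes `X` nonempty as the hitting set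
  -- requires.
  rcases Nat.lt_or_ge J.card 2 with hJ | hJ
  · have h1 : (J.card : ℝ) ≤ 1 := by exact_mod_cast (by omega : J.card ≤ 1)
    have h2 : (1 : ℝ) ≤ (θ⁻¹) ^ 2 := one_le_pow₀ hθi
    have h3 : (1 : ℝ) ≤ (1 + Real.log C.card) ^ 2 := one_le_pow₀ (by linarith)
    nlinarith
  have hJ0 : (1 : ℝ) ≤ J.card := by exact_mod_cast (by omega : 1 ≤ J.card)
  obtain ⟨i, hi, j, hj, hij⟩ := Finset.one_lt_card.1 (show 1 < J.card by omega)
  obtain ⟨k₀, hk₀, -⟩ := hex i hi j hj hij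
  -- a bound that depends on the size of `C`
  have hr1 : J.card ≤ 2 * (1 + C.card + C.card ^ 2) := by
    refine card_cuts_le hl hC subset_rfl hne hT fun i hi j hj hij => ?_
    obtain ⟨k, hk, h⟩ := hex i hi j hj hij
    exact ⟨x k, hx k hk, (hiff _ _ _).1 h⟩
  have hr2 : (J.card : ℝ) ≤ 6 * (C.card : ℝ) ^ 2 := by
    have : (J.card : ℝ) ≤ 2 * (1 + C.card + (C.card : ℝ) ^ 2) := by exact_mod_cast hr1
    nlinarith
  have hlogr : Real.log J.card ≤ 2 + 2 * Real.log C.card := by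
    calc Real.log J.card ≤ Real.log (6 * (C.card : ℝ) ^ 2) :=
          Real.log_le_log (by linarith) hr2
      _ = Real.log 6 + 2 * Real.log C.card := by
          rw [Real.log_mul (by norm_num) (by positivity), Real.log_pow]; norm_num
      _ ≤ _ := by
          have : Real.log 6 ≤ 2 := by
            rw [Real.log_le_iff_le_exp (by norm_num)]
            have := Real.exp_one_gt_d9
            have h2 : Real.exp 2 = Real.exp 1 * Real.exp 1 := by rw [← Real.exp_add]; norm_num
            rw [h2]
            nlinarith
          linarith
  -- Enough rounds for `exp (-θ * t)` to beat `|J| ^ 2`, the bound on the number of pairs; the added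
  -- `1` makes the comparison strict and `t` positive.
  set t : ℕ := ⌈2 * Real.log J.card * θ⁻¹⌉₊ + 1 with ht
  have htl : 2 * Real.log J.card * θ⁻¹ < t := by
    rw [ht]
    push_cast
    have := Nat.le_ceil (2 * Real.log J.card * θ⁻¹)
    linarith
  have hlogr0 : 0 ≤ Real.log J.card := Real.log_nonneg hJ0
  have htu : (t : ℝ) ≤ 6 * θ⁻¹ * (1 + Real.log C.card) := by
    rw [ht]
    push_cast
    have := Nat.ceil_lt_add_one (show 0 ≤ 2 * Real.log J.card * θ⁻¹ by positivity)
    nlinarith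
  obtain ⟨R, hRX, hRt, hR⟩ := exists_hitting_set X J.offDiag
    (fun k p => x k ∈ symmDiff (T p.1) (T p.2)) θ hθ1 ⟨k₀, hk₀⟩ (by
      rintro ⟨i, j⟩ hp
      obtain ⟨hi, hj, hij⟩ := Finset.mem_offDiag.1 hp
      have := hsep i hi j hj hij
      rw [hmass] at this
      exact this.le) t
  have hlt : (1 - θ) ^ t * (J.offDiag.card : ℝ) < 1 := by
    have h1 : (J.offDiag.card : ℝ) ≤ (J.card : ℝ) ^ 2 := by
      rw [Finset.offDiag_card]
      exact_mod_cast (Nat.sub_le _ _).trans (by rw [pow_two])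
    have h2 : (1 - θ) ^ t ≤ Real.exp (-θ * t) := by
      rw [mul_comm, Real.exp_nat_mul]
      exact pow_le_pow_left₀ (by linarith) (by linarith [Real.add_one_le_exp (-θ)]) t
    have h3 : (J.card : ℝ) ^ 2 = Real.exp (2 * Real.log J.card) := by
      rw [two_mul, Real.exp_add, Real.exp_log (by linarith)]
      ring
    calc (1 - θ) ^ t * (J.offDiag.card : ℝ) ≤ Real.exp (-θ * t) * Real.exp (2 * Real.log J.card) := by
          rw [← h3]
          exact mul_le_mul h2 h1 (by positivity) (by positivity)
      _ = Real.exp (-θ * t + 2 * Real.log J.card) := (Real.exp_add _ _).symm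
      _ < 1 := by
          rw [Real.exp_lt_one_iff]
          have : 2 * Real.log J.card * θ⁻¹ * θ < t * θ := mul_lt_mul_of_pos_right htl hθ
          rw [mul_assoc, inv_mul_cancel₀ hθ.ne'] at this
          linarith
  -- Fewer than one pair is left, so the hitting set tells all members of `J` apart.
  have hemp : (J.offDiag.filter fun p => ∀ k ∈ R, ¬ x k ∈ symmDiff (T p.1) (T p.2)) = ∅ := by
    rw [← Finset.card_eq_zero]
    have := lt_of_le_of_lt hR hlt
    exact_mod_cast Nat.lt_one_iff.1 (by exact_mod_cast this)
  have hr3 : J.card ≤ 2 * (1 + (R.image x).card + (R.image x).card ^ 2) := by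
    refine card_cuts_le hl hC ?_ hne hT fun i hi j hj hij => ?_
    · intro v hv
      obtain ⟨k, hk, rfl⟩ := Finset.mem_image.1 hv
      exact hx k (hRX hk)
    · by_contra hcon
      push Not at hcon
      have : (i, j) ∈ (J.offDiag.filter fun p => ∀ k ∈ R, ¬ x k ∈ symmDiff (T p.1) (T p.2)) := by
        refine Finset.mem_filter.2 ⟨Finset.mem_offDiag.2 ⟨hi, hj, hij⟩, fun k hk hmem => ?_⟩
        exact (hiff _ _ _).1 hmem (hcon (x k) (Finset.mem_image_of_mem x hk))
      rw [hemp] at this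
      simp at this
  have hRt' : (R.image x).card ≤ t := Finset.card_image_le.trans hRt
  have ht1 : 1 ≤ t := by omega
  have hr4 : J.card ≤ 6 * t ^ 2 := by
    have : (R.image x).card ^ 2 ≤ t ^ 2 := Nat.pow_le_pow_left hRt' 2
    nlinarith
  calc (J.card : ℝ) ≤ 6 * (t : ℝ) ^ 2 := by exact_mod_cast hr4
    _ ≤ 6 * (6 * θ⁻¹ * (1 + Real.log C.card)) ^ 2 := by gcongr
    _ = _ := by ring

end Cuts

end Fragment

/-! ### Edge counts between sets, and boundary sparse cuts. -/

namespace Fragment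

open scoped Graph

section Weight

variable {G : Graph ℕ ℕ}

theorem edgesBetween_comm (A B : Set ℕ) : edgesBetween G A B = edgesBetween G B A := by
  ext e
  exact ⟨fun ⟨u, hu, v, hv, h⟩ => ⟨v, hv, u, hu, h.symm⟩,
    fun ⟨u, hu, v, hv, h⟩ => ⟨v, hv, u, hu, h.symm⟩⟩

theorem weight_comm (A B : Set ℕ) : weight G A B = weight G B A := by
  rw [weight, edgesBetween_comm, weight]

theorem edgesBetween_subset (A B : Set ℕ) : edgesBetween G A B ⊆ E(G) := by
  rintro e ⟨u, -, v, -, h⟩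
  exact h.edge_mem

theorem edgesBetween_mono {A A' B B' : Set ℕ} (hA : A ⊆ A') (hB : B ⊆ B') :
    edgesBetween G A B ⊆ edgesBetween G A' B' := by
  rintro e ⟨u, hu, v, hv, h⟩
  exact ⟨u, hA hu, v, hB hv, h⟩

theorem weight_empty (B : Set ℕ) : weight G ∅ B = 0 := by
  simp [weight, edgesBetween]

theorem weight_union (hE : E(G).Finite) {A B B' : Set ℕ} (h1 : Disjoint A B')
    (h2 : Disjoint B B') : weight G A (B ∪ B') = weight G A B + weight G A B' := by
  have : edgesBetween G A (B ∪ B') = edgesBetween G A B ∪ edgesBetween G A B' := by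
    ext e
    constructor
    · rintro ⟨u, hu, v, hv | hv, h⟩
      · exact Or.inl ⟨u, hu, v, hv, h⟩
      · exact Or.inr ⟨u, hu, v, hv, h⟩
    · rintro (⟨u, hu, v, hv, h⟩ | ⟨u, hu, v, hv, h⟩)
      · exact ⟨u, hu, v, Or.inl hv, h⟩
      · exact ⟨u, hu, v, Or.inr hv, h⟩
  rw [weight, this, Set.ncard_union_eq _ (hE.subset (edgesBetween_subset _ _))
    (hE.subset (edgesBetween_subset _ _)), weight, weight]
  rw [Set.disjoint_left]
  rintro e ⟨u, hu, v, hv, h⟩ ⟨u', hu', v', hv', h'⟩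
  rcases h.eq_and_eq_or_eq_and_eq h' with ⟨-, rfl⟩ | ⟨rfl, -⟩
  · exact Set.disjoint_left.1 h2 hv hv'
  · exact Set.disjoint_left.1 h1 hu hv'

/-- If the boundary of `A` is not much smaller than that of `A ∪ B`, then the cut between
`A` and `B` is not much smaller than the rest of the boundary of `B`. -/
theorem le_weight_of_boundary_le (hE : E(G).Finite) {A B : Set ℕ} (hA : A ⊆ V(G)) (hB : B ⊆ V(G))
    (hAB : Disjoint A B) {δ η l : ℝ} (hδ : 0 < δ) (hη : 4 * η ≤ δ * l)
    (hAZ : (boundary G (A ∪ B) : ℝ) ≤ boundary G A + 2 * η) (hl : l ≤ boundary G B) :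
    (1 - δ) * weight G B (V(G) \ (A ∪ B)) ≤ weight G A B := by
  have e1 : V(G) \ A = B ∪ (V(G) \ (A ∪ B)) := by
    ext v
    have : v ∈ B → v ∈ V(G) := fun h => hB h
    have : v ∈ B → v ∉ A := fun h => Set.disjoint_right.1 hAB h
    simp only [Set.mem_sdiff, Set.mem_union]
    tauto
  have e2 : V(G) \ B = A ∪ (V(G) \ (A ∪ B)) := by
    ext v
    have : v ∈ A → v ∈ V(G) := fun h => hA h
    have : v ∈ A → v ∉ B := fun h => Set.disjoint_left.1 hAB h
    simp only [Set.mem_sdiff, Set.mem_union]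
    tauto
  have d1 : Disjoint A (V(G) \ (A ∪ B)) := by
    rw [Set.disjoint_left]; intro v h1 h2; exact h2.2 (Or.inl h1)
  have d2 : Disjoint B (V(G) \ (A ∪ B)) := by
    rw [Set.disjoint_left]; intro v h1 h2; exact h2.2 (Or.inr h1)
  have f1 : boundary G A = weight G A B + weight G A (V(G) \ (A ∪ B)) := by
    rw [boundary, e1, weight_union hE d1 d2]
  have f2 : boundary G B = weight G A B + weight G B (V(G) \ (A ∪ B)) := by
    rw [boundary, e2, weight_union hE d2 d1, weight_comm B A]
  have f3 : boundary G (A ∪ B)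
      = weight G A (V(G) \ (A ∪ B)) + weight G B (V(G) \ (A ∪ B)) := by
    rw [boundary, weight_comm, weight_union hE d2.symm hAB, weight_comm, weight_comm _ B]
  rw [f1, f3] at hAZ
  rw [f2] at hl
  push_cast at hAZ hl
  -- With `p = w(A, B)` and `q` the rest of the boundary of `B`, the hypothesis says `q ≤ p + 2 *
  -- η`. If `p < (1 - δ) * q`, then `δ * q < 2 * η` and `l ≤ p + q ≤ 2 * q`, whence `δ * l < 4 * η`.
  by_contra hcon
  push Not at hcon
  set p : ℝ := (weight G A B : ℝ)
  set q : ℝ := (weight G B (V(G) \ (A ∪ B)) : ℝ)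
  have hp : 0 ≤ p := Nat.cast_nonneg _
  have hq : 0 ≤ q := Nat.cast_nonneg _
  have h1 : δ * q < 2 * η := by nlinarith
  have h2 : p ≤ q := by nlinarith
  nlinarith

theorem boundary_nonneg_of_sparse {δ : ℝ} {Z U : Finset ℕ} (h : BoundarySparse G δ Z U) :
    U.Nonempty := by
  rw [Finset.nonempty_iff_ne_empty]
  rintro rfl
  have := h.2
  rw [Finset.coe_empty, weight_empty, weight_empty, Nat.cast_zero] at this
  rw [min_eq_left (Nat.cast_nonneg _), mul_zero] at this
  exact lt_irrefl _ this

/-- Neither side of a boundary sparse cut of `Z` has almost the boundary of `Z`. -/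
theorem not_boundarySparse (hE : E(G).Finite) {Z S : Finset ℕ} (hZ : (Z : Set ℕ) ⊆ V(G))
    {δ η l : ℝ} (hδ : 0 < δ) (hδ1 : δ ≤ 1) (hη : 4 * η ≤ δ * l)
    (hl : ∀ B : Finset ℕ, B ⊂ Z → B.Nonempty → l ≤ boundary G B)
    (h : (boundary G Z : ℝ) ≤ boundary G ((Z ∩ S : Finset ℕ) : Set ℕ) + 2 * η ∨
      (boundary G Z : ℝ) ≤ boundary G ((Z \ S : Finset ℕ) : Set ℕ) + 2 * η) :
    ¬ BoundarySparse G δ Z (S ∩ Z) := by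
  intro hsp
  have hne := boundary_nonneg_of_sparse hsp
  obtain ⟨hss, hlt⟩ := hsp
  have hsd : (Z \ (S ∩ Z)) = Z \ S := by
    ext v; simp only [Finset.mem_sdiff, Finset.mem_inter]; tauto
  rw [← Finset.coe_sdiff, hsd] at hlt
  rw [Finset.inter_comm] at hlt hne hss
  have hu : ((Z ∩ S : Finset ℕ) : Set ℕ) ∪ ((Z \ S : Finset ℕ) : Set ℕ) = Z := by
    ext v; simp only [Set.mem_union, Finset.mem_coe, Finset.mem_sdiff, Finset.mem_inter]; tauto
  have hdisj : Disjoint ((Z ∩ S : Finset ℕ) : Set ℕ) ((Z \ S : Finset ℕ) : Set ℕ) := by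
    rw [Set.disjoint_left]; intro v h1 h2; simp at h1 h2; exact h2.2 h1.2
  have h1V : ((Z ∩ S : Finset ℕ) : Set ℕ) ⊆ V(G) := fun v hv => hZ (by simp at hv ⊢; exact hv.1)
  have h2V : ((Z \ S : Finset ℕ) : Set ℕ) ⊆ V(G) := fun v hv => hZ (by simp at hv ⊢; exact hv.1)
  have hne2 : (Z \ S).Nonempty := by
    obtain ⟨v, hv, hv'⟩ := Finset.exists_of_ssubset hss
    exact ⟨v, by simp at hv' ⊢; tauto⟩
  have hss2 : Z \ S ⊂ Z := by
    refine Finset.ssubset_iff_subset_ne.2 ⟨Finset.sdiff_subset, fun he => ?_⟩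
    obtain ⟨v, hv⟩ := hne
    have : v ∈ Z \ S := by rw [he]; exact (Finset.mem_inter.1 hv).1
    exact (Finset.mem_sdiff.1 this).2 (Finset.mem_inter.1 hv).2
  have h1δ : 0 ≤ 1 - δ := by linarith
  -- The minimum in the definition of sparsity is at most either entry, so it suffices to bound the
  -- cut below by the outer boundary of the other side.
  rcases h with h | h
  · have := le_weight_of_boundary_le hE h1V h2V hdisj hδ hη (by rwa [hu]) (hl _ hss2 hne2)
    rw [hu] at this
    have h3 := mul_le_mul_of_nonneg_left (min_le_right (weight G ((Z ∩ S : Finset ℕ) : Set ℕ)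
      (V(G) \ (Z : Set ℕ)) : ℝ) (weight G ((Z \ S : Finset ℕ) : Set ℕ) (V(G) \ (Z : Set ℕ)))) h1δ
    linarith
  · have := le_weight_of_boundary_le hE h2V h1V hdisj.symm hδ hη (by rwa [Set.union_comm, hu])
      (hl _ hss hne)
    rw [Set.union_comm, hu, weight_comm ((Z \ S : Finset ℕ) : Set ℕ)] at this
    have h3 := mul_le_mul_of_nonneg_left (min_le_left (weight G ((Z ∩ S : Finset ℕ) : Set ℕ)
      (V(G) \ (Z : Set ℕ)) : ℝ) (weight G ((Z \ S : Finset ℕ) : Set ℕ) (V(G) \ (Z : Set ℕ)))) h1δ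
    linarith

end Weight

/-! ### Translation between the graph and indexed internal and external edges. -/

/-- The edges with both ends in `C`. -/
def internal (m : ℕ) (a b : ℕ → ℕ) (C : Finset ℕ) : Finset ℕ :=
  (Finset.range m).filter fun e => a e ∈ C ∧ b e ∈ C

/-- A graph with vertices `0, …, n - 1`, edges `0, …, m - 1` with ends `a e` and `b e`, and a set
`C` of vertices; `g k` for `k < ∂C` are the edges leaving `C`, and `x k` is the end of `g k` in
`C`. -/
structure Setting (G : Graph ℕ ℕ) (n m : ℕ) (C : Finset ℕ) (a b g x : ℕ → ℕ) : Prop where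
  vert : V(G) = Set.Iio n
  edge : E(G) = Set.Iio m
  sub : C ⊆ Finset.range n
  ne : C.Nonempty
  ends : ∀ e < m, G.IsLink e (a e) (b e)
  g_inj : ∀ k < boundary G C, ∀ k' < boundary G C, g k = g k' → k = k'
  g_mem : ∀ e, (∃ k < boundary G C, g k = e) ↔ e ∈ edgesBetween G C (V(G) \ C)
  x_mem : ∀ k < boundary G C, x k ∈ C ∧ (x k = a (g k) ∨ x k = b (g k))

namespace Setting

variable {G : Graph ℕ ℕ} {n m : ℕ} {C : Finset ℕ} {a b g x : ℕ → ℕ}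

theorem finite (h : Setting G n m C a b g x) : E(G).Finite := by
  rw [h.edge]; exact Set.finite_Iio m

theorem sub_vert (h : Setting G n m C a b g x) : (C : Set ℕ) ⊆ V(G) := by
  rw [h.vert]; intro v hv; simpa using h.sub hv

theorem isLink_iff (h : Setting G n m C a b g x) {e u v : ℕ} :
    G.IsLink e u v ↔ e < m ∧ (u = a e ∧ v = b e ∨ u = b e ∧ v = a e) := by
  constructor
  · intro hl
    have he : e < m := by simpa [h.edge] using hl.edge_mem
    exact ⟨he, hl.eq_and_eq_or_eq_and_eq (h.ends e he)⟩
  · rintro ⟨he, ⟨rfl, rfl⟩ | ⟨rfl, rfl⟩⟩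
    · exact h.ends e he
    · exact (h.ends e he).symm

theorem mem_edgesBetween (h : Setting G n m C a b g x) {A B : Set ℕ} {e : ℕ} :
    e ∈ edgesBetween G A B ↔ e < m ∧ (a e ∈ A ∧ b e ∈ B ∨ a e ∈ B ∧ b e ∈ A) := by
  constructor
  · rintro ⟨u, hu, v, hv, hl⟩
    rw [h.isLink_iff] at hl
    rcases hl with ⟨he, ⟨rfl, rfl⟩ | ⟨rfl, rfl⟩⟩
    · exact ⟨he, Or.inl ⟨hu, hv⟩⟩
    · exact ⟨he, Or.inr ⟨hv, hu⟩⟩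
  · rintro ⟨he, ⟨h1, h2⟩ | ⟨h1, h2⟩⟩
    · exact ⟨_, h1, _, h2, h.ends e he⟩
    · exact ⟨_, h2, _, h1, (h.ends e he).symm⟩

open scoped Classical in
theorem cut_eq_card (I : Finset ℕ) (Y : Set ℕ) :
    cut I a b Y = (I.filter fun e => ¬ (a e ∈ Y ↔ b e ∈ Y)).card := by
  rw [cut, Finset.card_filter]
  refine Finset.sum_congr rfl fun e _ => ?_
  split_ifs <;> simp_all

theorem edgesBetween_internal (h : Setting G n m C a b g x) {U : Set ℕ} (hU : U ⊆ C) :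
    edgesBetween G U (C \ U) = {e | e ∈ internal m a b C ∧ ¬(a e ∈ U ↔ b e ∈ U)} := by
  ext e
  rw [h.mem_edgesBetween, Set.mem_ofPred_eq, internal, Finset.mem_filter, Finset.mem_range]
  have h1 := (fun h => hU h : a e ∈ U → a e ∈ (C : Set ℕ))
  have h2 := (fun h => hU h : b e ∈ U → b e ∈ (C : Set ℕ))
  simp only [Set.mem_sdiff, Finset.mem_coe] at h1 h2 ⊢
  tauto

open scoped Classical in
theorem weight_internal (h : Setting G n m C a b g x) {U : Set ℕ} (hU : U ⊆ C) :
    weight G U (C \ U) = cut (internal m a b C) a b U := by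
  rw [cut_eq_card, weight, h.edgesBetween_internal hU, ← Set.ncard_coe_finset, Finset.coe_filter]

open scoped Classical in
theorem weight_external (h : Setting G n m C a b g x) {U : Set ℕ} (hU : U ⊆ C) :
    weight G U (V(G) \ C) = mass (Finset.range (boundary G C)) x U := by
  have : edgesBetween G U (V(G) \ C)
      = (((Finset.range (boundary G C)).filter fun k => x k ∈ U).image g : Finset ℕ) := by
    ext e
    simp only [Finset.coe_image, Finset.coe_filter, Set.mem_image, Set.mem_ofPred_eq,
      Finset.mem_range]
    have key : ∀ k < boundary G C, (x k ∈ U ↔ g k ∈ edgesBetween G U (V(G) \ C)) := by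
      intro k hk
      have hmem := (h.g_mem (g k)).1 ⟨k, hk, rfl⟩
      obtain ⟨hx, hx'⟩ := h.x_mem k hk
      rw [h.mem_edgesBetween] at hmem ⊢
      have h1 := (fun h => hU h : a (g k) ∈ U → a (g k) ∈ (C : Set ℕ))
      have h2 := (fun h => hU h : b (g k) ∈ U → b (g k) ∈ (C : Set ℕ))
      simp only [Set.mem_sdiff, Finset.mem_coe] at hmem h1 h2 ⊢
      rcases hx' with hx' | hx' <;> rw [hx'] at hx ⊢ <;> tauto
    constructor
    · intro he
      obtain ⟨k, hk, rfl⟩ := (h.g_mem e).2 (edgesBetween_mono hU subset_rfl he)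
      exact ⟨k, ⟨hk, (key k hk).2 he⟩, rfl⟩
    · rintro ⟨k, ⟨hk, hx⟩, rfl⟩
      exact (key k hk).1 hx
  rw [weight, this, Set.ncard_coe_finset, Finset.card_image_of_injOn, mass, Finset.card_filter]
  intro k hk k' hk' he
  simp only [Finset.coe_filter, Set.mem_ofPred_eq, Finset.mem_range] at hk hk'
  exact h.g_inj k hk.1 k' hk'.1 he

theorem boundary_eq (h : Setting G n m C a b g x) {U : Set ℕ} (hU : U ⊆ C) :
    boundary G U = bdry (internal m a b C) a b (Finset.range (boundary G C)) x U := by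
  have : V(G) \ U = ((C : Set ℕ) \ U) ∪ (V(G) \ (C : Set ℕ)) := by
    ext v
    have h1 : v ∈ U → v ∈ (C : Set ℕ) := fun h => hU h
    have h2 : v ∈ (C : Set ℕ) → v ∈ V(G) := fun h' => h.sub_vert h'
    simp only [Set.mem_sdiff, Set.mem_union]
    tauto
  rw [bdry, boundary, this, weight_union h.finite, h.weight_internal hU, h.weight_external hU]
  · rw [Set.disjoint_left]; intro v h1 h2; exact h2.2 (hU h1)
  · rw [Set.disjoint_left]; intro v h1 h2; exact h2.2 h1.1

theorem cut_inter (Y : Set ℕ) :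
    cut (internal m a b C) a b (Y ∩ C) = cut (internal m a b C) a b Y := by
  refine cut_congr fun e he => ?_
  have := (Finset.mem_filter.1 he).2
  simp [this.1, this.2]

theorem mass_inter (h : Setting G n m C a b g x) (Y : Set ℕ) :
    mass (Finset.range (boundary G C)) x (Y ∩ C) = mass (Finset.range (boundary G C)) x Y := by
  refine mass_congr fun k hk => ?_
  have := (h.x_mem k (Finset.mem_range.1 hk)).1
  simp [this]

/-- The boundary of the part of `Y` that lies in `C`. -/
theorem boundary_inter (h : Setting G n m C a b g x) (Y : Set ℕ) :
    boundary G (Y ∩ C) = bdry (internal m a b C) a b (Finset.range (boundary G C)) x Y := by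
  rw [h.boundary_eq Set.inter_subset_right, bdry, cut_inter, h.mass_inter, bdry]

theorem boundary_induce (h : Setting G n m C a b g x) {U : Set ℕ} (hU : U ⊆ C) :
    boundary (G.induce C) U = cut (internal m a b C) a b U := by
  rw [← h.weight_internal hU, boundary, weight, weight]
  congr 1
  ext e
  constructor
  · rintro ⟨u, hu, v, hv, hl, -, -⟩
    exact ⟨u, hu, v, hv, hl⟩
  · rintro ⟨u, hu, v, hv, hl⟩
    exact ⟨u, hu, v, hv, hl, hU hu, hv.1⟩

theorem minCut (h : Setting G n m C a b g x) {l : ℕ}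
    (hl : ∀ T : Finset ℕ, T.Nonempty → T ⊂ C → l ≤ boundary (G.induce C) T) :
    MinCut (internal m a b C) a b C l := by
  classical
  rintro Y ⟨u, hu, huY⟩ ⟨v, hv, hvY⟩
  have h1 := hl (C.filter fun w => w ∈ Y) ⟨u, by simp [hu, huY]⟩
    (Finset.ssubset_iff_subset_ne.2 ⟨Finset.filter_subset _ _, fun he => hvY ?_⟩)
  · rw [h.boundary_induce (fun v hv => (Finset.mem_filter.1 (Finset.mem_coe.1 hv)).1), ← cut_inter (m := m) (C := C) Y] at *
    refine h1.trans (le_of_eq ?_)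
    congr 1
    ext w
    simp [and_comm]
  · rw [← he] at hv
    exact (Finset.mem_filter.1 hv).2

/-- An intracluster edge with one end in `C` has both ends there. Thus for subsets of `C` the
guarantees of the data structure, which concern the intracluster graph, speak about cuts of `G[C]`.
-/
theorem weight_intracluster (h : Setting G n m C a b g x) {P : Finpartition (Finset.range n)}
    (hC : C ∈ P.parts) {U : Set ℕ} (hU : U ⊆ C) :
    boundary (intracluster G P) U = cut (internal m a b C) a b U := by
  rw [← h.weight_internal hU, boundary, weight, weight]
  congr 1
  ext e
  constructor
  · rintro ⟨u, hu, v, hv, hP, hl⟩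
    obtain ⟨D, hD, u', hu', v', hv', hl'⟩ := hP
    have hDC : D = C := by
      rcases hl.eq_and_eq_or_eq_and_eq hl' with ⟨rfl, rfl⟩ | ⟨rfl, rfl⟩
      · exact P.eq_of_mem_parts hD hC hu' (hU hu)
      · exact P.eq_of_mem_parts hD hC hv' (hU hu)
    subst hDC
    refine ⟨u, hu, v, ⟨?_, hv.2⟩, hl⟩
    rcases hl.eq_and_eq_or_eq_and_eq hl' with ⟨rfl, rfl⟩ | ⟨rfl, rfl⟩
    · exact hv'
    · exact hu'
  · rintro ⟨u, hu, v, hv, hl⟩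
    exact ⟨u, hu, v, ⟨h.sub_vert hv.1, hv.2⟩, ⟨C, hC, u, hU hu, v, hv.1, hl⟩, hl⟩

end Setting

end Fragment

/-! ### Completeness and soundness of the answers to the queries. -/

namespace Fragment

open scoped Graph

section Queries

variable {G : Graph ℕ ℕ} {n m : ℕ} {C : Finset ℕ} {a b g x : ℕ → ℕ}
  {P : Finpartition (Finset.range n)}

theorem intracluster_isLink_mem (hC : C ∈ P.parts) {e u v : ℕ}
    (hl : (intracluster G P).IsLink e u v) (hu : u ∈ C) : v ∈ C := by
  obtain ⟨⟨D, hD, u', hu', v', hv', hl'⟩, hl⟩ := hl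
  rcases hl.eq_and_eq_or_eq_and_eq hl' with ⟨rfl, rfl⟩ | ⟨rfl, rfl⟩
  · rwa [← P.eq_of_mem_parts hD hC hu' hu]
  · rwa [← P.eq_of_mem_parts hD hC hv' hu]

theorem reflTransGen_mem {R : ℕ → ℕ → Prop} {C : Set ℕ} (h : ∀ u v, R u v → u ∈ C → v ∈ C)
    {u v : ℕ} (huv : Relation.ReflTransGen R u v) (hu : u ∈ C) : v ∈ C := by
  induction huv with
  | refl => exact hu
  | tail _ hr ih => exact h _ _ hr ih

/-- If `S` were disconnected, it would split into two nonempty parts without edges between them;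
each is a proper cut of size at least `lmin`, and together they have the cut of `S`, which is less
than `2 * lmin`. -/
theorem Setting.connectedOn (h : Setting G n m C a b g x) (hC : C ∈ P.parts) {lmax lmin : ℕ}
    (hmin : MinCut (internal m a b C) a b C lmin) (hlt : lmax < 2 * lmin) {S : Set ℕ}
    (hS : S ⊆ C) (hne : S.Nonempty) (hcut : cut (internal m a b C) a b S ≤ lmax) :
    ConnectedOn (intracluster G P) S := by
  refine ⟨hne, fun u hu v hv => ?_⟩
  by_contra hcon
  set A : Set ℕ := {w | w ∈ S ∧ Relation.ReflTransGen ((intracluster G P).induce S).Adj u w}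
    with hA
  have h1 := hmin A ⟨u, hS hu, hu, .refl⟩ ⟨v, hS hv, fun hv' => hcon hv'.2⟩
  have h2 := hmin (S \ A) ⟨v, hS hv, hv, fun hv' => hcon hv'.2⟩
    ⟨u, hS hu, fun hu' => hu'.2 ⟨hu, .refl⟩⟩
  have key : ∀ e ∈ internal m a b C, a e ∈ S → b e ∈ S → (a e ∈ A ↔ b e ∈ A) := by
    intro e he ha hb
    obtain ⟨he, haC, hbC⟩ := Finset.mem_filter.1 he
    have hl := h.ends e (Finset.mem_range.1 he)
    have hl' : ((intracluster G P).induce S).IsLink e (a e) (b e) :=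
      ⟨⟨⟨C, hC, _, haC, _, hbC, hl⟩, hl⟩, ha, hb⟩
    exact ⟨fun h' => ⟨hb, h'.2.tail ⟨e, hl'⟩⟩, fun h' => ⟨ha, h'.2.tail ⟨e, hl'.symm⟩⟩⟩
  have hAS : ∀ w, w ∈ A → w ∈ S := fun w hw => hw.1
  have h3 : cut (internal m a b C) a b A + cut (internal m a b C) a b (S \ A)
      ≤ cut (internal m a b C) a b S := by
    simp only [cut, ← Finset.sum_add_distrib]
    refine Finset.sum_le_sum fun e he => ?_
    have k1 := key e he
    have k2 := hAS (a e)
    have k3 := hAS (b e)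
    by_cases q1 : a e ∈ A <;> by_cases q2 : b e ∈ A <;> by_cases q3 : a e ∈ S <;>
      by_cases q4 : b e ∈ S <;> simp_all
  omega

-- The conditions for being listed hold: `S` is connected by the previous lemma, and it is an
-- approximate minimum cut because a nonzero cut within the component of `v` is a proper cut of `C`,
-- hence at least `lmin ≥ lmax / b'`.
open scoped Classical in
theorem Setting.exists_answer (h : Setting G n m C a b g x) (hC : C ∈ P.parts)
    {lmax lmin ν b' : ℕ} (I : LocalKCut (intracluster G P) lmax ν b')
    (hmin : MinCut (internal m a b C) a b C lmin) (hlt : lmax < 2 * lmin)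
    (hlb : lmax ≤ b' * lmin) {S : Finset ℕ} (hS : S ⊂ C) {v : ℕ} (hv : v ∈ S)
    (hvol : vol G S ≤ ν) (hcut : boundary (G.induce C) S ≤ lmax) :
    ∃ L ∈ I.answer v, L.toFinset = S := by
  have hSC : (S : Set ℕ) ⊆ C := by exact_mod_cast hS.1
  rw [h.boundary_induce hSC] at hcut
  have hV : V(intracluster G P) = V(G) := rfl
  have hvC : v ∈ C := hS.1 hv
  have hprop : lmin ≤ cut (internal m a b C) a b S := by
    obtain ⟨w, hw, hw'⟩ := Finset.exists_of_ssubset hS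
    exact hmin S ⟨v, hvC, hv⟩ ⟨w, hw, hw'⟩
  refine I.complete v (by rw [hV]; exact h.sub_vert hvC) S hv
    (fun u hu => by rw [hV]; exact h.sub_vert (hS.1 hu)) ?_ ?_ ?_ ?_
  · rwa [h.weight_intracluster hC hSC]
  · refine le_trans (Finset.sum_le_sum fun u _ => ?_) hvol
    refine Set.ncard_le_ncard ?_ (h.finite.subset (G.incidenceSet_subset_edgeSet u))
    rintro e ⟨w, hw⟩
    exact ⟨w, hw.2⟩
  · exact h.connectedOn hC hmin hlt hSC ⟨v, hv⟩ hcut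
  · refine ⟨by rw [h.weight_intracluster hC hSC]; omega, fun T hT hT0 => ?_⟩
    have hTC : T ⊆ C := by
      intro u hu
      exact reflTransGen_mem (C := (C : Set ℕ))
        (fun u w ⟨e, he⟩ hu => intracluster_isLink_mem hC he hu) (hT hu) hvC
    rw [h.weight_intracluster hC hSC, h.weight_intracluster hC hTC] at *
    have : lmin ≤ cut (internal m a b C) a b T := by
      rw [Setting.cut_eq_card, ← Nat.pos_iff_ne_zero, Finset.card_pos] at hT0
      obtain ⟨e, he⟩ := hT0
      obtain ⟨he, he'⟩ := Finset.mem_filter.1 he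
      obtain ⟨-, haC, hbC⟩ := Finset.mem_filter.1 he
      by_cases ha : a e ∈ T
      · exact hmin T ⟨_, haC, ha⟩ ⟨_, hbC, by tauto⟩
      · exact hmin T ⟨_, hbC, by tauto⟩ ⟨_, haC, ha⟩
    exact hcut.trans (hlb.trans (Nat.mul_le_mul_left _ this))

/-- A returned set is connected inside clusters and contains `v`, so it stays in `C`. The degree
bound, which adds the external edges to the volume in the intracluster graph, limits how much of the
adjacency lists is read later. -/
theorem Setting.answer_sound (h : Setting G n m C a b g x) (hC : C ∈ P.parts) {lmax ν b' : ℕ}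
    (I : LocalKCut (intracluster G P) lmax ν b') {v : ℕ} (hv : v ∈ C) {L : List ℕ}
    (hL : L ∈ I.answer v) :
    (∀ u ∈ L, u ∈ C) ∧ cut (internal m a b C) a b {u | u ∈ L} ≤ lmax ∧
      ∀ u ∈ L, (G.incidenceSet u).ncard ≤ ν + boundary G C := by
  obtain ⟨hvL, -, hb, hvol, hcon⟩ := I.sound v (h.sub_vert hv) L hL
  have hLC : ∀ u ∈ L, u ∈ C := by
    intro u hu
    exact reflTransGen_mem (C := (C : Set ℕ))
      (fun u w ⟨e, he⟩ hu => intracluster_isLink_mem hC he.1 hu)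
      (hcon.2 v (by simpa using hvL) u (by simpa using hu)) hv
  refine ⟨hLC, ?_, fun u hu => ?_⟩
  · have hset : ((L.toFinset : Finset ℕ) : Set ℕ) = {u | u ∈ L} := by ext; simp
    rw [hset] at hb
    rwa [h.weight_intracluster hC (show {u | u ∈ L} ⊆ (C : Set ℕ) from fun u hu => hLC u hu)] at hb
  · have h1 : ((intracluster G P).incidenceSet u).ncard ≤ ν :=
      le_trans (Finset.single_le_sum (f := fun u => ((intracluster G P).incidenceSet u).ncard)
        (fun _ _ => Nat.zero_le _) (by simpa using hu)) hvol
    have h2 : G.incidenceSet u ⊆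
        (intracluster G P).incidenceSet u ∪ edgesBetween G C (V(G) \ C) := by
      rintro e ⟨w, hw⟩
      by_cases hwC : w ∈ C
      · exact Or.inl ⟨w, ⟨C, hC, u, hLC u hu, w, hwC, hw⟩, hw⟩
      · exact Or.inr ⟨u, hLC u hu, w, ⟨hw.right_mem, hwC⟩, hw⟩
    have h3 : (edgesBetween G C (V(G) \ C)).ncard = boundary G C := rfl
    have hf := h.finite
    calc (G.incidenceSet u).ncard
        ≤ ((intracluster G P).incidenceSet u ∪ edgesBetween G C (V(G) \ C)).ncard :=
          Set.ncard_le_ncard h2 ((hf.subset fun e he => by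
            obtain ⟨w, hw⟩ := he; exact hw.2.edge_mem).union (hf.subset (edgesBetween_subset _ _)))
      _ ≤ _ := Set.ncard_union_le _ _
      _ ≤ _ := by omega

end Queries

/-! ### The clusters left after cutting along the approximations. -/

section Decomposition

variable {G : Graph ℕ ℕ} {n m : ℕ} {C : Finset ℕ} {a b g x : ℕ → ℕ}

/-- Induction on the number of approximations taken into account, starting from the whole cluster:
each new one splits the cell of `v` by `Y i`, and depending on the side of `v` one of the two
uncrossing inequalities applies. -/
theorem bdry_cell_le {I X : Finset ℕ} {J : Finset ℕ} {T Y : ℕ → Set ℕ}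
    (hY : ∀ i ∈ J, ∀ v, ∀ Z, Z = {u | ∀ j ∈ J, j < i → (u ∈ Y j ↔ v ∈ Y j)} →
      price I a b X x (T i) (Y i) ≤ price I a b X x (T i) (Y i ∪ Z) ∧
      price I a b X x (T i) (Y i) ≤ price I a b X x (T i) (Y i ∩ Zᶜ)) (v : ℕ) :
    bdry I a b X x {u | ∀ j ∈ J, (u ∈ Y j ↔ v ∈ Y j)} ≤ bdry I a b X x Set.univ := by
  have key : ∀ i, bdry I a b X x {u | ∀ j ∈ J, j < i → (u ∈ Y j ↔ v ∈ Y j)}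
      ≤ bdry I a b X x Set.univ := by
    intro i
    induction i with
    | zero => simp [Set.ofPred_true]
    | succ i ih =>
      by_cases hi : i ∈ J
      · obtain ⟨h1, h2⟩ := hY i hi v _ rfl
        by_cases hv : v ∈ Y i
        · refine le_trans (le_of_eq (congrArg _ (Set.ext fun u => ?_)))
            ((bdry_inter_le h1).trans ih)
          simp only [Set.mem_ofPred_eq, Set.mem_inter_iff]
          constructor
          · exact fun h => ⟨fun j hj hji => h j hj (by omega), (h i hi (by omega)).2 hv⟩
          · rintro ⟨h, hu⟩ j hj hji
            rcases Nat.lt_succ_iff_lt_or_eq.1 hji with hji | rfl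
            · exact h j hj hji
            · exact ⟨fun _ => hv, fun _ => hu⟩
        · refine le_trans (le_of_eq (congrArg _ (Set.ext fun u => ?_)))
            ((bdry_inter_compl_le h2).trans ih)
          simp only [Set.mem_ofPred_eq, Set.mem_inter_iff, Set.mem_compl_iff]
          constructor
          · exact fun h => ⟨fun j hj hji => h j hj (by omega),
              fun hu => hv ((h i hi (by omega)).1 hu)⟩
          · rintro ⟨h, hu⟩ j hj hji
            rcases Nat.lt_succ_iff_lt_or_eq.1 hji with hji | rfl
            · exact h j hj hji
            · exact ⟨fun h => absurd h hu, fun h => absurd h hv⟩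
      · convert ih using 2
        ext u
        simp only [Set.mem_ofPred_eq]
        refine forall₂_congr fun j hj => ?_
        have : j ≠ i := fun h => hi (h ▸ hj)
        exact ⟨fun h hji => h (by omega), fun h hji => h (by omega)⟩
  -- Beyond the largest index in `J` the restriction `j < i` is void.
  convert key (J.sup id + 1) using 2
  ext u
  simp only [Set.mem_ofPred_eq]
  refine forall₂_congr fun j hj => ?_
  have : j ≤ J.sup id := Finset.le_sup (f := id) hj
  exact ⟨fun h _ => h, fun h => h (by omega)⟩

/-- The parts are the components of the internal edges that no `Y i` separates; they refine the
cells, and a cell may split into several of them. -/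
theorem Setting.exists_partition (h : Setting G n m C a b g x) {J : Finset ℕ} {Y : ℕ → Set ℕ}
    {lmax lmin : ℕ} (hmin : MinCut (internal m a b C) a b C lmin)
    (hcut : ∀ i ∈ J, cut (internal m a b C) a b (Y i) ≤ lmax)
    (hcell : ∀ v, bdry (internal m a b C) a b (Finset.range (boundary G C)) x
      {u | ∀ j ∈ J, (u ∈ Y j ↔ v ∈ Y j)} ≤ boundary G C) :
    ∃ D : Finpartition C, (∀ A ∈ D.parts, ConnectedOn G A) ∧
      (∀ e, (∃ A ∈ D.parts, ∃ B ∈ D.parts, A ≠ B ∧ e ∈ edgesBetween G A B) ↔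
        e ∈ internal m a b C ∧ ∃ i ∈ J, ¬(a e ∈ Y i ↔ b e ∈ Y i)) ∧
      (∀ A ∈ D.parts, boundary G A ≤ boundary G C) ∧
      (∀ A ∈ D.parts, ∀ u ∈ A, ∀ v ∈ A, ∀ i ∈ J, (u ∈ Y i ↔ v ∈ Y i)) ∧
      (D.parts.card ≤ 1 ∨ D.parts.card * lmin ≤ 2 * (J.card * lmax)) := by
  classical
  let R : ℕ → ℕ → Prop := fun u v => ∃ e ∈ internal m a b C,
    (∀ i ∈ J, (a e ∈ Y i ↔ b e ∈ Y i)) ∧ (u = a e ∧ v = b e ∨ u = b e ∧ v = a e)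
  have hRsymm : ∀ u v, R u v → R v u := by
    rintro u v ⟨e, he, hY, h'⟩
    exact ⟨e, he, hY, by tauto⟩
  have hRY : ∀ u v, Relation.ReflTransGen R u v → ∀ i ∈ J, (u ∈ Y i ↔ v ∈ Y i) := by
    intro u v huv i hi
    induction huv with
    | refl => rfl
    | tail _ hr ih =>
      obtain ⟨e, -, hY, ⟨rfl, rfl⟩ | ⟨rfl, rfl⟩⟩ := hr
      · exact ih.trans (hY i hi)
      · exact ih.trans (hY i hi).symm
  have hsymm : ∀ u v, Relation.ReflTransGen R u v → Relation.ReflTransGen R v u := by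
    intro u v huv
    induction huv with
    | refl => exact .refl
    | tail _ hr ih => exact .head (hRsymm _ _ hr) ih
  let s : Setoid ℕ := ⟨Relation.ReflTransGen R, fun _ => .refl, fun h => hsymm _ _ h,
    fun h h' => h.trans h'⟩
  let D := Finpartition.ofSetSetoid s C
  have hmem : ∀ A ∈ D.parts, ∃ u ∈ C, ∀ v, v ∈ A ↔ v ∈ C ∧ Relation.ReflTransGen R u v := by
    intro A hA
    obtain ⟨u, hu, rfl⟩ := Finset.mem_image.1 hA
    exact ⟨u, hu, fun v => Finset.mem_filter⟩
  have hcls : ∀ A ∈ D.parts, ∀ u ∈ A, ∀ v, v ∈ A ↔ v ∈ C ∧ Relation.ReflTransGen R u v := by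
    intro A hA u hu v
    obtain ⟨w, hw, hA'⟩ := hmem A hA
    have hwu := ((hA' u).1 hu).2
    rw [hA']
    exact and_congr_right fun _ => ⟨fun h => (hsymm _ _ hwu).trans h, fun h => hwu.trans h⟩
  have hRC : ∀ u v, R u v → u ∈ C ∧ v ∈ C := by
    rintro u v ⟨e, he, -, ⟨rfl, rfl⟩ | ⟨rfl, rfl⟩⟩
    · exact (Finset.mem_filter.1 he).2
    · exact (Finset.mem_filter.1 he).2.symm
  have hDC : ∀ A ∈ D.parts, A ⊆ C := fun A hA => D.le hA
  have hedge : ∀ e, (∃ A ∈ D.parts, ∃ B ∈ D.parts, A ≠ B ∧ e ∈ edgesBetween G A B) ↔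
      e ∈ internal m a b C ∧ ∃ i ∈ J, ¬(a e ∈ Y i ↔ b e ∈ Y i) := by
    intro e
    constructor
    · rintro ⟨A, hA, B, hB, hne, he⟩
      have hdisj := D.disjoint hA hB hne
      rw [h.mem_edgesBetween] at he
      simp only [Finset.mem_coe] at he
      have heI : e ∈ internal m a b C := by
        refine Finset.mem_filter.2 ⟨Finset.mem_range.2 he.1, ?_⟩
        rcases he.2 with he | he
        · exact ⟨hDC A hA he.1, hDC B hB he.2⟩
        · exact ⟨hDC B hB he.1, hDC A hA he.2⟩
      refine ⟨heI, ?_⟩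
      by_contra hcon
      push Not at hcon
      have hr : R (a e) (b e) := ⟨e, heI, hcon, Or.inl ⟨rfl, rfl⟩⟩
      rcases he.2 with he | he
      · exact Finset.disjoint_left.1 hdisj
          ((hcls A hA _ he.1 (b e)).2 ⟨(hRC _ _ hr).2, .single hr⟩) he.2
      · exact Finset.disjoint_left.1 hdisj he.2
          ((hcls B hB _ he.1 (b e)).2 ⟨(hRC _ _ hr).2, .single hr⟩)
    · rintro ⟨heI, i, hi, hne⟩
      obtain ⟨he, haC, hbC⟩ := Finset.mem_filter.1 heI
      obtain ⟨A, hA, haA⟩ := D.exists_mem haC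
      obtain ⟨B, hB, hbB⟩ := D.exists_mem hbC
      refine ⟨A, hA, B, hB, ?_, h.mem_edgesBetween.2 ⟨Finset.mem_range.1 he, Or.inl ⟨haA, hbB⟩⟩⟩
      rintro rfl
      exact hne (hRY _ _ ((hcls A hA _ haA _).1 hbB).2 i hi)
  have hsame : ∀ A ∈ D.parts, ∀ u ∈ A, ∀ v ∈ A, ∀ i ∈ J, (u ∈ Y i ↔ v ∈ Y i) :=
    fun A hA u hu v hv i hi => hRY u v ((hcls A hA u hu v).1 hv).2 i hi
  refine ⟨D, ?_, hedge, ?_, hsame, ?_⟩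
  · intro A hA
    refine ⟨D.nonempty_of_mem_parts hA, fun u hu v hv => ?_⟩
    have huv := ((hcls A hA u hu v).1 hv).2
    clear hv
    induction huv with
    | refl => exact .refl
    | @tail w v huw hr ih =>
      have hwA : w ∈ A := (hcls A hA u hu w).2 ⟨(hRC _ _ hr).1, huw⟩
      have hvA : v ∈ A := (hcls A hA u hu v).2 ⟨(hRC _ _ hr).2, huw.tail hr⟩
      refine (ih).tail ?_
      obtain ⟨e, he, -, h'⟩ := hr
      exact ⟨e, h.isLink_iff.2 ⟨Finset.mem_range.1 (Finset.mem_filter.1 he).1, h'⟩, hwA, hvA⟩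
  · intro A hA
    obtain ⟨v, hv⟩ := D.nonempty_of_mem_parts hA
    refine le_trans ?_ (hcell v)
    rw [← h.boundary_inter]
    -- An edge leaving `A` also leaves the cell of `v`: an internal edge with both ends in that cell
    -- is not cut, so it would keep its other end in `A`.
    refine Set.ncard_le_ncard ?_ (h.finite.subset (edgesBetween_subset _ _))
    intro e he
    rw [h.mem_edgesBetween] at he ⊢
    refine ⟨he.1, ?_⟩
    have key : ∀ u w, u ∈ A → w ∉ A → w ∈ V(G) →
        (u = a e ∧ w = b e ∨ u = b e ∧ w = a e) →
        u ∈ {u | ∀ j ∈ J, (u ∈ Y j ↔ v ∈ Y j)} ∩ (C : Set ℕ) ∧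
        w ∈ V(G) \ ({u | ∀ j ∈ J, (u ∈ Y j ↔ v ∈ Y j)} ∩ (C : Set ℕ)) := by
      intro u w hu hw hwV huw
      refine ⟨⟨fun j hj => hsame A hA u hu v hv j hj, hDC A hA hu⟩, hwV, ?_⟩
      rintro ⟨hwY, hwC⟩
      have heI : e ∈ internal m a b C := by
        refine Finset.mem_filter.2 ⟨Finset.mem_range.2 he.1, ?_⟩
        rcases huw with ⟨rfl, rfl⟩ | ⟨rfl, rfl⟩
        · exact ⟨hDC A hA hu, hwC⟩
        · exact ⟨hwC, hDC A hA hu⟩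
      refine hw ((hcls A hA u hu w).2 ⟨hwC, .single ⟨e, heI, fun j hj => ?_, huw⟩⟩)
      have h1 := hsame A hA u hu v hv j hj
      have h2 := hwY j hj
      rcases huw with ⟨rfl, rfl⟩ | ⟨rfl, rfl⟩ <;> tauto
    rcases he.2 with ⟨h1, h2⟩ | ⟨h1, h2⟩
    · exact Or.inl (key _ _ h1 h2.2 h2.1 (Or.inl ⟨rfl, rfl⟩))
    · exact Or.inr (key _ _ h2 h1.2 h1.1 (Or.inr ⟨rfl, rfl⟩)).symm
  · by_cases hD : D.parts.card ≤ 1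
    · exact Or.inl hD
    right
    push Not at hD
    have h1 : ∀ A ∈ D.parts, lmin ≤ cut (internal m a b C) a b A := by
      intro A hA
      obtain ⟨u, hu⟩ := D.nonempty_of_mem_parts hA
      obtain ⟨B, hB, hne⟩ := Finset.exists_mem_ne hD A
      obtain ⟨v, hv⟩ := D.nonempty_of_mem_parts hB
      exact hmin A ⟨u, hDC A hA hu, hu⟩
        ⟨v, hDC B hB hv, fun hv' => Finset.disjoint_left.1 (D.disjoint hB hA hne) hv hv'⟩
    -- An edge between different parts is counted for exactly two parts, and some `Y i` separates
    -- it.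
    have h2 : ∑ A ∈ D.parts, cut (internal m a b C) a b A
        ≤ ∑ i ∈ J, 2 * cut (internal m a b C) a b (Y i) := by
      simp only [cut, Finset.mul_sum]
      rw [Finset.sum_comm, Finset.sum_comm (s := J)]
      refine Finset.sum_le_sum fun e heI => ?_
      obtain ⟨he, haC, hbC⟩ := Finset.mem_filter.1 heI
      obtain ⟨A, hA, haA⟩ := D.exists_mem haC
      obtain ⟨B, hB, hbB⟩ := D.exists_mem hbC
      have huA : ∀ A' ∈ D.parts, a e ∈ A' → A' = A := fun A' hA' h' =>
        D.eq_of_mem_parts hA' hA h' haA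
      have huB : ∀ A' ∈ D.parts, b e ∈ A' → A' = B := fun A' hA' h' =>
        D.eq_of_mem_parts hA' hB h' hbB
      by_cases hAB : A = B
      · subst hAB
        rw [Finset.sum_eq_zero]
        · exact Nat.zero_le _
        · intro A' hA'
          by_cases q1 : a e ∈ A' <;> by_cases q2 : b e ∈ A' <;> simp [q1, q2]
          · exact q2 ((huA A' hA' q1) ▸ hbB)
          · exact q1 ((huB A' hA' q2) ▸ haA)
      · obtain ⟨-, i, hi, hne⟩ := (hedge e).1 ⟨A, hA, B, hB, hAB,
          h.mem_edgesBetween.2 ⟨Finset.mem_range.1 he, Or.inl ⟨haA, hbB⟩⟩⟩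
        calc _ ≤ ∑ A' ∈ D.parts, ((if A' = A then 1 else 0) + if A' = B then 1 else 0) := by
              refine Finset.sum_le_sum fun A' hA' => ?_
              by_cases q1 : a e ∈ A' <;> by_cases q2 : b e ∈ A' <;> simp [q1, q2]
              · simp [huA A' hA' q1]
              · simp [huB A' hA' q2]
          _ = 2 := by
              rw [Finset.sum_add_distrib, Finset.sum_ite_eq' _ A, Finset.sum_ite_eq' _ B]
              simp [hA, hB]
          _ ≤ _ := by
              refine le_trans ?_ (Finset.single_le_sum (fun _ _ => Nat.zero_le _) hi)
              simp [hne]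
    calc D.parts.card * lmin = ∑ A ∈ D.parts, lmin := by simp
      _ ≤ _ := Finset.sum_le_sum h1
      _ ≤ _ := h2
      _ ≤ ∑ i ∈ J, 2 * lmax := Finset.sum_le_sum fun i hi => Nat.mul_le_mul_left _ (hcut i hi)
      _ = _ := by simp; ring

end Decomposition

end Fragment

/-! ### Groupings, nets, and the fragmentation that a net provides. -/

namespace Fragment

open scoped Graph

/-- The grouping of the parts of `D` by a set `Y` that is a union of parts of `D`. -/
theorem exists_grouping {C : Finset ℕ} (D : Finpartition C) (Y : Set ℕ)
    (hY : ∀ A ∈ D.parts, ∀ u ∈ A, ∀ v ∈ A, (u ∈ Y ↔ v ∈ Y)) :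
    ∃ 𝒜 : Finpartition D.parts, ∀ A ∈ 𝒜.parts,
      ((A.sup id : Finset ℕ) : Set ℕ) = Y ∩ C ∨ ((A.sup id : Finset ℕ) : Set ℕ) = Yᶜ ∩ C := by
  classical
  let p : Finset ℕ → Prop := fun A => ∃ u ∈ A, u ∈ Y
  let s : Setoid (Finset ℕ) := ⟨fun A B => (p A ↔ p B), fun _ => Iff.rfl, fun h => h.symm,
    fun h h' => h.trans h'⟩
  refine ⟨Finpartition.ofSetSetoid s D.parts, fun A hA => ?_⟩
  obtain ⟨A₀, hA₀, rfl⟩ := Finset.mem_image.1 hA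
  have hmem : ∀ u, u ∈ (({b ∈ D.parts | s.r A₀ b}).sup id : Finset ℕ) ↔
      u ∈ C ∧ (p A₀ ↔ u ∈ Y) := by
    intro u
    rw [Finset.mem_sup]
    constructor
    · rintro ⟨B, hB, hu⟩
      obtain ⟨hB, hs⟩ := Finset.mem_filter.1 hB
      have hs : p A₀ ↔ p B := hs
      refine ⟨D.le hB hu, hs.trans ⟨fun ⟨v, hv, hvY⟩ => ?_, fun h => ⟨u, hu, h⟩⟩⟩
      exact (hY B hB v hv u hu).1 hvY
    · rintro ⟨hu, hp⟩
      obtain ⟨B, hB, huB⟩ := D.exists_mem hu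
      refine ⟨B, Finset.mem_filter.2 ⟨hB, ?_⟩, huB⟩
      show p A₀ ↔ p B
      refine hp.trans ⟨fun h => ⟨u, huB, h⟩, fun ⟨v, hv, hvY⟩ => (hY B hB v hv u huB).1 hvY⟩
  by_cases hp : p A₀
  · left
    ext u
    rw [Finset.mem_coe, hmem]
    simp [hp, and_comm]
  · right
    ext u
    rw [Finset.mem_coe, hmem]
    simp [hp, and_comm]

theorem Setting.le_boundary {G : Graph ℕ ℕ} {n m : ℕ} {C : Finset ℕ} {a b g x : ℕ → ℕ}
    (h : Setting G n m C a b g x) {l : ℕ} (hmin : MinCut (internal m a b C) a b C l)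
    {B : Finset ℕ} (hB : B ⊂ C) (hne : B.Nonempty) : l ≤ boundary G B := by
  rw [h.boundary_eq (by exact_mod_cast hB.1)]
  obtain ⟨u, hu⟩ := hne
  obtain ⟨v, hv, hv'⟩ := Finset.exists_of_ssubset hB
  exact (hmin B ⟨u, hB.1 hu, hu⟩ ⟨v, hv, hv'⟩).trans (Nat.le_add_right _ _)

/-- Among the first `i` members of a family `F 0, …, F (nf - 1)` of cuts, those with index in `J` are
pairwise far from each other and close to all the others, and the `Y j` are approximations to them
that are locally optimal with respect to the members of the family and to the cells, around the
points of `V`, of the partition by the earlier approximations. -/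
structure IsNet (I : Finset ℕ) (a b : ℕ → ℕ) (X : Finset ℕ) (x : ℕ → ℕ) (η : ℝ) (V : Set ℕ)
    (nf i : ℕ) (F : ℕ → Set ℕ) (J : Finset ℕ) (Y : ℕ → Set ℕ) : Prop where
  lt : ∀ j ∈ J, j < i
  close : ∀ f < i, ∃ j ∈ J, (mass X x (symmDiff (F f) (F j)) : ℝ) ≤ η
  far : ∀ i ∈ J, ∀ j ∈ J, i ≠ j → η < mass X x (symmDiff (F i) (F j))
  inter : ∀ i ∈ J, ∀ f < nf, price I a b X x (F i) (Y i) ≤ price I a b X x (F i) (Y i ∩ F f)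
  union : ∀ i ∈ J, ∀ f < nf, price I a b X x (F i) (Y i) ≤ price I a b X x (F i) (Y i ∪ F f)
  cell : ∀ i ∈ J, ∀ v ∈ V, ∀ Z, Z = {u | ∀ j ∈ J, j < i → (u ∈ Y j ↔ v ∈ Y j)} →
      price I a b X x (F i) (Y i) ≤ price I a b X x (F i) (Y i ∪ Z) ∧
      price I a b X x (F i) (Y i) ≤ price I a b X x (F i) (Y i ∩ Zᶜ)

namespace IsNet

variable {I : Finset ℕ} {a b : ℕ → ℕ} {X : Finset ℕ} {x : ℕ → ℕ} {η : ℝ} {V : Set ℕ} {nf i : ℕ}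
  {F : ℕ → Set ℕ} {J : Finset ℕ} {Y : ℕ → Set ℕ}

theorem zero : IsNet I a b X x η V nf 0 F ∅ Y where
  lt := by simp
  close := by simp
  far := by simp
  inter := by simp
  union := by simp
  cell := by simp

theorem succ_of_close (h : IsNet I a b X x η V nf i F J Y)
    (hc : ∃ j ∈ J, (mass X x (symmDiff (F i) (F j)) : ℝ) ≤ η) :
    IsNet I a b X x η V nf (i + 1) F J Y where
  lt j hj := (h.lt j hj).trans (Nat.lt_succ_self i)
  close f hf := by
    rcases Nat.lt_succ_iff_lt_or_eq.1 hf with hf | rfl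
    · exact h.close f hf
    · exact hc
  far := h.far
  inter := h.inter
  union := h.union
  cell := h.cell

/-- All indices in `J` are below `i`, so the cells that the earlier approximations were tested
against do not change, while the cells for `i` are those of the whole of `J`. -/
theorem succ_of_far (h : IsNet I a b X x η V nf i F J Y) (hη : 0 ≤ η)
    (hc : ∀ j ∈ J, η < mass X x (symmDiff (F i) (F j))) {S : Set ℕ}
    (hinter : ∀ f < nf, price I a b X x (F i) S ≤ price I a b X x (F i) (S ∩ F f))
    (hunion : ∀ f < nf, price I a b X x (F i) S ≤ price I a b X x (F i) (S ∪ F f))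
    (hcell : ∀ v ∈ V, ∀ Z, Z = {u | ∀ j ∈ J, (u ∈ Y j ↔ v ∈ Y j)} →
      price I a b X x (F i) S ≤ price I a b X x (F i) (S ∪ Z) ∧
      price I a b X x (F i) S ≤ price I a b X x (F i) (S ∩ Zᶜ)) :
    IsNet I a b X x η V nf (i + 1) F (insert i J) (Function.update Y i S) := by
  have hne : ∀ j ∈ J, j ≠ i := fun j hj => (h.lt j hj).ne
  have hY : ∀ j ∈ J, Function.update Y i S j = Y j := fun j hj =>
    Function.update_of_ne (hne j hj) _ _
  have hcl : ∀ i', i' ≤ i → ∀ v,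
      {u | ∀ j ∈ insert i J, j < i' → (u ∈ Function.update Y i S j ↔ v ∈ Function.update Y i S j)} =
        {u | ∀ j ∈ J, j < i' → (u ∈ Y j ↔ v ∈ Y j)} := by
    intro i' hi' v
    ext u
    simp only [Set.mem_ofPred_eq, Finset.mem_insert]
    constructor
    · intro hu j hj hji
      simpa [hY j hj] using hu j (Or.inr hj) hji
    · rintro hu j (rfl | hj) hji
      · omega
      · simpa [hY j hj] using hu j hj hji
  refine ⟨fun j hj => ?_, fun f hf => ?_, fun j hj j' hj' hjj' => ?_, fun j hj => ?_, fun j hj => ?_,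
    fun j hj => ?_⟩
  · rcases Finset.mem_insert.1 hj with rfl | hj
    · exact Nat.lt_succ_self j
    · exact (h.lt j hj).trans (Nat.lt_succ_self i)
  · rcases Nat.lt_succ_iff_lt_or_eq.1 hf with hf | rfl
    · obtain ⟨j, hj, hj'⟩ := h.close f hf
      exact ⟨j, Finset.mem_insert_of_mem hj, hj'⟩
    · refine ⟨f, Finset.mem_insert_self _ _, ?_⟩
      simpa [mass] using hη
  · rcases Finset.mem_insert.1 hj with h1 | h1 <;> rcases Finset.mem_insert.1 hj' with h2 | h2
    · exact absurd (h1.trans h2.symm) hjj'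
    · rw [h1]; exact hc j' h2
    · rw [h2, symmDiff_comm]; exact hc j h1
    · exact h.far j h1 j' h2 hjj'
  · rcases Finset.mem_insert.1 hj with rfl | hj
    · simpa using hinter
    · rw [hY j hj]; exact h.inter j hj
  · rcases Finset.mem_insert.1 hj with rfl | hj
    · simpa using hunion
    · rw [hY j hj]; exact h.union j hj
  · rcases Finset.mem_insert.1 hj with rfl | hj
    · intro v hv Z hZ
      rw [hcl j le_rfl] at hZ
      rw [Function.update_self]
      refine hcell v hv Z (hZ.trans (Set.ext fun u => ?_))
      exact ⟨fun hu j' hj' => hu j' hj' (h.lt j' hj'), fun hu j' hj' _ => hu j' hj'⟩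
    · intro v hv Z hZ
      rw [hcl j (h.lt j hj).le] at hZ
      rw [hY j hj]
      exact h.cell j hj v hv Z hZ

/-- Nets are preserved by taking preimages. -/
theorem preimage (h : IsNet I a b X x η V nf i F J Y) {I' X' : Finset ℕ} {a' b' x' σ : ℕ → ℕ}
    {F' : ℕ → Set ℕ} (hcut : ∀ S : Set ℕ, cut I' a' b' (σ ⁻¹' S) = cut I a b S)
    (hmass : ∀ S : Set ℕ, mass X' x' (σ ⁻¹' S) = mass X x S) (hV : ∀ v, σ v ∈ V) (hi : i ≤ nf)
    (hF : ∀ f < nf, F' f = σ ⁻¹' F f) :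
    IsNet I' a' b' X' x' η Set.univ nf i F' J fun j => σ ⁻¹' Y j := by
  have hprice : ∀ j < i, ∀ S : Set ℕ,
      price I' a' b' X' x' (F' j) (σ ⁻¹' S) = price I a b X x (F j) S := by
    intro j hj S
    simp only [price, hF j (hj.trans_le hi), hcut]
    congr 1
    exact hmass (symmDiff S (F j))
  have hsd : ∀ j < i, ∀ j' < i, mass X' x' (symmDiff (F' j) (F' j')) =
      mass X x (symmDiff (F j) (F j')) := by
    intro j hj j' hj'
    rw [hF j (hj.trans_le hi), hF j' (hj'.trans_le hi)]
    exact hmass (symmDiff (F j) (F j'))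
  refine ⟨h.lt, fun f hf => ?_, fun j hj j' hj' hjj' => ?_, fun j hj f hf => ?_, fun j hj f hf => ?_,
    fun j hj v _ Z hZ => ?_⟩
  · obtain ⟨j, hj, h'⟩ := h.close f hf
    exact ⟨j, hj, by rwa [hsd f hf j (h.lt j hj)]⟩
  · rw [hsd j (h.lt j hj) j' (h.lt j' hj')]
    exact h.far j hj j' hj' hjj'
  · rw [hF f hf, ← Set.preimage_inter, hprice j (h.lt j hj), hprice j (h.lt j hj)]
    exact h.inter j hj f hf
  · rw [hF f hf, ← Set.preimage_union, hprice j (h.lt j hj), hprice j (h.lt j hj)]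
    exact h.union j hj f hf
  · obtain ⟨h1, h2⟩ := h.cell j hj (σ v) (hV v) _ rfl
    have hZ' : Z = σ ⁻¹' {u | ∀ j' ∈ J, j' < j → (u ∈ Y j' ↔ σ v ∈ Y j')} := hZ
    rw [hZ', ← Set.preimage_compl, ← Set.preimage_union, ← Set.preimage_inter,
      hprice j (h.lt j hj), hprice j (h.lt j hj), hprice j (h.lt j hj)]
    exact ⟨h1, h2⟩

end IsNet

/-- This joins the three consequences of local optimality with the bound on the size of a net.
Completeness of the family is needed only for proper subsets that contain an inner end of an
external edge. -/
theorem Setting.exists_fragmentation {G : Graph ℕ ℕ} {n m : ℕ} {C : Finset ℕ} {a b g x : ℕ → ℕ}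
    (h : Setting G n m C a b g x) {lmax lmin ν nf : ℕ} {δ : ℝ} (hδ : 0 < δ) (hδ1 : δ ≤ 0.04)
    (hl1 : 0 < lmin) (hl : 5 * lmax ≤ 6 * lmin) (hb : boundary G C ≤ 6 * lmax)
    (hmin : MinCut (internal m a b C) a b C lmin) {F Y : ℕ → Set ℕ} {J : Finset ℕ}
    (hN : IsNet (internal m a b C) a b (Finset.range (boundary G C)) x (δ * lmax / 5)
      Set.univ nf nf F J Y)
    (hF : ∀ f < nf, cut (internal m a b C) a b (F f) ≤ lmax)
    (hcomp : ∀ S : Finset ℕ, S ⊂ C → vol G S ≤ ν → boundary (G.induce C) S ≤ lmax →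
      (∃ k < boundary G C, x k ∈ S) → ∃ f < nf, F f = S) :
    ∃ D : Finpartition C, (∀ A ∈ D.parts, ConnectedOn G A) ∧
      (∀ e, (∃ A ∈ D.parts, ∃ B ∈ D.parts, A ≠ B ∧ e ∈ edgesBetween G A B) ↔
        e ∈ internal m a b C ∧ ∃ i ∈ J, ¬(a e ∈ Y i ↔ b e ∈ Y i)) ∧
      (∀ S : Finset ℕ, S ⊆ C → vol G S ≤ ν → boundary (G.induce C) S ≤ lmax →
        ∃ 𝒜 : Finpartition D.parts, ∀ A ∈ 𝒜.parts,
          ¬ BoundarySparse G δ (A.sup id) (S ∩ A.sup id)) ∧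
      ((D.parts.card : ℝ) ≤ 466560 * (δ ^ 2)⁻¹ * (1 + Real.log C.card) ^ 2) ∧
      (∀ A ∈ D.parts, boundary G A ≤ boundary G C) := by
  have hYcut : ∀ i ∈ J, cut (internal m a b C) a b (Y i) ≤ lmax := fun i hi =>
    (cut_le_of_price_le (hN.inter i hi i (hN.lt i hi)) (hN.union i hi i (hN.lt i hi))).trans
      (hF i (hN.lt i hi))
  have hcell : ∀ v, bdry (internal m a b C) a b (Finset.range (boundary G C)) x
      {u | ∀ j ∈ J, (u ∈ Y j ↔ v ∈ Y j)} ≤ boundary G C := by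
    intro v
    refine (bdry_cell_le (fun i hi v => hN.cell i hi v trivial) v).trans (le_of_eq ?_)
    rw [← h.boundary_inter, Set.univ_inter]
  obtain ⟨D, hD1, hD2, hD3, hD4, hD5⟩ := h.exists_partition hmin hYcut hcell
  have hCV := h.sub_vert
  refine ⟨D, hD1, hD2, ?_, ?_, hD3⟩
  · intro S hS hvol hSb
    -- If `S` is not sparse in `C`, grouping all the clusters together is good enough; otherwise `S`
    -- is found in the family.
    by_cases hsp : BoundarySparse G δ C (S ∩ C)
    · have hSC : S ∩ C = S := Finset.inter_eq_left.2 hS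
      rw [hSC] at hsp
      have hSS : (S : Set ℕ) ⊆ C := by exact_mod_cast hS
      -- A set without external edges is not sparse: the minimum would be zero.
      have hk : ∃ k < boundary G C, x k ∈ S := by
        by_contra hcon
        push Not at hcon
        have h0 : weight G S (V(G) \ C) = 0 := by
          rw [h.weight_external hSS, mass]
          refine Finset.sum_eq_zero fun k hk => ?_
          rw [if_neg]
          exact hcon k (Finset.mem_range.1 hk)
        have := hsp.2
        rw [h0, Nat.cast_zero, min_eq_left (Nat.cast_nonneg _), mul_zero] at this
        exact absurd this (not_lt.2 (Nat.cast_nonneg _))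
      obtain ⟨f, hf, hFf⟩ := hcomp S hsp.1 hvol hSb hk
      obtain ⟨j, hj, hjf⟩ := hN.close f hf
      obtain ⟨𝒜, h𝒜⟩ := exists_grouping D (Y j) fun A hA u hu v hv => hD4 A hA u hu v hv j hj
      refine ⟨𝒜, fun A hA => ?_⟩
      have hAC : A.sup id ⊆ C := by
        refine Finset.sup_le fun B hB => D.le (𝒜.le hA hB)
      -- Here `lmax ≤ 6/5 * lmin` enters: `4/5 * 6/5 = 24/25 ≤ 1`.
      have hlR : 4 * (δ * lmax / 5) ≤ δ * (lmin : ℝ) := by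
        have : (5 : ℝ) * lmax ≤ 6 * lmin := by exact_mod_cast hl
        nlinarith
      refine not_boundarySparse h.finite (fun v hv => hCV (hAC hv)) hδ (by linarith) hlR
        (fun B hB hne => by
          exact_mod_cast h.le_boundary hmin (lt_of_lt_of_le hB hAC) hne) ?_
      rcases h𝒜 A hA with hA' | hA'
      · left
        have h1 := bdry_le_inter (hN.inter j hj f hf)
        rw [← h.boundary_inter, ← h.boundary_inter] at h1
        have e1 : ((A.sup id ∩ S : Finset ℕ) : Set ℕ) = Y j ∩ F f ∩ C := by
          rw [Finset.coe_inter, hA', hFf]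
          ext v; simp only [Set.mem_inter_iff]; tauto
        rw [hA', e1]
        have h2 : (boundary G (Y j ∩ C) : ℝ) ≤ boundary G (Y j ∩ F f ∩ C) +
          2 * mass (Finset.range (boundary G C)) x (symmDiff (F f) (F j)) := by exact_mod_cast h1
        linarith
      · right
        have h1 := bdry_compl_le_inter (hN.union j hj f hf)
        rw [← h.boundary_inter, ← h.boundary_inter] at h1
        have e1 : ((A.sup id \ S : Finset ℕ) : Set ℕ) = (Y j)ᶜ ∩ (F f)ᶜ ∩ C := by
          rw [Finset.coe_sdiff, hA', hFf]
          ext v; simp only [Set.mem_inter_iff, Set.mem_sdiff, Set.mem_compl_iff]; tauto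
        rw [hA', e1]
        have h2 : (boundary G ((Y j)ᶜ ∩ C) : ℝ) ≤ boundary G ((Y j)ᶜ ∩ (F f)ᶜ ∩ C) +
          2 * mass (Finset.range (boundary G C)) x (symmDiff (F f) (F j)) := by exact_mod_cast h1
        linarith
    · obtain ⟨𝒜, h𝒜⟩ := exists_grouping D Set.univ (by simp)
      refine ⟨𝒜, fun A hA => ?_⟩
      have hAC : A.sup id = C := by
        rcases h𝒜 A hA with h' | h'
        · rw [Set.univ_inter] at h'
          exact_mod_cast h'
        · exfalso
          obtain ⟨B, hB⟩ := 𝒜.nonempty_of_mem_parts hA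
          obtain ⟨u, hu⟩ := D.nonempty_of_mem_parts (𝒜.le hA hB)
          have : u ∈ ((A.sup id : Finset ℕ) : Set ℕ) := by
            rw [Finset.mem_coe, Finset.mem_sup]
            exact ⟨B, hB, hu⟩
          rw [h'] at this
          exact this.1 trivial
      rw [hAC]
      exact hsp
  · have hlR : (5 : ℝ) * lmax ≤ 6 * lmin := by exact_mod_cast hl
    have hl0 : (0 : ℝ) < lmin := by exact_mod_cast hl1
    have hbR : (boundary G C : ℝ) ≤ 6 * lmax := by exact_mod_cast hb
    -- Since `∂C ≤ 6 * lmax`, a distance above `δ * lmax / 5` exceeds the fraction `δ / 30` of all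
    -- external edges.
    have hr := card_separated_cuts_le hl1 hmin (X := Finset.range (boundary G C)) (x := x)
      (fun k hk => (h.x_mem k (Finset.mem_range.1 hk)).1) h.ne (J := J) (T := F)
      (fun i hi => by have := hF i (hN.lt i hi); omega) (θ := δ / 30) (by positivity)
      (by linarith) (fun i hi j hj hij => by
        refine lt_of_le_of_lt ?_ (hN.far i hi j hj hij)
        rw [Finset.card_range]
        nlinarith)
    have hlog : 0 ≤ Real.log C.card := Real.log_nonneg (by exact_mod_cast h.ne.card_pos)
    have hL : (1 : ℝ) ≤ (1 + Real.log C.card) ^ 2 := one_le_pow₀ (by linarith)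
    -- The constant is `216 * 30 ^ 2`.
    have hr' : (J.card : ℝ) ≤ 194400 * (δ ^ 2)⁻¹ * (1 + Real.log C.card) ^ 2 := by
      refine hr.trans (le_of_eq ?_)
      rw [inv_div, div_pow, div_eq_mul_inv]
      ring
    rcases hD5 with hD | hD
    · have h1 : (D.parts.card : ℝ) ≤ 1 := by exact_mod_cast hD
      have h2 : (1 : ℝ) ≤ (δ ^ 2)⁻¹ := (one_le_inv₀ (by positivity)).2 (by nlinarith)
      nlinarith
    · have h1 : (D.parts.card : ℝ) * lmin ≤ 2 * (J.card * lmax) := by exact_mod_cast hD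
      -- The factor is `2 * 6/5`, and `2.4 * 194400 = 466560`.
      have h2 : (D.parts.card : ℝ) * lmin ≤ (2.4 * J.card) * lmin := by
        have : (J.card : ℝ) * (5 * lmax) ≤ J.card * (6 * lmin) :=
          mul_le_mul_of_nonneg_left hlR (Nat.cast_nonneg _)
        linarith
      have h3 := le_of_mul_le_mul_right h2 hl0
      linarith

end Fragment

/-! ### A program logic for the word RAM: word size, frame, and time. -/

namespace Fragment

/-! ### Evaluation of expressions -/

/-- A bound for the exponent of the value of an expression. -/
def Expr.valDeg : Expr → ℕ
  | .lit _ => 1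
  | .reg _ => 1
  | .get _ _ => 1
  | .op .add e f => max e.valDeg f.valDeg + 1
  | .op .sub e _ => e.valDeg
  | .op .mul e f => e.valDeg + f.valDeg
  | .op .div e _ => e.valDeg
  | .op .lt _ _ => 1
  | .op .eq _ _ => 1

/-- The intermediate values of the expression are at most `W ^ 8`, if constants and the contents of
the memory are at most `W`. -/
def Expr.small : Expr → Bool
  | .lit k => decide (k ≤ 10)
  | .reg _ => true
  | .get _ i => i.small
  | .op o e f => e.small && f.small && decide ((Expr.op o e f).valDeg ≤ 8)

/-- The expression does not refer to the arrays that hold the input. -/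
def Expr.inner : Expr → Bool
  | .lit _ => true
  | .reg _ => true
  | .get a i => decide (7 ≤ a) && i.inner
  | .op _ e f => e.inner && f.inner

/-- The cells of the input that are used in the evaluation of an expression are at most `W`. -/
def Expr.Safe (W : ℕ) (s : State) : Expr → Prop
  | .lit _ => True
  | .reg _ => True
  | .get a i => i.Safe W s ∧ (a < 7 → s.arr a (i.eval s) ≤ W)
  | .op _ e f => e.Safe W s ∧ f.Safe W s

/-- The registers and the arrays that do not hold the input contain numbers up to `W`. -/
structure Bdd (W : ℕ) (s : State) : Prop where
  ten_le : 10 ≤ W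
  reg : ∀ x, s.reg x ≤ W
  arr : ∀ a, 7 ≤ a → ∀ i, s.arr a i ≤ W

theorem Expr.safe_of_inner {W : ℕ} {s : State} : ∀ e : Expr, e.inner = true → e.Safe W s
  | .lit _, _ => trivial
  | .reg _, _ => trivial
  | .get a i, h => by
    simp only [Expr.inner, Bool.and_eq_true, decide_eq_true_eq] at h
    exact ⟨i.safe_of_inner h.2, fun h' => by omega⟩
  | .op _ e f, h => by
    simp only [Expr.inner, Bool.and_eq_true] at h
    exact ⟨e.safe_of_inner h.1, f.safe_of_inner h.2⟩

/-- Values are tracked as powers of `W`. Multiplication adds the exponents; addition costs one more,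
since `2 * W ^ d ≤ W ^ (d + 1)`. The check that intermediate exponents stay within `8` is syntactic,
so for the concrete expressions of the program it is settled by computation. -/
theorem Expr.eval_le_and_fits {W : ℕ} {s : State} (hB : Bdd W s) :
    ∀ e : Expr, e.small = true → e.Safe W s → e.eval s ≤ W ^ e.valDeg ∧ e.Fits (W ^ 8) s
  | .lit k, h, _ => by
    have hW := hB.ten_le
    simp only [Expr.small, decide_eq_true_eq] at h
    exact ⟨by simp [Expr.valDeg, Expr.eval]; omega,
      (h.trans hW).trans (Nat.le_self_pow (by norm_num) W)⟩
  | .reg x, _, _ => ⟨by simpa [Expr.valDeg, Expr.eval] using hB.reg x,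
      (hB.reg x).trans (Nat.le_self_pow (by norm_num) W)⟩
  | .get a i, h, hs => by
    obtain ⟨-, h2⟩ := i.eval_le_and_fits hB h hs.1
    have h3 : s.arr a (i.eval s) ≤ W := by
      rcases Nat.lt_or_ge a 7 with ha | ha
      · exact hs.2 ha
      · exact hB.arr a ha _
    exact ⟨by simpa [Expr.valDeg, Expr.eval] using h3,
      h2, h3.trans (Nat.le_self_pow (by norm_num) W)⟩
  | .op o e f, h, hs => by
    simp only [Expr.small, Bool.and_eq_true, decide_eq_true_eq] at h
    obtain ⟨e1, e2⟩ := e.eval_le_and_fits hB h.1.1 hs.1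
    obtain ⟨f1, f2⟩ := f.eval_le_and_fits hB h.1.2 hs.2
    have hW := hB.ten_le
    have hW1 : 1 ≤ W := by omega
    have key : o.eval (e.eval s) (f.eval s) ≤ W ^ (Expr.op o e f).valDeg := by
      cases o with
      | add =>
        simp only [Op.eval, Expr.valDeg]
        have g1 := e1.trans (Nat.pow_le_pow_right hW1 (le_max_left e.valDeg f.valDeg))
        have g2 := f1.trans (Nat.pow_le_pow_right hW1 (le_max_right e.valDeg f.valDeg))
        rw [pow_succ]
        nlinarith [Nat.zero_le (W ^ max e.valDeg f.valDeg)]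
      | sub => exact (Nat.sub_le _ _).trans e1
      | mul =>
        simp only [Op.eval, Expr.valDeg, pow_add]
        exact Nat.mul_le_mul e1 f1
      | div => exact (Nat.div_le_self _ _).trans e1
      | lt =>
        simp only [Op.eval, Expr.valDeg, pow_one]
        split_ifs <;> omega
      | eq =>
        simp only [Op.eval, Expr.valDeg, pow_one]
        split_ifs <;> omega
    exact ⟨key, e2, f2, key.trans (Nat.pow_le_pow_right hW1 h.2)⟩

theorem Expr.fits_of {W : ℕ} {s : State} (hB : Bdd W s) (e : Expr)
    (h : e.small = true) (hs : e.Safe W s) : e.Fits (W ^ 8) s :=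
  (e.eval_le_and_fits hB h hs).2

theorem Bdd.set {W : ℕ} {s : State} (hB : Bdd W s) {x v : ℕ} (hv : v ≤ W) : Bdd W (s.set x v) := by
  refine ⟨hB.ten_le, fun y => ?_, hB.arr⟩
  simp only [State.set, Function.update_apply]
  split_ifs
  · exact hv
  · exact hB.reg y

theorem Bdd.put {W : ℕ} {s : State} (hB : Bdd W s) {a i v : ℕ} (hv : v ≤ W) :
    Bdd W (s.put a i v) := by
  refine ⟨hB.ten_le, hB.reg, fun a' ha' i' => ?_⟩
  simp only [State.put, Function.update_apply]
  split_ifs with h1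
  · rw [Function.update_apply]
    split_ifs
    · exact hv
    · exact hB.arr a (h1 ▸ ha') i'
  · exact hB.arr a' ha' i'

@[simp] theorem State.reg_set (s : State) (x v y : ℕ) :
    (s.set x v).reg y = if y = x then v else s.reg y := by
  simp [State.set, Function.update_apply]

@[simp] theorem State.arr_set (s : State) (x v a : ℕ) : (s.set x v).arr a = s.arr a := rfl

@[simp] theorem State.reg_put (s : State) (a i v y : ℕ) : (s.put a i v).reg y = s.reg y := rfl

@[simp] theorem State.arr_put (s : State) (a i v b : ℕ) :
    (s.put a i v).arr b = if b = a then Function.update (s.arr a) i v else s.arr b := by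
  simp only [State.put, Function.update_apply]

/-! ### The parts of the memory that a program writes -/

/-- The registers that a program writes. -/
def Prog.regs : Prog → List ℕ
  | .skip => []
  | .set x _ => [x]
  | .put _ _ _ => []
  | .query _ => []
  | .seq p q => p.regs ++ q.regs
  | .ite _ p q => p.regs ++ q.regs
  | .loop _ p => p.regs

/-- The arrays that a program writes. -/
def Prog.arrs : Prog → List ℕ
  | .skip => []
  | .set _ _ => []
  | .put a _ _ => [a]
  | .query _ => [answerArray]
  | .seq p q => p.arrs ++ q.arrs
  | .ite _ p q => p.arrs ++ q.arrs
  | .loop _ p => p.arrs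

/-- `s` and `s'` agree on what the program `p` does not write. -/
def Agree (p : Prog) (s s' : State) : Prop :=
  (∀ x, x ∉ p.regs → s'.reg x = s.reg x) ∧ ∀ a, a ∉ p.arrs → s'.arr a = s.arr a

theorem Agree.refl (p : Prog) (s : State) : Agree p s s := ⟨fun _ _ => rfl, fun _ _ => rfl⟩

theorem Agree.trans {p : Prog} {s s' s'' : State} (h : Agree p s s') (h' : Agree p s' s'') :
    Agree p s s'' :=
  ⟨fun x hx => (h'.1 x hx).trans (h.1 x hx), fun a ha => (h'.2 a ha).trans (h.2 a ha)⟩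

theorem Agree.mono {p q : Prog} {s s' : State} (h : Agree p s s') (h1 : p.regs ⊆ q.regs)
    (h2 : p.arrs ⊆ q.arrs) : Agree q s s' :=
  ⟨fun x hx => h.1 x fun h' => hx (h1 h'), fun a ha => h.2 a fun h' => ha (h2 h')⟩

section Logic

variable {ans : ℕ → List ℕ} {time : ℕ → ℕ} {W B : ℕ}

/-- The frame rule. What a program may write can be read off its syntax, so the persistence of all
other registers and arrays is decidable for each concrete program. -/
theorem Exec.agree {M : ℕ} {p : Prog} {s s' : State} {t : ℕ} (h : Exec ans time M p s s' t) :
    Agree p s s' := by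
  induction h with
  | skip s => exact Agree.refl _ _
  | set s x e he =>
    refine ⟨fun y hy => ?_, fun _ _ => rfl⟩
    simp only [Prog.regs, List.mem_singleton] at hy
    simp [hy]
  | put s a i e hi he =>
    refine ⟨fun _ _ => rfl, fun b hb => ?_⟩
    simp only [Prog.arrs, List.mem_singleton] at hb
    simp [hb]
  | query s e he hlen hans =>
    refine ⟨fun _ _ => rfl, fun b hb => ?_⟩
    simp only [Prog.arrs, List.mem_singleton] at hb
    simp [State.write, hb]
  | seq p q s s₁ s₂ t₁ t₂ hp hq ihp ihq =>
    exact (ihp.mono (List.subset_append_left _ _) (List.subset_append_left _ _)).trans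
      (ihq.mono (List.subset_append_right _ _) (List.subset_append_right _ _))
  | ite_true e p q s s₁ t he hc hp ih =>
    exact ih.mono (List.subset_append_left _ _) (List.subset_append_left _ _)
  | ite_false e p q s s₁ t he hc hq ih =>
    exact ih.mono (List.subset_append_right _ _) (List.subset_append_right _ _)
  | loop_true e p s s₁ s₂ t₁ t₂ he hc hp hl ihp ihl => exact Agree.trans ihp ihl
  | loop_false e p s he hc => exact Agree.refl _ _

variable (ans time W B) in
/-- Started in `s`, the program `p` halts after at most `B ^ K` steps in a state with `Q`; all the
numbers that occur are at most `W ^ 8`, and those in the memory at the end are at most `W`. -/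
def Ok (p : Prog) (s : State) (K : ℕ) (Q : State → Prop) : Prop :=
  100 ≤ B → ∃ s' t, Exec ans time (W ^ 8) p s s' t ∧ t ≤ B ^ K ∧ Bdd W s' ∧ Q s'

variable {p q : Prog} {s : State} {K : ℕ} {Q : State → Prop}

theorem Ok.mono {K' : ℕ} {R : State → Prop} (h : Ok ans time W B p s K R) (hK : K ≤ K')
    (hQ : ∀ s', Bdd W s' → Agree p s s' → R s' → Q s') : Ok ans time W B p s K' Q := by
  intro hB
  obtain ⟨s', t, h1, h2, h3, h4⟩ := h hB
  exact ⟨s', t, h1, h2.trans (Nat.pow_le_pow_right (by omega) hK), h3, hQ s' h3 h1.agree h4⟩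

theorem Ok.skip (hB : Bdd W s) (hQ : Q s) : Ok ans time W B .skip s K Q :=
  fun h => ⟨s, 1, .skip s, Nat.one_le_pow _ _ (by omega), hB, hQ⟩

theorem le_pow_of_le {k : ℕ} (hB : 100 ≤ B) (h : k ≤ 100) : k ≤ B ^ (K + 1) :=
  (h.trans hB).trans (Nat.le_self_pow (by omega) B)

/-- This makes exponents count nesting depth only: as `B ≥ 100`, two time bounds and a small
overhead are absorbed by the next power of `B`. -/
theorem add_le_pow {t₁ t₂ k : ℕ} (hB : 100 ≤ B) (h₁ : t₁ ≤ B ^ K) (h₂ : t₂ ≤ B ^ K)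
    (h : k ≤ 98) : t₁ + t₂ + k ≤ B ^ (K + 1) := by
  have h1 : 1 ≤ B ^ K := Nat.one_le_pow _ _ (by omega)
  have h2 : B ^ K * 100 ≤ B ^ (K + 1) := by
    rw [pow_succ]; exact Nat.mul_le_mul_left _ hB
  omega

theorem Ok.set {x : ℕ} {e : Expr} (hB : Bdd W s) (hs : (e.small && decide (e.cost ≤ 50)) = true)
    (hf : e.Safe W s) (v : ℕ) (hv : e.eval s = v) (hvW : v ≤ W) (hQ : Q (s.set x v)) :
    Ok ans time W B (.set x e) s (K + 1) Q := by
  subst hv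
  rw [Bool.and_eq_true, decide_eq_true_eq] at hs
  exact fun h => ⟨_, _, .set s x e (e.fits_of hB hs.1 hf), le_pow_of_le h (by omega),
    hB.set hvW, hQ⟩

theorem Ok.put {a : ℕ} {i e : Expr} (hB : Bdd W s)
    (hs : (i.small && e.small && decide (i.cost ≤ 45) && decide (e.cost ≤ 45)) = true)
    (hi : i.Safe W s) (he : e.Safe W s) (j v : ℕ) (hj : i.eval s = j)
    (hv : e.eval s = v) (hvW : v ≤ W) (hQ : Q (s.put a j v)) :
    Ok ans time W B (.put a i e) s (K + 1) Q := by
  subst hv hj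
  simp only [Bool.and_eq_true, decide_eq_true_eq] at hs
  exact fun h => ⟨_, _, .put s a i e (i.fits_of hB hs.1.1.1 hi) (e.fits_of hB hs.1.1.2 he),
    le_pow_of_le h (by omega), hB.put hvW, hQ⟩

theorem Ok.seq {R : State → Prop} (hp : Ok ans time W B p s K R)
    (hq : ∀ s', Bdd W s' → Agree p s s' → R s' → Ok ans time W B q s' K Q) :
    Ok ans time W B (.seq p q) s (K + 1) Q := by
  intro h
  obtain ⟨s₁, t₁, h1, h2, h3, h4⟩ := hp h
  obtain ⟨s₂, t₂, k1, k2, k3, k4⟩ := hq s₁ h3 h1.agree h4 h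
  exact ⟨s₂, _, .seq p q s s₁ s₂ t₁ t₂ h1 k1, add_le_pow (k := 0) h h2 k2 (by omega), k3, k4⟩

theorem Ok.set_seq {x : ℕ} {e : Expr} (hB : Bdd W s)
    (hs : (e.small && decide (e.cost ≤ 50)) = true) (hf : e.Safe W s) (v : ℕ)
    (hv : e.eval s = v) (hvW : v ≤ W)
    (hq : Bdd W (s.set x v) → Ok ans time W B q (s.set x v) (K + 1) Q) :
    Ok ans time W B (.seq (.set x e) q) s (K + 2) Q :=
  Ok.seq (Ok.set (Q := fun s' => s' = s.set x v) hB hs hf v hv hvW rfl)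
    fun _ hB' _ h => by subst h; exact hq hB'

theorem Ok.put_seq {a : ℕ} {i e : Expr} (hB : Bdd W s)
    (hs : (i.small && e.small && decide (i.cost ≤ 45) && decide (e.cost ≤ 45)) = true)
    (hi : i.Safe W s) (he : e.Safe W s) (j v : ℕ) (hj : i.eval s = j)
    (hv : e.eval s = v) (hvW : v ≤ W)
    (hq : Bdd W (s.put a j v) → Ok ans time W B q (s.put a j v) (K + 1) Q) :
    Ok ans time W B (.seq (.put a i e) q) s (K + 2) Q :=
  Ok.seq (Ok.put (Q := fun s' => s' = s.put a j v) hB hs hi he j v hj hv hvW rfl)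
    fun _ hB' _ h => by subst h; exact hq hB'

theorem Ok.query {e : Expr} (hB : Bdd W s) (hs : (e.small && decide (e.cost ≤ 50)) = true)
    (hf : e.Safe W s) (v : ℕ) (hv : e.eval s = v) (htime : time v ≤ B)
    (hlen : (ans v).length ≤ W) (hans : ∀ k ∈ ans v, k ≤ W)
    (hQ : Q (s.write answerArray (ans v))) :
    Ok ans time W B (.query e) s (K + 2) Q := by
  subst hv
  rw [Bool.and_eq_true, decide_eq_true_eq] at hs
  have hW : W ≤ W ^ 8 := Nat.le_self_pow (by norm_num) W
  refine fun h => ⟨_, _, .query s e (e.fits_of hB hs.1 hf) (hlen.trans hW)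
    (fun k hk => (hans k hk).trans hW), ?_, ⟨hB.ten_le, hB.reg, fun a ha i => ?_⟩, hQ⟩
  · have h1 : B ≤ B ^ (K + 1) := Nat.le_self_pow (by omega) B
    exact le_trans (by omega) (add_le_pow (t₁ := B) (t₂ := B) (k := 0) h h1 h1 (by omega))
  · simp only [State.write, Function.update_apply]
    split_ifs with h1
    · dsimp only
      rcases lt_or_ge i (ans (e.eval s)).length with h2 | h2
      · rw [List.getD_eq_getElem _ _ h2]
        exact hans _ (List.getElem_mem h2)
      · rw [List.getD_eq_default _ _ h2]
        exact hB.arr _ (h1 ▸ ha) i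
    · exact hB.arr a ha i

theorem Ok.ite {e : Expr} (hB : Bdd W s) (hs : (e.small && decide (e.cost ≤ 50)) = true)
    (hf : e.Safe W s) (hp : e.eval s ≠ 0 → Ok ans time W B p s K Q)
    (hq : e.eval s = 0 → Ok ans time W B q s K Q) : Ok ans time W B (.ite e p q) s (K + 1) Q := by
  intro h
  rw [Bool.and_eq_true, decide_eq_true_eq] at hs
  have hf' := e.fits_of hB hs.1 hf
  have aux : ∀ t ≤ B ^ K, e.cost + t + 1 ≤ B ^ (K + 1) := fun t ht =>
    le_trans (by omega) (add_le_pow (t₁ := t) (t₂ := 0) (k := 60) h ht (Nat.zero_le _) (by omega))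
  by_cases h0 : e.eval s = 0
  · obtain ⟨s', t, h1, h2, h3, h4⟩ := hq h0 h
    exact ⟨s', _, .ite_false e p q s s' t hf' h0 h1, aux t h2, h3, h4⟩
  · obtain ⟨s', t, h1, h2, h3, h4⟩ := hp h0 h
    exact ⟨s', _, .ite_true e p q s s' t hf' h0 h1, aux t h2, h3, h4⟩

/-- A while loop: `Inv k s` means that `s` may occur before an iteration, and that at most `k`
iterations follow. -/
theorem Ok.loop {e : Expr} {k J : ℕ} (Inv : ℕ → State → Prop)
    (hs : (e.small && e.inner && decide (e.cost ≤ 50)) = true) (hB : Bdd W s)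
    (h0 : Inv k s) (hk : 100 ≤ B → k + 1 ≤ B ^ J)
    (hend : ∀ k s', Bdd W s' → Agree p s s' → Inv k s' → e.eval s' = 0 → Q s')
    (hstep : ∀ k s', Bdd W s' → Agree p s s' → Inv k s' → e.eval s' ≠ 0 →
      Ok ans time W B p s' K fun s'' => ∃ k' < k, Inv k' s'') :
    Ok ans time W B (.loop e p) s (J + (K + 1)) Q := by
  intro h
  simp only [Bool.and_eq_true, decide_eq_true_eq] at hs
  have hf : ∀ s', Bdd W s' → e.Fits (W ^ 8) s' := fun s' hB' =>
    e.fits_of hB' hs.1.1 (e.safe_of_inner hs.1.2)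
  -- Strong induction on the variant `k`, which bounds the number of remaining iterations; an
  -- iteration with its test takes at most `B ^ (K + 1)` steps.
  have key : ∀ k s', Bdd W s' → Agree p s s' → Inv k s' →
      ∃ s'' t, Exec ans time (W ^ 8) (.loop e p) s' s'' t ∧ t ≤ (k + 1) * B ^ (K + 1) ∧
        Bdd W s'' ∧ Q s'' := by
    intro k
    induction k using Nat.strong_induction_on with
    | _ k ih =>
      intro s' hB' hA hI
      have hpos : 60 ≤ B ^ (K + 1) := le_pow_of_le h (by omega)
      by_cases hc : e.eval s' = 0
      · refine ⟨s', _, .loop_false e p s' (hf s' hB') hc, ?_, hB', hend k s' hB' hA hI hc⟩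
        nlinarith
      · obtain ⟨s₁, t₁, h1, h2, h3, k', hk', h4⟩ := hstep k s' hB' hA hI hc h
        obtain ⟨s₂, t₂, g1, g2, g3, g4⟩ := ih k' hk' s₁ h3 (hA.trans h1.agree) h4
        refine ⟨s₂, _, .loop_true e p s' s₁ s₂ t₁ t₂ (hf s' hB') hc h1 g1, ?_, g3, g4⟩
        have h5 : e.cost + t₁ + 1 ≤ B ^ (K + 1) :=
          le_trans (by omega) (add_le_pow (t₁ := t₁) (t₂ := 0) (k := 60) h h2 (Nat.zero_le _)
            (by omega))
        have h6 : (k' + 1) * B ^ (K + 1) ≤ k * B ^ (K + 1) := Nat.mul_le_mul_right _ (by omega)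
        have h7 : (k + 1) * B ^ (K + 1) = k * B ^ (K + 1) + B ^ (K + 1) := by ring
        omega
  obtain ⟨s', t, h1, h2, h3, h4⟩ := key k s hB (Agree.refl _ _) h0
  refine ⟨s', t, h1, h2.trans ?_, h3, h4⟩
  rw [pow_add B J]
  exact Nat.mul_le_mul_right _ (hk h)

/-- For `x` from `0` up to, but not including, the value of `e`. -/
def Prog.for (x : ℕ) (e : Expr) (p : Prog) : Prog :=
  .seq (.set x (.lit 0)) (.loop (.op .lt (.reg x) e) (.seq p (.set x (.op .add (.reg x) (.lit 1)))))

/-- The bound `e` is evaluated again before every round, hence the hypothesis that it keeps its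
value; and the invariant must tolerate changes of the counter, which is advanced outside the body.
-/
theorem Ok.for {x : ℕ} {e : Expr} {N : ℕ} (hB : Bdd W s)
    (hs : (e.small && e.inner && decide (e.cost ≤ 40) && !p.regs.elem x) = true) (hNW : N ≤ W)
    (hNB : N < B) (Inv : ℕ → State → Prop) (h0 : Inv 0 s)
    (hInv : ∀ i s v, Inv i s → Inv i (s.set x v))
    (he : ∀ s', Bdd W s' → Agree (.for x e p) s s' → e.eval s' = N)
    (hp : ∀ i < N, ∀ s', Bdd W s' → Agree (.for x e p) s s' → s'.reg x = i → Inv i s' →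
      Ok ans time W B p s' (K + 1) (Inv (i + 1))) :
    Ok ans time W B (.for x e p) s (K + 5) fun s' => Inv N s' ∧ s'.reg x = N := by
  simp only [Bool.and_eq_true, decide_eq_true_eq, Bool.not_eq_true', List.elem_eq_mem,
    decide_eq_false_iff_not] at hs
  have hreg : ∀ s', Agree (.seq p (.set x (.op .add (.reg x) (.lit 1)))) (s.set x 0) s' →
      Agree (.for x e p) s s' := by
    intro s' h'
    refine ⟨fun y hy => ?_, fun a ha => ?_⟩
    · simp only [Prog.for, Prog.regs, List.mem_append, List.mem_singleton, not_or] at hy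
      rw [h'.1 y (by simp [Prog.regs, hy.1, hy.2])]
      simp [hy.1]
    · simp only [Prog.for, Prog.arrs, List.nil_append, List.append_nil] at ha
      rw [h'.2 a (by simpa [Prog.arrs] using ha)]
      rfl
  refine Ok.set_seq hB rfl trivial 0 rfl (Nat.zero_le _) fun hB' => ?_
  have main := Ok.loop (ans := ans) (time := time) (W := W) (B := B) (K := K + 2) (J := 1) (k := N)
    (e := .op .lt (.reg x) e) (p := .seq p (.set x (.op .add (.reg x) (.lit 1))))
    (s := s.set x 0) (Q := fun s' => Inv N s' ∧ s'.reg x = N)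
    (fun k s' => s'.reg x ≤ N ∧ k = N - s'.reg x ∧ Inv (s'.reg x) s')
    (by simp only [Expr.small, Expr.inner, Expr.cost, Expr.valDeg, hs]; simp; omega)
    hB' ⟨by simp, by simp, by simpa using hInv 0 s 0 h0⟩ (fun _ => by simpa using hNB) ?_ ?_
  · exact main.mono (by omega) fun _ _ _ h => h
  · rintro k s' hB' hA ⟨h1, h2, h3⟩ hc
    have hev := he s' hB' (hreg s' hA)
    simp only [Expr.eval, Op.eval, hev, ite_eq_right_iff, one_ne_zero, imp_false, not_lt] at hc
    have : s'.reg x = N := by omega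
    exact ⟨this ▸ h3, this⟩
  · rintro k s' hB' hA ⟨h1, h2, h3⟩ hc
    have hev := he s' hB' (hreg s' hA)
    simp only [Expr.eval, Op.eval, hev, ne_eq, ite_eq_right_iff, one_ne_zero, imp_false,
      not_not] at hc
    refine Ok.seq (hp _ hc s' hB' (hreg s' hA) rfl h3) fun s₁ hB₁ hA₁ hI₁ => ?_
    have hrx := hA₁.1 x hs.2
    refine Ok.set hB₁ rfl ⟨trivial, trivial⟩ (s'.reg x + 1) ?_ (by omega) ?_
    · simp [Expr.eval, Op.eval, hrx]
    · refine ⟨N - (s'.reg x + 1), by omega, ?_, ?_, ?_⟩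
      · simp; omega
      · simp
      · simpa using hInv _ _ _ hI₁

/-- The sum in register `r` of the values of `f`, for `x` from `0` up to, but not including, the
value of `e`. -/
def Prog.sum (x : ℕ) (e : Expr) (r : ℕ) (f : Expr) : Prog :=
  .seq (.set r (.lit 0)) (.for x e (.set r (.op .add (.reg r) f)))

/-- Summands of at most `1` keep every partial sum within `N ≤ W`. -/
theorem Ok.sum {x r : ℕ} {e f : Expr} {N : ℕ} (hB : Bdd W s)
    (hs : (e.small && e.inner && decide (e.cost ≤ 40) && f.small && f.inner &&
      decide (f.cost ≤ 40) && decide (f.valDeg ≤ 7) && decide (x ≠ r)) = true) (hNW : N ≤ W)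
    (hNB : N < B) (v : ℕ → ℕ) (hv : ∀ i, v i ≤ 1)
    (he : ∀ s', Agree (.sum x e r f) s s' → e.eval s' = N)
    (hf : ∀ i < N, ∀ s', Agree (.sum x e r f) s s' → s'.reg x = i → f.eval s' = v i) :
    Ok ans time W B (.sum x e r f) s (K + 7) fun s' => s'.reg r = ∑ i ∈ Finset.range N, v i := by
  simp only [Bool.and_eq_true, decide_eq_true_eq] at hs
  obtain ⟨⟨⟨⟨⟨⟨⟨h1, h2⟩, h3⟩, h4⟩, h5⟩, h6⟩, h7⟩, h8⟩ := hs
  have hA : ∀ s', Agree (.for x e (.set r (.op .add (.reg r) f))) (s.set r 0) s' →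
      Agree (.sum x e r f) s s' := by
    intro s' h'
    refine ⟨fun y hy => ?_, fun a ha => ?_⟩
    · simp only [Prog.sum, Prog.for, Prog.regs, List.mem_append, List.mem_singleton, not_or] at hy
      rw [h'.1 y (by simp [Prog.for, Prog.regs, hy])]
      simp [hy.1]
    · rw [h'.2 a (by simp [Prog.for, Prog.arrs])]
      rfl
  have hsum : ∀ i ≤ N, ∑ j ∈ Finset.range i, v j ≤ W := fun i hi =>
    ((Finset.sum_le_card_nsmul _ _ 1 fun j _ => hv j).trans (by simpa using hi)).trans hNW
  refine Ok.set_seq hB rfl trivial 0 rfl (Nat.zero_le _) fun hB' => ?_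
  refine (Ok.for (K := K) hB' (by simp [h1, h2, h3, Prog.regs, h8]) hNW hNB
    (fun i s' => s'.reg r = ∑ j ∈ Finset.range i, v j) (by simp) ?_
    (fun s' _ h' => he s' (hA s' h')) ?_).mono (by omega) fun s' _ _ h => h.1
  · intro i s' w h
    simpa [Ne.symm h8] using h
  · intro i hi s' hB₁ h' hx hI
    refine Ok.set hB₁ ?_ ⟨trivial, f.safe_of_inner h5⟩ _ rfl ?_ ?_
    · simp [Expr.small, Expr.valDeg, Expr.cost, h4]
      omega
    · simp only [Expr.eval, Op.eval, hI, hf i hi s' (hA s' h') hx, ← Finset.sum_range_succ]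
      exact hsum _ hi
    · simp only [State.reg_set, if_true, Expr.eval, Op.eval, hI, hf i hi s' (hA s' h') hx,
        ← Finset.sum_range_succ]

/-- Put the value of `f` into cell `x` of the array `a`, for `x` from `0` up to, but not including,
the value of `e`. -/
def Prog.fill (x : ℕ) (e : Expr) (a : ℕ) (f : Expr) : Prog :=
  .for x e (.put a (.reg x) f)

theorem Ok.fill {x a : ℕ} {e f : Expr} {N : ℕ} (hB : Bdd W s)
    (hs : (e.small && e.inner && decide (e.cost ≤ 40) && f.small && f.inner &&
      decide (f.cost ≤ 40)) = true) (hNW : N ≤ W) (hNB : N < B) (v : ℕ → ℕ) (hv : ∀ i < N, v i ≤ W)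
    (he : ∀ s', Agree (.fill x e a f) s s' → e.eval s' = N)
    (hf : ∀ i < N, ∀ s', Agree (.fill x e a f) s s' → s'.reg x = i → s'.arr a i = s.arr a i →
      f.eval s' = v i) :
    Ok ans time W B (.fill x e a f) s (K + 6) fun s' => ∀ z < N, s'.arr a z = v z := by
  simp only [Bool.and_eq_true, decide_eq_true_eq] at hs
  obtain ⟨⟨⟨⟨⟨h1, h2⟩, h3⟩, h4⟩, h5⟩, h6⟩ := hs
  refine (Ok.for (K := K) hB (by simp [h1, h2, h3, Prog.regs]) hNW hNB
    (fun i s' => (∀ z < i, s'.arr a z = v z) ∧ ∀ z, i ≤ z → s'.arr a z = s.arr a z) (by simp) ?_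
    (fun s' _ h' => he s' h') ?_).mono (by omega) fun s' _ _ h => h.1.1
  · intro i s' w h
    simpa using h
  · intro i hi s' hB₁ h' hx hI
    have hev := hf i hi s' h' hx (hI.2 i le_rfl)
    refine Ok.put hB₁ ?_ trivial (f.safe_of_inner h5) i (v i) hx hev (hv i hi) ?_
    · simp [Expr.small, Expr.cost, h4]
      omega
    · simp only [State.arr_put, if_true]
      refine ⟨fun z hz => ?_, fun z hz => ?_⟩
      · rcases Nat.lt_succ_iff_lt_or_eq.1 hz with hz | rfl
        · rw [Function.update_of_ne (by omega), hI.1 z hz]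
        · simp
      · rw [Function.update_of_ne (by omega), hI.2 z (by omega)]

end Logic

end Fragment

namespace Fragment

/-! ### Local search -/

/-- The contents of the memory that are used, but not changed, in the construction of a net: `E`
external edges, of which the `k`-th one ends in the vertex `vx k`; `q` internal edges, of which
the `j`-th one has its ends in the slots `ea j` and `eb j`; the slot `sl v ≤ w` of each vertex. -/
structure Slots where
  N : ℕ
  w : ℕ
  nf : ℕ
  q : ℕ
  E : ℕ
  ea : ℕ → ℕ
  eb : ℕ → ℕ
  vx : ℕ → ℕ
  sl : ℕ → ℕ

/-- The memory contains the data `D`, which are bounded by `B`. -/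
structure Holds (W B : ℕ) (D : Slots) (s : State) : Prop where
  reg0 : s.reg 0 = D.E
  reg1 : s.reg 1 = D.N
  reg2 : s.reg 2 = D.w
  reg3 : s.reg 3 = D.nf
  reg4 : s.reg 4 = D.q
  arr14 : s.arr 14 = D.ea
  arr15 : s.arr 15 = D.eb
  arr12 : s.arr 12 = D.vx
  arr9 : s.arr 9 = D.sl
  ea_le : ∀ j < D.q, D.ea j ≤ D.w
  eb_le : ∀ j < D.q, D.eb j ≤ D.w
  sl_le : ∀ v, D.sl v ≤ D.w
  lt_N : D.w < D.N
  E_lt : D.E < B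
  w_lt : D.w + 1 < B
  nf_lt : D.nf < B
  q_lt : D.q < B
  B_le : 30 * B ≤ W

/-- The price of a set of slots. -/
noncomputable def Slots.price (D : Slots) (T Y : Set ℕ) : ℕ :=
  Fragment.price (Finset.range D.q) D.ea D.eb (Finset.range D.E) (fun k => D.sl (D.vx k)) T Y

/-- The set of the slots `z` for which the cell of the matrix `A` in row `x` and column `z` contains
`k`. -/
def Slots.row (D : Slots) (A : ℕ → ℕ) (x k : ℕ) : Set ℕ := {z | A (x * D.N + z) = k}

variable {ans : ℕ → List ℕ} {time : ℕ → ℕ} {W B : ℕ} {s : State} {K : ℕ} {D : Slots}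

/-- The shared data occupy the registers `0` to `4` and the arrays `9`, `12`, `14` and `15`; a
program that writes none of these preserves them. -/
theorem Holds.agree {p : Prog} {s' : State} (h : Holds W B D s) (hA : Agree p s s')
    (hr : (p.regs.all fun r => 5 ≤ r) = true)
    (ha : (p.arrs.all fun a => a != 9 && a != 12 && a != 14 && a != 15) = true) :
    Holds W B D s' := by
  simp only [List.all_eq_true, decide_eq_true_eq, Bool.and_eq_true, bne_iff_ne] at hr ha
  have h1 : ∀ x < 5, s'.reg x = s.reg x := fun x hx => hA.1 x fun h' => by
    have := hr x h'
    omega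
  refine ⟨?_, ?_, ?_, ?_, ?_, ?_, ?_, ?_, ?_, h.ea_le, h.eb_le, h.sl_le, h.lt_N, h.E_lt, h.w_lt,
    h.nf_lt, h.q_lt, h.B_le⟩
  · rw [h1 0 (by omega), h.reg0]
  · rw [h1 1 (by omega), h.reg1]
  · rw [h1 2 (by omega), h.reg2]
  · rw [h1 3 (by omega), h.reg3]
  · rw [h1 4 (by omega), h.reg4]
  · rw [hA.2 14 fun h' => (ha _ h').1.2 rfl, h.arr14]
  · rw [hA.2 15 fun h' => (ha _ h').2 rfl, h.arr15]
  · rw [hA.2 12 fun h' => (ha _ h').1.1.2 rfl, h.arr12]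
  · rw [hA.2 9 fun h' => (ha _ h').1.1.1 rfl, h.arr9]

/-- Only slots up to `w` occur as ends of edges, so what the arrays contain beyond them is
irrelevant to the price. -/
theorem Holds.price_congr (h : Holds W B D s) {T T' Y Y' : Set ℕ}
    (hT : ∀ z ≤ D.w, (z ∈ T ↔ z ∈ T')) (hY : ∀ z ≤ D.w, (z ∈ Y ↔ z ∈ Y')) :
    D.price T Y = D.price T' Y' := by
  refine congrArg₂ (· + ·) (cut_congr fun j hj => ?_) (mass_congr fun k _ => ?_)
  · have hj := Finset.mem_range.1 hj
    exact ⟨hY _ (h.ea_le j hj), hY _ (h.eb_le j hj)⟩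
  · simp only [Set.mem_symmDiff, hT _ (h.sl_le _), hY _ (h.sl_le _)]

theorem Slots.price_le (D : Slots) (T Y : Set ℕ) : D.price T Y ≤ D.q + D.E := by
  refine Nat.add_le_add ?_ ?_
  · refine (Finset.sum_le_card_nsmul _ _ 1 fun j _ => ?_).trans (by simp)
    split_ifs <;> simp
  · refine (Finset.sum_le_card_nsmul _ _ 1 fun j _ => ?_).trans (by simp)
    split_ifs <;> simp

/-- `1` if the values of `e` and `f` differ, and `0` otherwise. -/
def Expr.ne (e f : Expr) : Expr := .op .sub (.lit 1) (.op .eq e f)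

theorem Expr.eval_ne (s : State) (e f : Expr) :
    (Expr.ne e f).eval s = 1 - if e.eval s = f.eval s then 1 else 0 := rfl

/-- The cell of the matrix in row `x` and column `z`. -/
def Expr.cell (x z : Expr) : Expr := .get 11 (.op .add (.op .mul x (.reg 1)) z)

/-- Compute in register `r` the price of the set in the array `a`. -/
def priceProg (r a : ℕ) : Prog :=
  .seq (.sum 35 (.reg 4) r
    (.ne (.get a (.get 14 (.reg 35))) (.get a (.get 15 (.reg 35))))) <|
  .seq (.sum 36 (.reg 0) 44
    (.ne (.get a (.get 9 (.get 12 (.reg 36))))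
      (.cell (.op .add (.op .mul (.lit 2) (.reg 20)) (.lit 1)) (.get 9 (.get 12 (.reg 36)))))) <|
  .set r (.op .add (.reg r) (.reg 44))

theorem ne_eq_ite {u v : ℕ} (hu : u ≤ 1) (hv : v ≤ 1) {p : Prop} {_ : Decidable p}
    (hp : p ↔ (u = 1 ↔ v = 1)) : (1 - if u = v then 1 else 0) = if p then 0 else 1 := by
  by_cases h : p <;> interval_cases u <;> interval_cases v <;> simp_all

/-- Two instances are used: array `18` holds the current set, with its price in register `33`, and
array `19` holds the trial set, with its price in register `34`. The target is the member `i` of the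
family, stored in row `2 * i + 1`. -/
theorem priceProg_ok {r a i : ℕ} (hra : r = 33 ∧ a = 18 ∨ r = 34 ∧ a = 19) (hB : Bdd W s)
    (h : Holds W B D s) (hi : s.reg 20 = i) (hy : ∀ z ≤ D.w, s.arr a z ≤ 1)
    (hM : ∀ z ≤ D.w, s.arr 11 ((2 * i + 1) * D.N + z) ≤ 1) :
    Ok ans time W B (priceProg r a) s (K + 9) fun s' =>
      s'.reg r = D.price (D.row (s.arr 11) (2 * i + 1) 1) {z | s.arr a z = 1} := by
  generalize hyd : s.arr a = y at hy ⊢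
  have hBW := h.B_le
  have h1 := h.E_lt
  have h2 := h.q_lt
  have e1 : (∑ j ∈ Finset.range D.q, (1 - if y (D.ea j) = y (D.eb j) then 1 else 0)) =
      cut (Finset.range D.q) D.ea D.eb {z | y z = 1} := by
    refine Finset.sum_congr rfl fun j hj => ?_
    have hj := Finset.mem_range.1 hj
    exact ne_eq_ite (hy _ (h.ea_le j hj)) (hy _ (h.eb_le j hj)) Iff.rfl
  have e2 : (∑ k ∈ Finset.range D.E, (1 - if y (D.sl (D.vx k)) =
      s.arr 11 ((2 * i + 1) * D.N + D.sl (D.vx k)) then 1 else 0)) =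
      mass (Finset.range D.E) (fun k => D.sl (D.vx k))
        (symmDiff {z | y z = 1} (D.row (s.arr 11) (2 * i + 1) 1)) := by
    refine Finset.sum_congr rfl fun k hk => ?_
    have hz := h.sl_le (D.vx k)
    have g1 := hy _ hz
    have g2 := hM _ hz
    simp only [Set.mem_symmDiff, Slots.row, Set.mem_ofPred_eq]
    generalize y (D.sl (D.vx k)) = u at *
    generalize s.arr 11 ((2 * i + 1) * D.N + D.sl (D.vx k)) = v at *
    interval_cases u <;> interval_cases v <;> simp
  obtain ⟨rfl, rfl⟩ | ⟨rfl, rfl⟩ := hra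
  all_goals
    rw [priceProg]
    refine Ok.seq (Ok.sum (N := D.q) hB rfl (by omega) h2
      (fun j => 1 - if y (D.ea j) = y (D.eb j) then 1 else 0)
      (fun j => Nat.sub_le _ _) (fun s' hA => (hA.1 4 (by decide)).trans h.reg4)
      (fun j hj s' hA hx => ?_))
      fun s₁ hB₁ hA₁ hr₁ => ?_
    · simp only [Expr.eval_ne, Expr.eval, hx, hA.2 14 (by decide), hA.2 15 (by decide), h.arr14,
        h.arr15]
      first | rw [hA.2 18 (by decide), hyd] | rw [hA.2 19 (by decide), hyd]
    · refine Ok.seq (Ok.sum (N := D.E) hB₁ rfl (by omega) h1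
        (fun k => 1 - if y (D.sl (D.vx k)) =
          s.arr 11 ((2 * i + 1) * D.N + D.sl (D.vx k)) then 1 else 0)
        (fun j => Nat.sub_le _ _)
        (fun s' hA => (hA.1 0 (by decide)).trans ((hA₁.1 0 (by decide)).trans h.reg0))
        (fun k hk s' hA hx => ?_))
        fun s₂ hB₂ hA₂ hr₂ => ?_
      · simp only [Expr.eval_ne, Expr.cell, Expr.eval, Op.eval, hx, hA.2 12 (by decide),
          hA.2 9 (by decide), hA₁.2 12 (by decide), hA₁.2 9 (by decide), h.arr12, h.arr9,
          hA.1 20 (by decide), hA₁.1 20 (by decide), hi, hA.1 1 (by decide),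
          hA₁.1 1 (by decide), h.reg1, hA.2 11 (by decide), hA₁.2 11 (by decide)]
        first
          | rw [hA.2 18 (by decide), hA₁.2 18 (by decide), hyd]
          | rw [hA.2 19 (by decide), hA₁.2 19 (by decide), hyd]
      · have hval : D.price (D.row (s.arr 11) (2 * i + 1) 1) {z | y z = 1} = _ :=
          congrArg₂ (· + ·) e1.symm e2.symm
        refine Ok.set hB₂ rfl ⟨trivial, trivial⟩
          (D.price (D.row (s.arr 11) (2 * i + 1) 1) {z | y z = 1}) ?_
          ((D.price_le _ _).trans (by omega)) ?_
        · rw [hval]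
          simp only [Expr.eval, Op.eval, hr₂]
          first
            | rw [hA₂.1 33 (by decide), hr₁]
            | rw [hA₂.1 34 (by decide), hr₁]
        · simp

end Fragment

namespace Fragment

variable {ans : ℕ → List ℕ} {time : ℕ → ℕ} {W B : ℕ} {s : State} {K : ℕ} {D : Slots}

/-- The intersection (for `k = 0`) or the union (for `k = 1`) of `S` with a set that is given by a
row of the matrix. -/
def Slots.move (D : Slots) (A : ℕ → ℕ) (x k f : ℕ) (S : Set ℕ) : Set ℕ :=
  if k = 0 then S ∩ D.row A x f else S ∪ D.row A x f

/-- Whether the slot in register `37` belongs to the set obtained by the move in the registers `26`,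
`28` and `29`. -/
def moveExpr : Expr :=
  .op .lt (.lit 1) (.op .add (.op .add (.get 18 (.reg 37))
    (.op .eq (.cell (.reg 26) (.reg 37)) (.reg 29))) (.reg 28))

/-- Try the move in register `25`. -/
def moveProg : Prog :=
  .seq (.set 26 (.op .div (.reg 25) (.lit 4))) <|
  .seq (.set 27 (.op .sub (.reg 25) (.op .mul (.lit 4) (.reg 26)))) <|
  .seq (.set 28 (.op .div (.reg 27) (.lit 2))) <|
  .seq (.set 29 (.op .sub (.reg 27) (.op .mul (.lit 2) (.reg 28)))) <|
  .seq (.fill 37 (.op .add (.reg 2) (.lit 1)) 19 moveExpr) <|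
  .seq (priceProg 34 19) <|
  .ite (.op .lt (.reg 34) (.reg 33))
    (.seq (.fill 37 (.op .add (.reg 2) (.lit 1)) 18 (.get 19 (.reg 37))) <|
      .seq (.set 33 (.reg 34)) <| .set 25 (.lit 0))
    (.set 25 (.op .add (.reg 25) (.lit 1)))

/-- A move is coded by `c = 4 * x + 2 * k + f`: the row `x`, intersection or union `k`, and the
entry `f` that marks membership. After an improvement the counter returns to `0`; otherwise it
advances. -/
theorem moveProg_ok {i c : ℕ} (hB : Bdd W s) (h : Holds W B D s) (hi : s.reg 20 = i)
    (hy : ∀ z ≤ D.w, s.arr 18 z ≤ 1) (hM : ∀ x, ∀ z ≤ D.w, s.arr 11 (x * D.N + z) ≤ 1)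
    (hc : s.reg 25 = c) (hcL : c < 8 * (D.w + D.nf + 1)) (T : Set ℕ)
    (hT : T = D.row (s.arr 11) (2 * i + 1) 1) (hp : s.reg 33 = D.price T {z | s.arr 18 z = 1}) :
    Ok ans time W B moveProg s (K + 17) fun s' =>
      (∀ z ≤ D.w, s'.arr 18 z ≤ 1) ∧ s'.reg 33 = D.price T {z | s'.arr 18 z = 1} ∧
      (D.price T {z | s'.arr 18 z = 1} < D.price T {z | s.arr 18 z = 1} ∧ s'.reg 25 = 0 ∨
        s'.arr 18 = s.arr 18 ∧ s'.reg 25 = c + 1 ∧ ∀ x k f, k < 2 → f < 2 → c = 4 * x + 2 * k + f →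
        D.price T {z | s.arr 18 z = 1} ≤
          D.price T (D.move (s.arr 11) x k f {z | s.arr 18 z = 1})) := by
  have h1 := h.w_lt
  have h2 := h.nf_lt
  have h3 := h.B_le
  have hW := hB.ten_le
  rw [moveProg]
  refine Ok.set_seq hB rfl ⟨trivial, trivial⟩ (c / 4) (by simp [Expr.eval, Op.eval, hc])
    (by omega) fun hB => ?_
  refine Ok.set_seq hB rfl ⟨trivial, trivial, trivial⟩ (c - 4 * (c / 4))
    (by simp [Expr.eval, Op.eval, hc]) (by omega) fun hB => ?_
  refine Ok.set_seq hB rfl ⟨trivial, trivial⟩ ((c - 4 * (c / 4)) / 2)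
    (by simp [Expr.eval, Op.eval]) (by omega) fun hB => ?_
  refine Ok.set_seq hB rfl ⟨trivial, trivial, trivial⟩
    ((c - 4 * (c / 4)) - 2 * ((c - 4 * (c / 4)) / 2)) (by simp [Expr.eval, Op.eval]) (by omega)
    fun hB => ?_
  obtain ⟨x, hx⟩ : ∃ x, x = c / 4 := ⟨_, rfl⟩
  obtain ⟨k, hk⟩ : ∃ k, k = (c - 4 * (c / 4)) / 2 := ⟨_, rfl⟩
  obtain ⟨f, hf⟩ : ∃ f, f = (c - 4 * (c / 4)) - 2 * ((c - 4 * (c / 4)) / 2) := ⟨_, rfl⟩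
  have hk2 : k < 2 := by omega
  have hf2 : f < 2 := by omega
  rw [← hf, ← hk, ← hx] at hB ⊢
  generalize c - 4 * x = r27 at hB ⊢
  generalize hs₁ : (((s.set 26 x).set 27 r27).set 28 k).set 29 f = s₁ at hB ⊢
  have h₁ : Holds W B D s₁ := by
    subst hs₁
    exact ⟨h.reg0, h.reg1, h.reg2, h.reg3, h.reg4, h.arr14, h.arr15, h.arr12, h.arr9, h.ea_le,
      h.eb_le, h.sl_le, h.lt_N, h.E_lt, h.w_lt, h.nf_lt, h.q_lt, h.B_le⟩
  have r26 : s₁.reg 26 = x := by simp [← hs₁]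
  have r28 : s₁.reg 28 = k := by simp [← hs₁]
  have r29 : s₁.reg 29 = f := by simp [← hs₁]
  have r25 : s₁.reg 25 = c := by simp [← hs₁, hc]
  have r20 : s₁.reg 20 = i := by simp [← hs₁, hi]
  have r33 : s₁.reg 33 = D.price T {z | s.arr 18 z = 1} := by simp [← hs₁, hp]
  have a11 : s₁.arr 11 = s.arr 11 := by simp [← hs₁]
  have a18 : s₁.arr 18 = s.arr 18 := by simp [← hs₁]
  -- A threshold realizes both moves: two of the bits must be set for `k = 0`, one for `k = 1`.
  have hv : ∀ z ≤ D.w, ((if 1 < s.arr 18 z + (if s.arr 11 (x * D.N + z) = f then 1 else 0) + k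
      then 1 else 0) = 1 ↔ z ∈ D.move (s.arr 11) x k f {z | s.arr 18 z = 1}) := by
    intro z hz
    have g1 := hy z hz
    rw [Slots.move]
    interval_cases k <;> interval_cases hyz : s.arr 18 z <;>
      by_cases g2 : s.arr 11 (x * D.N + z) = f <;> simp [Slots.row, g2, hyz]
  refine Ok.seq (Ok.fill (N := D.w + 1) hB rfl (by omega) h1 (fun z =>
      if 1 < s.arr 18 z + (if s.arr 11 (x * D.N + z) = f then 1 else 0) + k then 1 else 0)
      (fun z _ => by split_ifs <;> omega) (fun s' hA => ?_) fun z hz s' hA hxz _ => ?_)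
      fun s₂ hB₂ hA₂ hI₂ => ?_
  · simp [Expr.eval, Op.eval, hA.1 2 (by decide), h₁.reg2]
  · simp only [moveExpr, Expr.cell, Expr.eval, Op.eval, hxz, hA.1 26 (by decide),
      hA.1 28 (by decide), hA.1 29 (by decide), hA.1 1 (by decide), hA.2 11 (by decide),
      hA.2 18 (by decide), r26, r28, r29, h₁.reg1, a11, a18]
  have h₂ := h₁.agree hA₂ rfl rfl
  have a11' : s₂.arr 11 = s.arr 11 := (hA₂.2 11 (by decide)).trans a11
  refine Ok.seq (priceProg_ok (Or.inr ⟨rfl, rfl⟩) hB₂ h₂ ((hA₂.1 20 (by decide)).trans r20)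
    (fun z hz => ?_) fun z hz => ?_) fun s₃ hB₃ hA₃ hr₃ => ?_
  · rw [hI₂ z (by omega)]
    split_ifs <;> omega
  · rw [a11']
    exact hM _ z hz
  have h₃ := h₂.agree hA₃ rfl rfl
  rw [a11', ← hT, h.price_congr (Y' := D.move (s.arr 11) x k f {z | s.arr 18 z = 1})
    (fun _ _ => Iff.rfl) fun z hz => by
      rw [← hv z hz, Set.mem_ofPred_eq, hI₂ z (by omega)]] at hr₃
  have hr₃' : s₃.reg 33 = D.price T {z | s.arr 18 z = 1} := by
    rw [hA₃.1 33 (by decide), hA₂.1 33 (by decide), r33]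
  have a18₃ : s₃.arr 18 = s.arr 18 := by
    rw [hA₃.2 18 (by decide), hA₂.2 18 (by decide), a18]
  refine Ok.ite hB₃ rfl ⟨trivial, trivial⟩ (fun hlt => ?_) fun hlt => ?_
  · have hlt : D.price T (D.move (s.arr 11) x k f {z | s.arr 18 z = 1}) <
        D.price T {z | s.arr 18 z = 1} := by
      by_contra hcon
      simp [Expr.eval, Op.eval, hr₃, hr₃', hcon] at hlt
    refine Ok.seq (Ok.fill (N := D.w + 1) hB₃ rfl (by omega) h1 (fun z =>
      if 1 < s.arr 18 z + (if s.arr 11 (x * D.N + z) = f then 1 else 0) + k then 1 else 0)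
      (fun z _ => by split_ifs <;> omega) (fun s' hA => ?_) fun z hz s' hA hxz _ => ?_)
      fun s₄ hB₄ hA₄ hI₄ => ?_
    · simp [Expr.eval, Op.eval, hA.1 2 (by decide), h₃.reg2]
    · simp only [Expr.eval, hxz, hA.2 19 (by decide), hA₃.2 19 (by decide)]
      exact hI₂ z hz
    have hp₄ : D.price T {z | s₄.arr 18 z = 1} =
        D.price T (D.move (s.arr 11) x k f {z | s.arr 18 z = 1}) :=
      h.price_congr (fun _ _ => Iff.rfl) fun z hz => by
        rw [← hv z hz, Set.mem_ofPred_eq, hI₄ z (by omega)]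
    refine Ok.set_seq hB₄ rfl trivial _ ((hA₄.1 34 (by decide)).trans hr₃)
      ((D.price_le _ _).trans ?_) fun hB₅ => ?_
    · have := h.E_lt
      have := h.q_lt
      omega
    refine Ok.set hB₅ rfl trivial 0 rfl (Nat.zero_le _) ⟨fun z hz => ?_, ?_, Or.inl ⟨?_, ?_⟩⟩
    · simp only [State.arr_set]
      rw [hI₄ z (by omega)]
      split_ifs <;> omega
    · simp [hp₄]
    · simpa [hp₄] using hlt
    · simp
  · have hlt : D.price T {z | s.arr 18 z = 1} ≤
        D.price T (D.move (s.arr 11) x k f {z | s.arr 18 z = 1}) := by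
      by_contra hcon
      simp [Expr.eval, Op.eval, hr₃, hr₃', hcon] at hlt
    have r25₃ : s₃.reg 25 = c := by rw [hA₃.1 25 (by decide), hA₂.1 25 (by decide), r25]
    refine Ok.set hB₃ rfl ⟨trivial, trivial⟩ (c + 1) (by simp [Expr.eval, Op.eval, r25₃])
      (by omega) ⟨?_, ?_, Or.inr ⟨?_, ?_, ?_⟩⟩
    · simpa [a18₃] using hy
    · simp [hr₃', a18₃]
    · simp [a18₃]
    · simp
    · intro x' k' f' hk' hf' hc'
      obtain rfl : x' = x := by omega
      obtain rfl : k' = k := by omega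
      obtain rfl : f' = f := by omega
      exact hlt

/-- Improve the set in the array `18` until no move makes its price smaller. -/
def searchProg : Prog :=
  .seq (.set 25 (.lit 0)) <|
  .seq (priceProg 33 18) <|
  .loop (.op .lt (.reg 25) (.op .mul (.lit 8) (.op .add (.op .add (.reg 2) (.reg 3)) (.lit 1))))
    moveProg

/-- When the counter has run through all codes, every move has failed against the same set, which is
then locally optimal. Nothing is assumed about the initial set except that it consists of bits, so
the result of the previous search can serve as the start. The rows below `2 * (w + nf + 1)` include
all the even rows of slots and all the odd rows of the family. -/
theorem searchProg_ok {i : ℕ} (hB : Bdd W s) (h : Holds W B D s) (hi : s.reg 20 = i)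
    (hy : ∀ z ≤ D.w, s.arr 18 z ≤ 1) (hM : ∀ x, ∀ z ≤ D.w, s.arr 11 (x * D.N + z) ≤ 1) :
    Ok ans time W B searchProg s (K + 26) fun s' => (∀ z ≤ D.w, s'.arr 18 z ≤ 1) ∧
      ∀ x < 2 * (D.w + D.nf + 1), ∀ k < 2, ∀ f < 2,
        D.price (D.row (s.arr 11) (2 * i + 1) 1) {z | s'.arr 18 z = 1} ≤
          D.price (D.row (s.arr 11) (2 * i + 1) 1)
            (D.move (s.arr 11) x k f {z | s'.arr 18 z = 1}) := by
  have h1 := h.w_lt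
  have h2 := h.nf_lt
  have h3 := h.B_le
  have h4 := h.E_lt
  have h5 := h.q_lt
  have hW := hB.ten_le
  obtain ⟨T, hT⟩ : ∃ T, T = D.row (s.arr 11) (2 * i + 1) 1 := ⟨_, rfl⟩
  obtain ⟨L, hL⟩ : ∃ L, L = 8 * (D.w + D.nf + 1) := ⟨_, rfl⟩
  rw [← hT, searchProg]
  refine Ok.set_seq hB rfl trivial 0 rfl (Nat.zero_le _) fun hB₀ => ?_
  have h₀ : Holds W B D (s.set 25 0) :=
    ⟨h.reg0, h.reg1, h.reg2, h.reg3, h.reg4, h.arr14, h.arr15, h.arr12, h.arr9, h.ea_le,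
      h.eb_le, h.sl_le, h.lt_N, h.E_lt, h.w_lt, h.nf_lt, h.q_lt, h.B_le⟩
  refine Ok.seq (R := fun s' => s'.reg 33 = D.price T {z | s.arr 18 z = 1})
    ((priceProg_ok (K := K + 14) (i := i) (Or.inl ⟨rfl, rfl⟩) hB₀ h₀ (by simp [hi]) hy
      (hM _)).mono (by omega) fun s' _ _ h => by rw [hT]; exact h) fun s₁ hB₁ hA₁ hr₁ => ?_
  have h₁ := h₀.agree hA₁ rfl rfl
  have a11 : s₁.arr 11 = s.arr 11 := hA₁.2 11 (by decide)
  have a18 : s₁.arr 18 = s.arr 18 := hA₁.2 18 (by decide)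
  -- The variant is lexicographic: an improvement lowers the price, worth `L + 1`, against which
  -- resetting the counter restores at most `L`; a failed move advances the counter.
  refine Ok.mono (Ok.loop (K := K + 17) (J := 6) (k := D.price T {z | s.arr 18 z = 1} * (L + 1) + L)
    (fun k s' => (∀ z ≤ D.w, s'.arr 18 z ≤ 1) ∧ s'.reg 25 ≤ L ∧
      s'.reg 33 = D.price T {z | s'.arr 18 z = 1} ∧
      k = D.price T {z | s'.arr 18 z = 1} * (L + 1) + (L - s'.reg 25) ∧
      ∀ x k f, k < 2 → f < 2 → 4 * x + 2 * k + f < s'.reg 25 → D.price T {z | s'.arr 18 z = 1} ≤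
        D.price T (D.move (s.arr 11) x k f {z | s'.arr 18 z = 1}))
    rfl hB₁ ?_ ?_ ?_ ?_) (by omega) fun _ _ _ h => h
  · have r25 : s₁.reg 25 = 0 := by rw [hA₁.1 25 (by decide)]; simp
    refine ⟨by simpa [a18] using hy, by omega, by rw [a18, hr₁], by rw [a18, r25, Nat.sub_zero],
      fun x k f _ _ h => by omega⟩
  · intro hB100
    have h6 : D.price T {z | s.arr 18 z = 1} ≤ 2 * B := (D.price_le _ _).trans (by omega)
    have h7 : L + 1 ≤ 20 * B := by omega
    have h8 : D.price T {z | s.arr 18 z = 1} * (L + 1) ≤ 2 * B * (20 * B) := Nat.mul_le_mul h6 h7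
    have h9 : 2 * B * (20 * B) + 20 * B ≤ B ^ 6 := by
      have e1 : 100 ^ 4 * B ^ 2 ≤ B ^ 6 :=
        (Nat.mul_le_mul_right _ (Nat.pow_le_pow_left hB100 4)).trans (le_of_eq (by ring))
      nlinarith
    omega
  · rintro k s' hB' hA' ⟨g1, g2, g3, g4, g5⟩ hc
    have hh := h₁.agree hA' rfl rfl
    have hc : L ≤ s'.reg 25 := by
      by_contra hcon
      rw [hL] at hcon
      simp [Expr.eval, Op.eval, hh.reg2, hh.reg3] at hc
      omega
    refine ⟨g1, fun x hx k hk f hf => g5 x k f hk hf (by omega)⟩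
  · rintro k s' hB' hA' ⟨g1, g2, g3, g4, g5⟩ hc
    have hh := h₁.agree hA' rfl rfl
    have a11' : s'.arr 11 = s.arr 11 := (hA'.2 11 (by decide)).trans a11
    have hc : s'.reg 25 < L := by
      by_contra hcon
      rw [hL] at hcon
      simp [Expr.eval, Op.eval, hh.reg2, hh.reg3, hcon] at hc
    refine (moveProg_ok (K := K) (i := i) (c := s'.reg 25) hB' hh ?_ g1 (by rwa [a11']) rfl
      (by omega) T (by rw [a11', hT]) g3).mono le_rfl ?_
    · rw [hA'.1 20 (by decide), hA₁.1 20 (by decide)]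
      simp [hi]
    · rintro s'' hB'' hA'' ⟨f1, f2, f3⟩
      rcases f3 with ⟨f3, f4⟩ | ⟨f3, f4, f5⟩
      · refine ⟨_, ?_, f1, by omega, f2, rfl, fun x k f _ _ h => by omega⟩
        rw [g4, f4, Nat.sub_zero]
        have := Nat.mul_le_mul_right (L + 1) (Nat.succ_le_of_lt f3)
        rw [Nat.succ_mul] at this
        omega
      · refine ⟨_, ?_, f1, by omega, f2, rfl, fun x k f hk hf hlt => ?_⟩
        · rw [g4, f3, f4]
          omega
        · rw [f3]
          rcases Nat.lt_or_ge (4 * x + 2 * k + f) (s'.reg 25) with hlt' | hge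
          · exact g5 x k f hk hf hlt'
          · rw [← a11']
            exact f5 x k f hk hf (by omega)

end Fragment

/-! ### The separation matrix and the greedy construction of the net. -/

namespace Fragment

variable {ans : ℕ → List ℕ} {time : ℕ → ℕ} {W B : ℕ} {s : State} {K : ℕ} {D : Slots}

theorem cell_inj {N x x' z z' : ℕ} (hz : z < N) (hz' : z' < N) :
    x * N + z = x' * N + z' ↔ x = x' ∧ z = z' := by
  refine ⟨fun h => ?_, by rintro ⟨rfl, rfl⟩; rfl⟩
  have h1 := congrArg (· / N) h
  have h2 := congrArg (· % N) h
  simp only [Nat.add_comm (_ * N), Nat.add_mul_div_right _ _ (show 0 < N by omega),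
    Nat.add_mul_mod_self_right, Nat.div_eq_of_lt hz, Nat.div_eq_of_lt hz', Nat.mod_eq_of_lt hz,
    Nat.mod_eq_of_lt hz'] at h1 h2
  omega

/-- Mark in the matrix the pairs of slots that are separated by the set in the array `18`. -/
def updateProg : Prog :=
  .for 42 (.op .add (.reg 2) (.lit 1)) <| .for 43 (.op .add (.reg 2) (.lit 1)) <|
    .ite (.op .eq (.get 18 (.reg 42)) (.get 18 (.reg 43))) .skip
      (.put 11 (.op .add (.op .mul (.op .mul (.lit 2) (.reg 42)) (.reg 1)) (.reg 43)) (.lit 1))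

-- Row `2 * x` accumulates the slots that some approximation separates from the slot `x`, so its
-- zero entries form the cell of `x`. Marks are only added, and the odd rows are left alone.
open scoped Classical in
theorem updateProg_ok (hB : Bdd W s) (h : Holds W B D s) :
    Ok ans time W B updateProg s (K + 12) fun s' => ∀ x, ∀ z ≤ D.w, s'.arr 11 (x * D.N + z) =
      if ∃ x' ≤ D.w, x = 2 * x' ∧ s.arr 18 x' ≠ s.arr 18 z then 1 else s.arr 11 (x * D.N + z) := by
  have h1 := h.w_lt
  have h3 := h.B_le
  have h4 := h.lt_N
  have hW := hB.ten_le
  refine Ok.mono (Ok.for (K := K + 6) (N := D.w + 1) hB rfl (by omega) h1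
    (fun i s' => ∀ x, ∀ z ≤ D.w, s'.arr 11 (x * D.N + z) =
      if ∃ x' < i, x = 2 * x' ∧ s.arr 18 x' ≠ s.arr 18 z then 1 else s.arr 11 (x * D.N + z))
    (by simp) (fun i s' v hI => by simpa using hI) (fun s' _ hA => ?_) ?_) (by omega)
    fun s' _ _ h => by simpa only [Nat.lt_succ_iff] using h.1
  · simp [Expr.eval, Op.eval, hA.1 2 (by decide), h.reg2]
  intro i hi s₁ hB₁ hA₁ hx₁ hI₁
  -- Lexicographic progress: rows before `i` are complete, row `i` is complete up to column `j`.
  refine Ok.mono (Ok.for (K := K + 1) (N := D.w + 1) hB₁ rfl (by omega) h1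
    (fun j s' => ∀ x, ∀ z ≤ D.w, s'.arr 11 (x * D.N + z) =
      if ∃ x' ≤ i, x = 2 * x' ∧ s.arr 18 x' ≠ s.arr 18 z ∧ (x' < i ∨ z < j)
      then 1 else s.arr 11 (x * D.N + z))
    (fun x z hz => ?_) (fun i s' v hI => by simpa using hI) (fun s' _ hA => ?_) ?_) (by omega)
    fun s' _ _ h x z hz => ?_
  · rw [hI₁ x z hz]
    congr 1
    refine propext ⟨?_, ?_⟩
    · rintro ⟨x', hx', e1, e2⟩
      exact ⟨x', hx'.le, e1, e2, Or.inl hx'⟩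
    · rintro ⟨x', hx', e1, e2, e3⟩
      exact ⟨x', by omega, e1, e2⟩
  · simp [Expr.eval, Op.eval, hA.1 2 (by decide), hA₁.1 2 (by decide), h.reg2]
  · intro j hj s₂ hB₂ hA₂ hx₂ hI₂
    have r42 : s₂.reg 42 = i := (hA₂.1 42 (by decide)).trans hx₁
    have a18 : s₂.arr 18 = s.arr 18 := (hA₂.2 18 (by decide)).trans (hA₁.2 18 (by decide))
    have r1 : s₂.reg 1 = D.N :=
      (hA₂.1 1 (by decide)).trans ((hA₁.1 1 (by decide)).trans h.reg1)
    refine Ok.ite hB₂ rfl (Expr.safe_of_inner _ rfl) (fun hc => ?_) fun hc => ?_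
    · have hc : s.arr 18 i = s.arr 18 j := by
        by_contra hcon
        simp [Expr.eval, Op.eval, r42, hx₂, a18, hcon] at hc
      refine Ok.skip hB₂ fun x z hz => ?_
      rw [hI₂ x z hz]
      congr 1
      refine propext ⟨?_, ?_⟩
      · rintro ⟨x', hx', e1, e2, e3⟩
        exact ⟨x', hx', e1, e2, by omega⟩
      · rintro ⟨x', hx', e1, e2, e3⟩
        refine ⟨x', hx', e1, e2, ?_⟩
        by_contra hcon
        obtain rfl : x' = i := by omega
        obtain rfl : z = j := by omega
        exact e2 hc
    · have hc : s.arr 18 i ≠ s.arr 18 j := by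
        intro hcon
        simp [Expr.eval, Op.eval, r42, hx₂, a18, hcon] at hc
      refine Ok.put hB₂ rfl ⟨⟨⟨trivial, trivial⟩, trivial⟩, trivial⟩ trivial (2 * i * D.N + j) 1
        (by simp [Expr.eval, Op.eval, r42, r1, hx₂]) rfl (by omega) fun x z hz => ?_
      simp only [State.arr_put, if_true, Function.update_apply,
        cell_inj (show z < D.N by omega) (show j < D.N by omega)]
      by_cases he : x = 2 * i ∧ z = j
      · rw [if_pos he, if_pos]
        exact ⟨i, le_rfl, he.1, he.2 ▸ hc, Or.inr (by omega)⟩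
      · rw [if_neg he, hI₂ x z hz]
        congr 1
        refine propext ⟨?_, ?_⟩
        · rintro ⟨x', hx', e1, e2, e3⟩
          exact ⟨x', hx', e1, e2, by omega⟩
        · rintro ⟨x', hx', e1, e2, e3⟩
          exact ⟨x', hx', e1, e2, by
            by_contra hcon
            exact he ⟨by omega, by omega⟩⟩
  · rw [h.1 x z hz]
    congr 1
    refine propext ⟨?_, ?_⟩
    · rintro ⟨x', hx', e1, e2, e3⟩
      exact ⟨x', by omega, e1, e2⟩
    · rintro ⟨x', hx', e1, e2⟩
      exact ⟨x', by omega, e1, e2, Or.inr (by omega)⟩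

/-- Whether the threshold in the registers `30`, `31` and `32` is at least the number in register
`23`. -/
def closeExpr : Expr :=
  .op .sub (.lit 1) (.op .lt (.op .mul (.reg 30) (.reg 32))
    (.op .mul (.op .mul (.lit 5) (.reg 23)) (.reg 31)))

/-- Count in register `21` the members of the net that are close to the set number `i` of the
family, where `i` is the content of register `20`. -/
def closeProg : Prog :=
  .seq (.set 21 (.lit 0)) <| .for 22 (.reg 20) <|
    .seq (.sum 24 (.reg 0) 23 (.ne
      (.cell (.op .add (.op .mul (.lit 2) (.reg 20)) (.lit 1)) (.get 9 (.get 12 (.reg 24))))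
      (.cell (.op .add (.op .mul (.lit 2) (.reg 22)) (.lit 1)) (.get 9 (.get 12 (.reg 24)))))) <|
    .set 21 (.op .add (.reg 21) (.op .mul (.get 17 (.reg 22)) closeExpr))

/-- Register `21` counts members of the net within the threshold; only whether it is zero matters.
The threshold test is done in integers, and `hη` ties it to the real number `η`. -/
theorem closeProg_ok {i : ℕ} (hB : Bdd W s) (h : Holds W B D s) (hi : s.reg 20 = i)
    (hin : i < D.nf) (hM : ∀ x, ∀ z ≤ D.w, s.arr 11 (x * D.N + z) ≤ 1) {J : Finset ℕ}
    (hJ : ∀ j, s.arr 17 j = if j ∈ J then 1 else 0) {η : ℝ}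
    (hη : ∀ c : ℕ, 5 * c * s.reg 31 ≤ s.reg 30 * s.reg 32 ↔ (c : ℝ) ≤ η) :
    Ok ans time W B closeProg s (K + 16) fun s' => s'.reg 21 ≠ 0 ↔ ∃ j < i, j ∈ J ∧
      (mass (Finset.range D.E) (fun k => D.sl (D.vx k)) (symmDiff (D.row (s.arr 11) (2 * i + 1) 1)
        (D.row (s.arr 11) (2 * j + 1) 1)) : ℝ) ≤ η := by
  have h1 := h.nf_lt
  have h2 := h.E_lt
  have h3 := h.B_le
  refine Ok.set_seq hB rfl trivial 0 rfl (Nat.zero_le _) fun hB₀ => ?_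
  refine Ok.mono (Ok.for (K := K + 8) (N := i) hB₀ rfl (by omega) (by omega)
    (fun j s' => s'.reg 21 ≤ j ∧ (s'.reg 21 ≠ 0 ↔ ∃ j' < j, j' ∈ J ∧
      (mass (Finset.range D.E) (fun k => D.sl (D.vx k)) (symmDiff (D.row (s.arr 11) (2 * i + 1) 1)
        (D.row (s.arr 11) (2 * j' + 1) 1)) : ℝ) ≤ η)) (by simp)
    (fun i s' v hI => by simpa using hI) (fun s' _ hA => ?_) ?_) (by omega) fun _ _ _ h => h.1.2
  · simp only [Expr.eval]
    rw [hA.1 20 (by decide)]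
    simp [hi]
  intro j hj s₁ hB₁ hA₁ hx₁ hI₁
  have r20 : s₁.reg 20 = i := by rw [hA₁.1 20 (by decide)]; simp [hi]
  have r0 : s₁.reg 0 = D.E := by rw [hA₁.1 0 (by decide)]; simp [h.reg0]
  have r1 : s₁.reg 1 = D.N := by rw [hA₁.1 1 (by decide)]; simp [h.reg1]
  have a11 : s₁.arr 11 = s.arr 11 := hA₁.2 11 (by decide)
  have a12 : s₁.arr 12 = D.vx := (hA₁.2 12 (by decide)).trans h.arr12
  have a9 : s₁.arr 9 = D.sl := (hA₁.2 9 (by decide)).trans h.arr9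
  have a17 : s₁.arr 17 = s.arr 17 := hA₁.2 17 (by decide)
  have r30 : s₁.reg 30 = s.reg 30 := by rw [hA₁.1 30 (by decide)]; simp
  have r31 : s₁.reg 31 = s.reg 31 := by rw [hA₁.1 31 (by decide)]; simp
  have r32 : s₁.reg 32 = s.reg 32 := by rw [hA₁.1 32 (by decide)]; simp
  have hmass : (∑ k ∈ Finset.range D.E, (1 - if s.arr 11 ((2 * i + 1) * D.N + D.sl (D.vx k)) =
      s.arr 11 ((2 * j + 1) * D.N + D.sl (D.vx k)) then 1 else 0)) =
      mass (Finset.range D.E) (fun k => D.sl (D.vx k))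
        (symmDiff (D.row (s.arr 11) (2 * i + 1) 1) (D.row (s.arr 11) (2 * j + 1) 1)) := by
    refine Finset.sum_congr rfl fun k hk => ?_
    have hz := h.sl_le (D.vx k)
    have g1 := hM (2 * i + 1) _ hz
    have g2 := hM (2 * j + 1) _ hz
    simp only [Set.mem_symmDiff, Slots.row, Set.mem_ofPred_eq]
    generalize s.arr 11 ((2 * i + 1) * D.N + D.sl (D.vx k)) = u at *
    generalize s.arr 11 ((2 * j + 1) * D.N + D.sl (D.vx k)) = v at *
    interval_cases u <;> interval_cases v <;> simp
  refine Ok.seq (Ok.sum (N := D.E) hB₁ rfl (by omega) h2 (fun k => 1 -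
    if s.arr 11 ((2 * i + 1) * D.N + D.sl (D.vx k)) =
      s.arr 11 ((2 * j + 1) * D.N + D.sl (D.vx k)) then 1 else 0) (fun k => Nat.sub_le _ _)
    (fun s' hA => (hA.1 0 (by decide)).trans r0) fun k hk s' hA hx => ?_) fun s₂ hB₂ hA₂ hr₂ => ?_
  · simp only [Expr.eval_ne, Expr.cell, Expr.eval, Op.eval, hA.1 20 (by decide),
      hA.1 22 (by decide), hA.1 1 (by decide), hA.2 11 (by decide), hA.2 9 (by decide),
      hA.2 12 (by decide), r20, r1, a11, a12, a9, hx, hx₁]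
  rw [hmass] at hr₂
  obtain ⟨c, hc⟩ : ∃ c, c = mass (Finset.range D.E) (fun k => D.sl (D.vx k))
    (symmDiff (D.row (s.arr 11) (2 * i + 1) 1) (D.row (s.arr 11) (2 * j + 1) 1)) := ⟨_, rfl⟩
  rw [← hc] at hr₂
  obtain ⟨hI1, hI2⟩ := hI₁
  have hstep : ∀ b, (b ≤ 1 ∧ (b ≠ 0 ↔ j ∈ J ∧ (c : ℝ) ≤ η)) → s₁.reg 21 + b ≤ j + 1 ∧
      (s₁.reg 21 + b ≠ 0 ↔ ∃ j' < j + 1, j' ∈ J ∧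
      (mass (Finset.range D.E) (fun k => D.sl (D.vx k)) (symmDiff (D.row (s.arr 11) (2 * i + 1) 1)
        (D.row (s.arr 11) (2 * j' + 1) 1)) : ℝ) ≤ η) := by
    rintro b ⟨hb1, hb2⟩
    refine ⟨by omega, ?_⟩
    have e1 : s₁.reg 21 + b ≠ 0 ↔ s₁.reg 21 ≠ 0 ∨ b ≠ 0 := by omega
    rw [e1, hI2, hb2, hc]
    constructor
    · rintro (⟨j', h1, h2⟩ | h1)
      · exact ⟨j', by omega, h2⟩
      · exact ⟨j, by omega, h1⟩
    · rintro ⟨j', h1, h2⟩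
      rcases Nat.lt_succ_iff_lt_or_eq.1 h1 with h1 | rfl
      · exact Or.inl ⟨j', h1, h2⟩
      · exact Or.inr h2
  obtain ⟨hS1, hS2⟩ := hstep ((if j ∈ J then 1 else 0) *
    (1 - if s.reg 30 * s.reg 32 < 5 * c * s.reg 31 then 1 else 0)) (by
      rw [← hη]
      by_cases h1 : j ∈ J <;> by_cases h2 : s.reg 30 * s.reg 32 < 5 * c * s.reg 31 <;>
        (simp [h1, h2]; try omega))
  refine Ok.set hB₂ rfl (Expr.safe_of_inner _ rfl) _ ?_ (hS1.trans (by omega)) ⟨?_, ?_⟩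
  · simp only [closeExpr, Expr.eval, Op.eval, hr₂, hA₂.1 21 (by decide), hA₂.1 22 (by decide),
      hA₂.2 17 (by decide), hA₂.1 30 (by decide), hA₂.1 31 (by decide), hA₂.1 32 (by decide),
      r30, r31, r32, a17, hx₁, hJ]
  · simpa using hS1
  · simpa using hS2

/-- The construction of a net. -/
def netProg : Prog :=
  .for 20 (.reg 3) <| .seq closeProg <| .ite (.reg 21) .skip <|
    .seq (.put 17 (.reg 20) (.lit 1)) <| .seq searchProg updateProg

/-- The loop keeps the odd rows, which describe the family, equal to their initial contents, and the
even rows equal to the separation relation of the approximations found so far. The second fact lets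
cells be used as moves by row number, and at the end it tells which edges are to be cut. -/
theorem netProg_ok (hB : Bdd W s) (h : Holds W B D s)
    (hM : ∀ x, ∀ z ≤ D.w, s.arr 11 (x * D.N + z) ≤ 1)
    (hM0 : ∀ x ≤ D.w, ∀ z ≤ D.w, s.arr 11 (2 * x * D.N + z) = 0)
    (h17 : ∀ j, s.arr 17 j = 0) (h18 : ∀ z, s.arr 18 z = 0) {η : ℝ} (hη0 : 0 ≤ η)
    (hη : ∀ c : ℕ, 5 * c * s.reg 31 ≤ s.reg 30 * s.reg 32 ↔ (c : ℝ) ≤ η) :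
    Ok ans time W B netProg s (K + 40) fun s' => ∃ (J : Finset ℕ) (Y : ℕ → Set ℕ),
      IsNet (Finset.range D.q) D.ea D.eb (Finset.range D.E) (fun k => D.sl (D.vx k)) η
        {v | v ≤ D.w} D.nf D.nf (fun f => D.row (s.arr 11) (2 * f + 1) 1) J Y ∧
      ∀ x ≤ D.w, ∀ z ≤ D.w,
        (s'.arr 11 (2 * x * D.N + z) ≠ 0 ↔ ∃ j ∈ J, ¬(x ∈ Y j ↔ z ∈ Y j)) := by
  have h1 := h.nf_lt
  have h3 := h.B_le
  have hW := hB.ten_le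
  refine Ok.mono (Ok.for (K := K + 30) (N := D.nf) hB rfl (by omega) h1
    (fun i s' => (∀ z ≤ D.w, s'.arr 18 z ≤ 1) ∧ (∀ x, ∀ z ≤ D.w, s'.arr 11 (x * D.N + z) ≤ 1) ∧
      (∀ f, ∀ z ≤ D.w, s'.arr 11 ((2 * f + 1) * D.N + z) = s.arr 11 ((2 * f + 1) * D.N + z)) ∧
      ∃ (J : Finset ℕ) (Y : ℕ → Set ℕ), (∀ j, s'.arr 17 j = if j ∈ J then 1 else 0) ∧
      IsNet (Finset.range D.q) D.ea D.eb (Finset.range D.E) (fun k => D.sl (D.vx k)) η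
        {v | v ≤ D.w} D.nf i (fun f => D.row (s.arr 11) (2 * f + 1) 1) J Y ∧
      ∀ x ≤ D.w, ∀ z ≤ D.w,
        (s'.arr 11 (2 * x * D.N + z) ≠ 0 ↔ ∃ j ∈ J, ¬(x ∈ Y j ↔ z ∈ Y j)))
    ⟨by simp [h18], hM, by simp, ∅, fun _ => ∅, by simpa using h17, IsNet.zero, by simpa using hM0⟩
    (fun i s' v hI => by simpa using hI) (fun s' _ hA => (hA.1 3 (by decide)).trans h.reg3) ?_)
    (by omega) fun s' _ _ ⟨⟨_, _, _, J, Y, _, hN, hY⟩, _⟩ => ⟨J, Y, hN, hY⟩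
  rintro i hi s₁ hB₁ hA₁ hx₁ ⟨hy, hM₁, hodd, J, Y, hJ, hN, hY⟩
  have h₁ := h.agree hA₁ rfl rfl
  have hrow : ∀ f, ∀ z ≤ D.w,
      (z ∈ D.row (s₁.arr 11) (2 * f + 1) 1 ↔ z ∈ D.row (s.arr 11) (2 * f + 1) 1) := by
    intro f z hz
    simp only [Slots.row, Set.mem_ofPred_eq, hodd f z hz]
  have hms : ∀ f, mass (Finset.range D.E) (fun k => D.sl (D.vx k)) (symmDiff
      (D.row (s₁.arr 11) (2 * i + 1) 1) (D.row (s₁.arr 11) (2 * f + 1) 1)) =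
      mass (Finset.range D.E) (fun k => D.sl (D.vx k)) (symmDiff
        (D.row (s.arr 11) (2 * i + 1) 1) (D.row (s.arr 11) (2 * f + 1) 1)) := by
    refine fun f => mass_congr fun k _ => ?_
    simp only [Set.mem_symmDiff, hrow _ _ (h.sl_le _)]
  refine Ok.seq (closeProg_ok (K := K + 14) (η := η) hB₁ h₁ hx₁ hi hM₁ hJ (fun c => ?_))
    fun s₂ hB₂ hA₂ hr₂ => ?_
  · rw [hA₁.1 30 (by decide), hA₁.1 31 (by decide), hA₁.1 32 (by decide)]
    exact hη c
  simp only [hms] at hr₂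
  have h₂ := h₁.agree hA₂ rfl rfl
  have a11 : s₂.arr 11 = s₁.arr 11 := hA₂.2 11 (by decide)
  have a17 : s₂.arr 17 = s₁.arr 17 := hA₂.2 17 (by decide)
  have a18 : s₂.arr 18 = s₁.arr 18 := hA₂.2 18 (by decide)
  refine Ok.ite hB₂ rfl trivial (fun hc => ?_) fun hc => ?_
  · refine Ok.skip hB₂ ⟨by rwa [a18], by rwa [a11], by rwa [a11], J, Y, by rwa [a17],
      hN.succ_of_close ?_, by rwa [a11]⟩
    obtain ⟨j, _, hj, hj'⟩ := hr₂.1 hc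
    exact ⟨j, hj, hj'⟩
  have hfar : ∀ j ∈ J, η < mass (Finset.range D.E) (fun k => D.sl (D.vx k)) (symmDiff
      (D.row (s.arr 11) (2 * i + 1) 1) (D.row (s.arr 11) (2 * j + 1) 1)) := by
    intro j hj
    by_contra hcon
    exact hr₂.2 ⟨j, hN.lt j hj, hj, not_lt.1 hcon⟩ hc
  refine Ok.put_seq hB₂ rfl trivial trivial i 1 ((hA₂.1 20 (by decide)).trans hx₁) rfl (by omega)
    fun hB₃ => ?_
  generalize hs₃ : s₂.put 17 i 1 = s₃ at hB₃ ⊢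
  have h₃ : Holds W B D s₃ := by
    subst hs₃
    exact ⟨h₂.reg0, h₂.reg1, h₂.reg2, h₂.reg3, h₂.reg4, h₂.arr14, h₂.arr15, h₂.arr12, h₂.arr9,
      h.ea_le, h.eb_le, h.sl_le, h.lt_N, h.E_lt, h.w_lt, h.nf_lt, h.q_lt, h.B_le⟩
  have a11' : s₃.arr 11 = s₁.arr 11 := by subst hs₃; simpa using a11
  have a18' : s₃.arr 18 = s₁.arr 18 := by subst hs₃; simpa using a18
  have a17' : s₃.arr 17 = Function.update (s₁.arr 17) i 1 := by subst hs₃; simp [a17]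
  have r20 : s₃.reg 20 = i := by
    subst hs₃
    simp [hA₂.1 20 (by decide), hx₁]
  refine Ok.seq (searchProg_ok (K := K + 1) hB₃ h₃ r20 (by rwa [a18']) (by rwa [a11']))
    fun s₄ hB₄ hA₄ ⟨hy₄, hopt⟩ => ?_
  have h₄ := h₃.agree hA₄ rfl rfl
  have a11₄ : s₄.arr 11 = s₁.arr 11 := (hA₄.2 11 (by decide)).trans a11'
  have a17₄ : s₄.arr 17 = Function.update (s₁.arr 17) i 1 := (hA₄.2 17 (by decide)).trans a17'
  rw [a11'] at hopt
  have hopt' : ∀ x < 2 * (D.w + D.nf + 1), ∀ k < 2, ∀ f < 2, ∀ Z : Set ℕ,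
      (∀ z ≤ D.w, (z ∈ D.move (s₁.arr 11) x k f {z | s₄.arr 18 z = 1} ↔ z ∈ Z)) →
      D.price (D.row (s.arr 11) (2 * i + 1) 1) {z | s₄.arr 18 z = 1} ≤
        D.price (D.row (s.arr 11) (2 * i + 1) 1) Z := by
    intro x hx k hk f hf Z hZ
    have := hopt x hx k hk f hf
    rwa [h.price_congr (hrow i) (fun _ _ => Iff.rfl), h.price_congr (hrow i) hZ] at this
  have hcell : ∀ v ≤ D.w, ∀ z ≤ D.w, (z ∈ D.row (s₁.arr 11) (2 * v) 0 ↔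
      ∀ j ∈ J, (z ∈ Y j ↔ v ∈ Y j)) := by
    intro v hv z hz
    have := hY v hv z hz
    rw [Slots.row, Set.mem_ofPred_eq, ← not_iff_not, ← ne_eq, this]
    simp only [not_forall, exists_prop]
    exact exists_congr fun j => and_congr_right fun _ => by tauto
  refine (updateProg_ok (K := K + 15) hB₄ h₄).mono (by omega) fun s₅ hB₅ hA₅ h11 => ?_
  rw [a11₄] at h11
  refine ⟨?_, ?_, ?_, insert i J, Function.update Y i {z | s₄.arr 18 z = 1}, ?_,
    hN.succ_of_far hη0 hfar (fun f hf => ?_) (fun f hf => ?_) (fun v hv Z hZ => ⟨?_, ?_⟩), ?_⟩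
  · rwa [hA₅.2 18 (by decide)]
  · intro x z hz
    rw [h11 x z hz]
    split_ifs
    · exact le_rfl
    · exact hM₁ x z hz
  · intro f z hz
    rw [h11 _ z hz, if_neg, hodd f z hz]
    rintro ⟨x', -, h', -⟩
    omega
  · intro j
    rw [hA₅.2 17 (by decide), a17₄, Function.update_apply, hJ]
    by_cases h1 : j = i <;> simp [h1]
  -- The required inequalities are instances of local optimality: row `2 * f + 1` with entry `1` is
  -- a member of the family, row `2 * v` with entry `0` is the cell of `v`, and the same row with
  -- entry `1` is its complement.
  · refine hopt' (2 * f + 1) (by omega) 0 (by omega) 1 (by omega) _ fun z hz => ?_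
    simp only [Slots.move, if_true, Set.mem_inter_iff, hrow f z hz]
  · refine hopt' (2 * f + 1) (by omega) 1 (by omega) 1 (by omega) _ fun z hz => ?_
    simp only [Slots.move, one_ne_zero, if_false, Set.mem_union, hrow f z hz]
  · have hv : v ≤ D.w := hv
    refine hopt' (2 * v) (by omega) 1 (by omega) 0 (by omega) _ fun z hz => ?_
    simp only [Slots.move, one_ne_zero, if_false, Set.mem_union, hcell v hv z hz, hZ,
      Set.mem_ofPred_eq]
  · have hv : v ≤ D.w := hv
    refine hopt' (2 * v) (by omega) 0 (by omega) 1 (by omega) _ fun z hz => ?_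
    have e1 : z ∈ D.row (s₁.arr 11) (2 * v) 1 ↔ ¬ z ∈ D.row (s₁.arr 11) (2 * v) 0 := by
      have := hM₁ (2 * v) z hz
      simp only [Slots.row, Set.mem_ofPred_eq]
      omega
    simp only [Slots.move, if_true, Set.mem_inter_iff, e1, hcell v hv z hz, hZ,
      Set.mem_ofPred_eq, Set.mem_compl_iff]
  · intro x hx z hz
    have hne : ∀ j ∈ J, j ≠ i := fun j hj => (hN.lt j hj).ne
    have hbit : s₄.arr 18 x ≠ s₄.arr 18 z ↔ ¬(s₄.arr 18 x = 1 ↔ s₄.arr 18 z = 1) := by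
      have := hy₄ x hx
      have := hy₄ z hz
      omega
    have hor : (∃ j ∈ insert i J, ¬(x ∈ Function.update Y i {z | s₄.arr 18 z = 1} j ↔
        z ∈ Function.update Y i {z | s₄.arr 18 z = 1} j)) ↔
        s₄.arr 18 x ≠ s₄.arr 18 z ∨ ∃ j ∈ J, ¬(x ∈ Y j ↔ z ∈ Y j) := by
      rw [Finset.exists_mem_insert, Function.update_self, hbit]
      refine or_congr Iff.rfl (exists_congr fun j => and_congr_right fun hj => ?_)
      rw [Function.update_of_ne (hne j hj)]
    rw [hor, h11 _ z hz, ← hY x hx z hz]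
    by_cases hxz : s₄.arr 18 x = s₄.arr 18 z
    · rw [if_neg]
      · simp [hxz]
      · rintro ⟨x', -, h', h''⟩
        obtain rfl : x' = x := by omega
        exact h'' hxz
    · rw [if_pos ⟨x, hx, rfl, hxz⟩]
      simp [hxz]

end Fragment

namespace Fragment

variable {ans : ℕ → List ℕ} {time : ℕ → ℕ} {W B : ℕ} {s : State} {K : ℕ}

/-! ### The family of the sets in the answers -/

/-- The position of the set number `t` in the encoding of a list of sets. -/
def position (A : List (List ℕ)) (t : ℕ) : ℕ :=
  1 + ((A.take t).flatMap fun L => L.length :: L).length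

theorem position_succ {A : List (List ℕ)} {t : ℕ} (ht : t < A.length) :
    position A (t + 1) = position A t + A[t].length + 1 := by
  simp only [position, List.take_add_one, List.getElem?_eq_getElem ht, Option.toList_some,
    List.flatMap_append, List.length_append, List.flatMap_cons, List.flatMap_nil,
    List.length_cons, List.append_nil]
  omega

theorem encodeSets_eq {A : List (List ℕ)} {t : ℕ} (ht : t < A.length) :
    ∃ p q : List ℕ, p.length = position A t ∧ encodeSets A = p ++ (A[t].length :: (A[t] ++ q)) := by
  refine ⟨A.length :: ((A.take t).flatMap fun L => L.length :: L),
    (A.drop (t + 1)).flatMap fun L => L.length :: L, by simp [position]; omega, ?_⟩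
  have h : A.flatMap (fun L => L.length :: L) = (A.take t).flatMap (fun L => L.length :: L) ++
      (A[t].length :: A[t] ++ (A.drop (t + 1)).flatMap fun L => L.length :: L) := by
    conv_lhs => rw [← List.take_append_drop t A, List.drop_eq_getElem_cons ht]
    rw [List.flatMap_append, List.flatMap_cons]
  rw [encodeSets, h]
  rfl

theorem encodeSets_length {A : List (List ℕ)} {t : ℕ} (ht : t < A.length) (d : ℕ) :
    (encodeSets A).getD (position A t) d = A[t].length := by
  obtain ⟨p, q, h1, h2⟩ := encodeSets_eq ht
  rw [h2, ← h1, List.getD_append_right _ _ _ _ le_rfl]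
  simp

theorem encodeSets_getElem {A : List (List ℕ)} {t j : ℕ} (ht : t < A.length) (hj : j < A[t].length)
    (d : ℕ) : (encodeSets A).getD (position A t + 1 + j) d = A[t][j] := by
  obtain ⟨p, q, h1, h2⟩ := encodeSets_eq ht
  rw [h2, ← h1, List.getD_append_right _ _ _ _ (by omega),
    show p.length + 1 + j - p.length = j + 1 by omega, List.getD_cons_succ,
    List.getD_append _ _ _ _ hj, List.getD_eq_getElem _ _ hj]

theorem position_le {A : List (List ℕ)} {t : ℕ} (ht : t < A.length) :
    position A t + A[t].length + 1 ≤ (encodeSets A).length := by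
  obtain ⟨p, q, h1, h2⟩ := encodeSets_eq ht
  rw [h2, ← h1]
  simp only [List.length_append, List.length_cons]
  omega

/-- This bounds the number of sets plus the number of their elements by the length of the written
answer, hence by the query time; so the numbers of members of the family and of slots are
controlled. -/
theorem flatten_length_le (A : List (List ℕ)) :
    A.flatten.length + A.length ≤ (encodeSets A).length := by
  induction A with
  | nil => simp
  | cons L A ih =>
    simp only [encodeSets, List.flatten_cons, List.length_append, List.length_cons,
      List.flatMap_cons] at ih ⊢
    omega

theorem mem_encodeSets {A : List (List ℕ)} {k : ℕ} (h : k ∈ encodeSets A) :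
    k ≤ (encodeSets A).length ∨ ∃ L ∈ A, k ∈ L := by
  simp only [encodeSets, List.mem_cons, List.mem_flatMap] at h
  rcases h with rfl | ⟨L, hL, rfl | hk⟩
  · left
    have := flatten_length_le A
    omega
  · left
    obtain ⟨t, ht, rfl⟩ := List.getElem_of_mem hL
    have := position_le ht
    omega
  · exact Or.inr ⟨L, hL, hk⟩

/-- `v` belongs to the set number `f` of a list of sets. -/
def InSet (Ls : List (List ℕ)) (f v : ℕ) : Prop := ∃ L, Ls[f]? = some L ∧ v ∈ L

theorem inSet_append (Ls : List (List ℕ)) (L : List ℕ) (f v : ℕ) :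
    InSet (Ls ++ [L]) f v ↔ InSet Ls f v ∨ f = Ls.length ∧ v ∈ L := by
  simp only [InSet]
  rcases Nat.lt_trichotomy f Ls.length with h | h | h
  · simp [List.getElem?_append_left h, h.ne]
  · subst h
    simp
  · rw [List.getElem?_eq_none (by simp; omega), List.getElem?_eq_none (by omega)]
    simp
    omega

/-- Slots `1, …, w` have been given to the vertices of the sets `{v | R f v}`, so that `sl` and `vt`
are inverse to each other, and the rows `2 * f + 1` of the matrix `A` describe these sets. -/
structure Table (n : ℕ) (R : ℕ → ℕ → Prop) (w : ℕ) (sl vt A : ℕ → ℕ) : Prop where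
  lt : ∀ f v, R f v → v < n
  sl_ne : ∀ v, sl v ≠ 0 ↔ ∃ f, R f v
  sl_le : ∀ v, sl v ≤ w
  vt_sl : ∀ v, sl v ≠ 0 → vt (sl v) = v
  sl_vt : ∀ j, 1 ≤ j → j ≤ w → sl (vt j) = j
  le_one : ∀ x, ∀ z ≤ n, A (x * (n + 1) + z) ≤ 1
  eq_one : ∀ x, ∀ z ≤ n, (A (x * (n + 1) + z) = 1 ↔ ∃ f v, x = 2 * f + 1 ∧ R f v ∧ sl v = z)

namespace Table

variable {n w : ℕ} {R R' : ℕ → ℕ → Prop} {sl vt A : ℕ → ℕ}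

theorem congr (h : Table n R w sl vt A) (hR : ∀ f v, R f v ↔ R' f v) : Table n R' w sl vt A := by
  have : R = R' := by ext f v; exact hR f v
  exact this ▸ h

/-- `vt` embeds the slots `1, …, w` into the vertices. So the row length `n + 1` of the matrix
leaves room for slot `0` and rows do not overlap. -/
theorem w_le (h : Table n R w sl vt A) : w ≤ n := by
  have h1 := Finset.card_le_card_of_injOn (s := Finset.Icc 1 w) (t := Finset.range n) vt
    (fun j hj => by
      obtain ⟨h1, h2⟩ := Finset.mem_Icc.1 hj
      have h3 := h.sl_vt j h1 h2
      obtain ⟨f, hf⟩ := (h.sl_ne (vt j)).1 (by omega)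
      exact Finset.mem_coe.2 (Finset.mem_range.2 (h.lt f _ hf)))
    (fun j hj j' hj' hjj' => by
      obtain ⟨h1, h2⟩ := Finset.mem_Icc.1 hj
      obtain ⟨h3, h4⟩ := Finset.mem_Icc.1 hj'
      rw [← h.sl_vt j h1 h2, ← h.sl_vt j' h3 h4, hjj'])
  simpa using h1

theorem insert_of_eq (h : Table n R w sl vt A) {f v : ℕ} (hv : v < n) (hsl : sl v = 0) :
    Table n (fun f' v' => R f' v' ∨ f' = f ∧ v' = v) (w + 1) (Function.update sl v (w + 1))
      (Function.update vt (w + 1) v)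
      (Function.update A ((2 * f + 1) * (n + 1) + (w + 1)) 1) := by
  have hRv : ∀ f', ¬ R f' v := fun f' hf => (h.sl_ne v).2 ⟨f', hf⟩ hsl
  -- The new vertex `v` has no slot yet, so the `w` old slots belong to the other `n - 1` vertices.
  have hw : w + 1 ≤ n := by
    have h1 := Finset.card_le_card_of_injOn (s := Finset.Icc 1 w) (t := (Finset.range n).erase v) vt
      (fun j hj => by
        obtain ⟨h1, h2⟩ := Finset.mem_Icc.1 hj
        have h3 := h.sl_vt j h1 h2
        obtain ⟨f, hf⟩ := (h.sl_ne (vt j)).1 (by omega)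
        refine Finset.mem_coe.2 (Finset.mem_erase.2 ⟨?_, Finset.mem_range.2 (h.lt f _ hf)⟩)
        intro hjv
        rw [hjv] at h3
        omega)
      (fun j hj j' hj' hjj' => by
        obtain ⟨h1, h2⟩ := Finset.mem_Icc.1 hj
        obtain ⟨h3, h4⟩ := Finset.mem_Icc.1 hj'
        rw [← h.sl_vt j h1 h2, ← h.sl_vt j' h3 h4, hjj'])
    rw [Finset.card_erase_of_mem (Finset.mem_range.2 hv)] at h1
    simp only [Nat.card_Icc, Finset.card_range] at h1
    omega
  have hup : ∀ u, u ≠ v → Function.update sl v (w + 1) u = sl u :=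
    fun u hu => Function.update_of_ne hu _ _
  refine ⟨?_, fun u => ?_, fun u => ?_, fun u hu => ?_, fun j h1 h2 => ?_, fun x z hz => ?_,
    fun x z hz => ?_⟩
  · rintro f' u (hR | ⟨-, rfl⟩)
    · exact h.lt f' u hR
    · exact hv
  · by_cases huv : u = v
    · subst huv
      simp only [Function.update_self, ne_eq, Nat.add_eq_zero_iff, one_ne_zero, and_false,
        not_false_eq_true, true_iff]
      exact ⟨f, by simp⟩
    · rw [hup u huv, h.sl_ne u]
      simp [huv]
  · by_cases huv : u = v
    · subst huv; simp
    · rw [hup u huv]; exact (h.sl_le u).trans (Nat.le_succ w)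
  · by_cases huv : u = v
    · subst huv; simp
    · rw [hup u huv] at hu ⊢
      have := h.sl_le u
      rw [Function.update_of_ne (by omega)]
      exact h.vt_sl u hu
  · rcases Nat.lt_succ_iff_lt_or_eq.1 (Nat.lt_succ_of_le h2) with h2 | rfl
    · have e1 : Function.update vt (w + 1) v j = vt j := Function.update_of_ne (by omega) _ _
      rw [e1, hup]
      · exact h.sl_vt j h1 (by omega)
      · intro hjv
        have := h.sl_vt j h1 (by omega)
        rw [hjv] at this
        omega
    · simp
  · rw [Function.update_apply]
    split_ifs
    · exact le_rfl
    · exact h.le_one x z hz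
  · rw [Function.update_apply]
    simp only [cell_inj (show z < n + 1 by omega) (show w + 1 < n + 1 by omega)]
    by_cases hxz : x = 2 * f + 1 ∧ z = w + 1
    · rw [if_pos hxz]
      simp only [true_iff]
      exact ⟨f, v, hxz.1, Or.inr ⟨rfl, rfl⟩, by simp [hxz.2]⟩
    · rw [if_neg hxz, h.eq_one x z hz]
      constructor
      · rintro ⟨f', u, e1, e2, e3⟩
        exact ⟨f', u, e1, Or.inl e2, by rw [hup u (fun h' => hRv f' (h' ▸ e2)), e3]⟩
      · rintro ⟨f', u, e1, e2 | ⟨rfl, rfl⟩, e3⟩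
        · exact ⟨f', u, e1, e2, by rw [← e3, hup u (fun h' => hRv f' (h' ▸ e2))]⟩
        · rw [Function.update_self] at e3
          exact absurd ⟨e1, e3.symm⟩ hxz

theorem insert_of_ne (h : Table n R w sl vt A) {f v : ℕ} (hv : v < n) (hsl : sl v ≠ 0) :
    Table n (fun f' v' => R f' v' ∨ f' = f ∧ v' = v) w sl vt
      (Function.update A ((2 * f + 1) * (n + 1) + sl v) 1) := by
  have hw := h.w_le
  have hsv := h.sl_le v
  refine ⟨?_, fun u => ?_, h.sl_le, h.vt_sl, h.sl_vt, fun x z hz => ?_, fun x z hz => ?_⟩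
  · rintro f' u (hR | ⟨-, rfl⟩)
    · exact h.lt f' u hR
    · exact hv
  · rw [h.sl_ne u]
    constructor
    · rintro ⟨f', hf⟩
      exact ⟨f', Or.inl hf⟩
    · rintro ⟨f', hf | ⟨-, rfl⟩⟩
      · exact ⟨f', hf⟩
      · exact (h.sl_ne u).1 hsl
  · rw [Function.update_apply]
    split_ifs
    · exact le_rfl
    · exact h.le_one x z hz
  · rw [Function.update_apply]
    simp only [cell_inj (show z < n + 1 by omega) (show sl v < n + 1 by omega)]
    by_cases hxz : x = 2 * f + 1 ∧ z = sl v
    · rw [if_pos hxz]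
      simp only [true_iff]
      exact ⟨f, v, hxz.1, Or.inr ⟨rfl, rfl⟩, hxz.2.symm⟩
    · rw [if_neg hxz, h.eq_one x z hz]
      constructor
      · rintro ⟨f', u, e1, e2, e3⟩
        exact ⟨f', u, e1, Or.inl e2, e3⟩
      · rintro ⟨f', u, e1, e2 | ⟨rfl, rfl⟩, e3⟩
        · exact ⟨f', u, e1, e2, e3⟩
        · exact absurd ⟨e1, e3.symm⟩ hxz

end Table

/-- The table in the memory. -/
def TableAt (n : ℕ) (R : ℕ → ℕ → Prop) (s : State) : Prop :=
  Table n R (s.reg 2) (s.arr 9) (s.arr 10) (s.arr 11)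

/-- Add the element number `j` of a set of the answer, where `j` is the content of register `11`. -/
def elementProg : Prog :=
  .seq (.set 12 (.get 7 (.op .add (.op .add (.reg 8) (.lit 1)) (.reg 11)))) <|
  .seq (.ite (.get 9 (.reg 12)) .skip <|
    .seq (.set 2 (.op .add (.reg 2) (.lit 1))) <|
    .seq (.put 9 (.reg 12) (.reg 2)) <| .put 10 (.reg 2) (.reg 12)) <|
  .put 11 (.op .add (.op .mul (.op .add (.op .mul (.lit 2) (.reg 3)) (.lit 1)) (.reg 1))
    (.get 9 (.reg 12))) (.lit 1)

theorem elementProg_ok {n v : ℕ} {R : ℕ → ℕ → Prop} (hB : Bdd W s) (h : TableAt n R s)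
    (hr1 : s.reg 1 = n + 1) (hv : v < n) (hnW : n < W)
    (hs : s.arr 7 (s.reg 8 + 1 + s.reg 11) = v) :
    Ok ans time W B elementProg s (K + 8) fun s' =>
      TableAt n (fun f' v' => R f' v' ∨ f' = s.reg 3 ∧ v' = v) s' ∧ s'.reg 2 ≤ s.reg 2 + 1 := by
  have hw := h.w_le
  have hW := hB.ten_le
  refine Ok.set_seq hB rfl (Expr.safe_of_inner _ rfl) v hs (by omega) fun hB₁ => ?_
  generalize hs₁ : s.set 12 v = s₁ at hB₁ ⊢
  have h₁ : TableAt n R s₁ := by subst hs₁; exact h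
  have r1 : s₁.reg 1 = n + 1 := by simp [← hs₁, hr1]
  have r12 : s₁.reg 12 = v := by simp [← hs₁]
  have r3 : s₁.reg 3 = s.reg 3 := by simp [← hs₁]
  have r2 : s₁.reg 2 = s.reg 2 := by simp [← hs₁]
  -- Both branches only ensure that `v` has a slot; the assertion already includes the matrix entry
  -- that the common last instruction writes.
  refine Ok.seq (R := fun s' => Table n (fun f' v' => R f' v' ∨ f' = s.reg 3 ∧ v' = v) (s'.reg 2)
    (s'.arr 9) (s'.arr 10) (Function.update (s'.arr 11)
      ((2 * s.reg 3 + 1) * (n + 1) + s'.arr 9 v) 1) ∧ s'.reg 2 ≤ s.reg 2 + 1)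
    (Ok.ite hB₁ rfl (Expr.safe_of_inner _ rfl) (fun hc => ?_) fun hc => ?_)
    fun s₂ hB₂ hA₂ ⟨hI₂, hI₂'⟩ => ?_
  · simp only [Expr.eval, r12] at hc
    exact Ok.skip hB₁ ⟨h₁.insert_of_ne hv hc, by omega⟩
  · simp only [Expr.eval, r12] at hc
    have := h₁.insert_of_eq (f := s.reg 3) hv hc
    refine Ok.set_seq hB₁ rfl (Expr.safe_of_inner _ rfl) (s₁.reg 2 + 1) rfl (by omega)
      fun hB₂ => ?_
    refine Ok.put_seq hB₂ rfl trivial trivial v (s₁.reg 2 + 1) (by simp [Expr.eval, r12])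
      (by simp [Expr.eval]) (by omega) fun hB₃ => ?_
    refine Ok.put hB₃ rfl trivial trivial (s₁.reg 2 + 1) v (by simp [Expr.eval])
      (by simp [Expr.eval, r12]) (by omega) ⟨?_, by simp [r2]⟩
    simpa using this
  · refine Ok.put hB₂ rfl (Expr.safe_of_inner _ rfl) trivial
      ((2 * s.reg 3 + 1) * (n + 1) + s₂.arr 9 v) 1 ?_ rfl (by omega) ⟨?_, hI₂'⟩
    · simp [Expr.eval, Op.eval, hA₂.1 3 (by decide), r3, hA₂.1 1 (by decide), r1,
        hA₂.1 12 (by decide), r12]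
    · simpa [TableAt] using hI₂

/-- Add the sets in the answer to the family. -/
def answerProg : Prog :=
  .seq (.set 8 (.lit 1)) <| .for 9 (.get 7 (.lit 0)) <|
    .seq (.set 10 (.get 7 (.reg 8))) <|
    .seq (.for 11 (.reg 10) elementProg) <|
    .seq (.set 8 (.op .add (.op .add (.reg 8) (.reg 10)) (.lit 1))) <|
    .set 3 (.op .add (.reg 3) (.lit 1))

theorem answerProg_ok {n : ℕ} {A Ls : List (List ℕ)} (hB : Bdd W s)
    (h : TableAt n (InSet Ls) s) (hr3 : s.reg 3 = Ls.length)
    (hr2 : s.reg 2 ≤ Ls.flatten.length) (hr1 : s.reg 1 = n + 1) (hnW : n < W) (hBW : B ≤ W)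
    (hA : ∀ L ∈ A, ∀ v ∈ L, v < n) (hlen : (encodeSets A).length < B)
    (hLs : Ls.length + A.length ≤ W)
    (o : ℕ → ℕ) (hs : ∀ i, s.arr 7 i = (encodeSets A).getD i (o i)) :
    Ok ans time W B answerProg s (K + 20) fun s' => TableAt n (InSet (Ls ++ A)) s' ∧
      s'.reg 3 = (Ls ++ A).length ∧ s'.reg 2 ≤ (Ls ++ A).flatten.length := by
  have hW := hB.ten_le
  have hAl : A.length < B := by
    have := flatten_length_le A
    omega
  refine Ok.set_seq hB rfl trivial 1 rfl (by omega) fun hB₀ => ?_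
  refine Ok.mono (Ok.for (K := K + 13) (N := A.length) hB₀ rfl (by omega) hAl
    -- Register `8` points to the word with the cardinality of the set number `t`.
    (fun t s' => TableAt n (InSet (Ls ++ A.take t)) s' ∧ s'.reg 3 = Ls.length + t ∧
      s'.reg 2 ≤ (Ls ++ A.take t).flatten.length ∧ s'.reg 8 = position A t)
    ⟨by simpa [TableAt] using h, by simpa using hr3, by simpa using hr2, by simp [position]⟩
    (fun i s' v hI => by simpa [TableAt] using hI) (fun s' _ hA' => ?_) ?_) (by omega)
    fun s' _ _ ⟨⟨h1, h2, h3, _⟩, _⟩ => by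
      rw [List.take_length] at h1 h3
      exact ⟨h1, by simpa using h2, h3⟩
  · simp only [Expr.eval]
    rw [hA'.2 7 (by decide), State.arr_set, hs]
    simp [encodeSets]
  rintro t ht s₁ hB₁ hA₁ hx₁ ⟨hI1, hI2, hI3, hI4⟩
  have a7 : s₁.arr 7 = s.arr 7 := hA₁.2 7 (by decide)
  have hpos := position_le ht
  refine Ok.set_seq hB₁ rfl (Expr.safe_of_inner _ rfl) A[t].length ?_ (by omega) fun hB₂ => ?_
  · simp only [Expr.eval, a7, hI4, hs]
    exact encodeSets_length ht _
  refine Ok.seq (Ok.for (N := A[t].length) hB₂ rfl (by omega) (by omega)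
    (fun j s' => TableAt n (fun f v => InSet (Ls ++ A.take t) f v ∨
        f = Ls.length + t ∧ v ∈ A[t].take j) s' ∧
      s'.reg 2 ≤ (Ls ++ A.take t).flatten.length + j)
    ⟨by simpa [TableAt] using hI1, by simpa using hI3⟩
    (fun i s' v hI => by simpa [TableAt] using hI) (fun s' _ hA' => ?_) ?_)
    fun s₃ hB₃ hA₃ ⟨⟨hI5, hI6⟩, hr11⟩ => ?_
  · simp only [Expr.eval]
    rw [hA'.1 10 (by decide)]
    simp
  · rintro j hj s₃ hB₃ hA₃ hx₃ ⟨hI5, hI6⟩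
    refine (elementProg_ok (K := K) (v := A[t][j]) hB₃ hI5 ?_
      (hA _ (List.getElem_mem ht) _ (List.getElem_mem hj)) hnW ?_).mono (by omega) ?_
    · rw [hA₃.1 1 (by decide)]
      simp [hA₁.1 1 (by decide), hr1]
    · rw [hA₃.2 7 (by decide), State.arr_set, a7, hx₃, hA₃.1 8 (by decide)]
      simp only [State.reg_set, Nat.reduceEqDiff, if_false, hI4, hs]
      exact encodeSets_getElem ht hj _
    · rintro s₄ hB₄ hA₄ ⟨hI7, hI8⟩
      have r3 : s₃.reg 3 = Ls.length + t := by
        rw [hA₃.1 3 (by decide)]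
        simp [hI2]
      refine ⟨hI7.congr fun f v => ?_, by omega⟩
      rw [r3, List.take_add_one, List.getElem?_eq_getElem hj]
      simp only [Option.toList_some, List.mem_append, List.mem_singleton]
      tauto
  · have r3 : s₃.reg 3 = Ls.length + t := by
      rw [hA₃.1 3 (by decide)]
      simp [hI2]
    have r8 : s₃.reg 8 = position A t := by
      rw [hA₃.1 8 (by decide)]
      simp [hI4]
    have r10 : s₃.reg 10 = A[t].length := by
      rw [hA₃.1 10 (by decide)]
      simp
    have htk : Ls ++ A.take (t + 1) = (Ls ++ A.take t) ++ [A[t]] := by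
      rw [List.take_add_one, List.getElem?_eq_getElem ht]
      simp
    refine Ok.set_seq hB₃ rfl (Expr.safe_of_inner _ rfl) (position A (t + 1))
      (by simp [Expr.eval, Op.eval, r8, r10, position_succ ht]) ?_ fun hB₄ => ?_
    · rw [position_succ ht]
      omega
    refine Ok.set hB₄ rfl (Expr.safe_of_inner _ rfl) (Ls.length + t + 1)
      (by simp [Expr.eval, Op.eval, r3]) (by omega) ⟨?_, ?_, ?_, ?_⟩
    · have := hI5.congr (R' := InSet (Ls ++ A.take (t + 1))) fun f v => by
        rw [htk, inSet_append]
        simp [Nat.min_eq_left ht.le]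
      simpa [TableAt] using this
    · simp [Nat.add_assoc]
    · have hfl : ((Ls ++ A.take t) ++ [A[t]]).flatten.length =
          (Ls ++ A.take t).flatten.length + A[t].length := by
        rw [List.flatten_append, List.length_append]
        simp
      rw [htk]
      exact le_trans (le_of_eq (by simp)) (hI6.trans (le_of_eq hfl.symm))
    · simp

end Fragment

namespace Fragment

variable {ans : ℕ → List ℕ} {time : ℕ → ℕ} {W B : ℕ} {s : State} {K : ℕ}

theorem TableAt.agree {n : ℕ} {R : ℕ → ℕ → Prop} {p : Prog} {s' : State} (h : TableAt n R s)
    (hA : Agree p s s') (hp : (p.regs.all (· != 2) && p.arrs.all fun a => a != 9 && a != 10 &&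
      a != 11) = true) : TableAt n R s' := by
  simp only [Bool.and_eq_true, List.all_eq_true, bne_iff_ne] at hp
  rw [TableAt, hA.1 2 fun h' => hp.1 2 h' rfl, hA.2 9 fun h' => (hp.2 9 h').1.1 rfl,
    hA.2 10 fun h' => (hp.2 10 h').1.2 rfl, hA.2 11 fun h' => (hp.2 11 h').2 rfl]
  exact h

/-- The end in the cluster of the external edge number `k`. -/
def innerEnd (s : State) (k : ℕ) : ℕ :=
  if s.arr 5 (s.arr 1 (s.arr 6 k)) = s.arr 0 9 then s.arr 1 (s.arr 6 k) else s.arr 2 (s.arr 6 k)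

/-- Collect the sets in the answers to the queries on the ends of the external edges. -/
def familyProg : Prog :=
  .for 5 (.reg 0) <|
    .seq (.set 6 (.get 6 (.reg 5))) <|
    .seq (.ite (.op .eq (.get 5 (.get 1 (.reg 6))) (.get 0 (.lit 9)))
      (.set 7 (.get 1 (.reg 6))) (.set 7 (.get 2 (.reg 6)))) <|
    .seq (.put 12 (.reg 5) (.reg 7)) <|
    .seq (.query (.reg 7)) answerProg

/-- Each answer occupies at most `Q` words, so after `E` queries the number of sets and the number
of slots are at most `E * Q`. This is where the work becomes independent of the size of the cluster.
-/
theorem familyProg_ok {n E Q : ℕ} {A : ℕ → List (List ℕ)} (hB : Bdd W s) (hBW : B ≤ W)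
    (hnW : n < W) (hE : s.reg 0 = E) (hEB : E < B) (hr1 : s.reg 1 = n + 1) (hr2 : s.reg 2 = 0)
    (hr3 : s.reg 3 = 0) (h9 : ∀ i, s.arr 9 i = 0) (h11 : ∀ i, s.arr 11 i = 0) (h09 : s.arr 0 9 ≤ W)
    (hsafe : ∀ k < E, s.arr 6 k ≤ W ∧ s.arr 1 (s.arr 6 k) ≤ W ∧ s.arr 2 (s.arr 6 k) ≤ W ∧
      s.arr 5 (s.arr 1 (s.arr 6 k)) ≤ W)
    (htime : ∀ k < E, time (innerEnd s k) ≤ B)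
    (hA : ∀ k < E, ∀ L ∈ A (innerEnd s k), ∀ v ∈ L, v < n) (hx : ∀ k < E, innerEnd s k < n)
    (hQ : ∀ k < E, (encodeSets (A (innerEnd s k))).length ≤ Q) (hQB : Q < B)
    (hEQ : (E + 1) * Q ≤ W) :
    Ok (fun v => encodeSets (A v)) time W B familyProg s (K + 40) fun s' => ∃ Ls : List (List ℕ),
      Ls = (List.range E).flatMap (fun k => A (innerEnd s k)) ∧ TableAt n (InSet Ls) s' ∧
      s'.reg 3 = Ls.length ∧ s'.reg 2 ≤ E * Q ∧ s'.reg 3 ≤ E * Q ∧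
      ∀ k < E, s'.arr 12 k = innerEnd s k := by
  have hW := hB.ten_le
  refine Ok.mono (Ok.for (K := K + 30) (N := E) hB rfl (by omega) hEB
    (fun i s' => ∃ Ls : List (List ℕ),
      Ls = (List.range i).flatMap (fun k => A (innerEnd s k)) ∧ TableAt n (InSet Ls) s' ∧
      s'.reg 3 = Ls.length ∧ s'.reg 2 ≤ Ls.flatten.length ∧ Ls.length + Ls.flatten.length ≤ i * Q ∧
      ∀ k < i, s'.arr 12 k = innerEnd s k) ?_ ?_ (fun s' _ hA' => (hA'.1 0 (by decide)).trans hE) ?_)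
    (by omega) ?_
  · refine ⟨[], rfl, ?_, by simpa using hr3, by simp [hr2], by simp, by simp⟩
    refine ⟨?_, ?_, ?_, ?_, ?_, ?_, ?_⟩
    · simp [InSet]
    · simp [InSet, h9]
    · simp [h9]
    · simp [h9]
    · intro j h1 h2
      omega
    · simp [h11]
    · simp [InSet, h11]
  · intro i s' v hI
    simpa [TableAt] using hI
  · rintro i hi s₁ hB₁ hA₁ hx₁ ⟨Ls, hLs, hT, hI1, hI2, hI3, hI4⟩
    obtain ⟨g1, g2, g3, g4⟩ := hsafe i hi
    have a0 : s₁.arr 0 = s.arr 0 := hA₁.2 0 (by decide)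
    have a1 : s₁.arr 1 = s.arr 1 := hA₁.2 1 (by decide)
    have a2 : s₁.arr 2 = s.arr 2 := hA₁.2 2 (by decide)
    have a5 : s₁.arr 5 = s.arr 5 := hA₁.2 5 (by decide)
    have a6 : s₁.arr 6 = s.arr 6 := hA₁.2 6 (by decide)
    refine Ok.set_seq hB₁ rfl ?_ (s.arr 6 i) (by simp [Expr.eval, a6, hx₁]) g1 fun hB₂ => ?_
    · simpa [Expr.Safe, Expr.eval, a6, hx₁] using g1
    refine Ok.seq (R := fun s' => s'.reg 7 = innerEnd s i) (Ok.ite hB₂ rfl ?_ (fun hc => ?_)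
      fun hc => ?_) fun s₃ hB₃ hA₃ hr7 => ?_
    · simp [Expr.Safe, Expr.eval, a0, a1, a5, g2, g4, h09]
    · refine Ok.set hB₂ rfl (by simp [Expr.Safe, Expr.eval, a1, g2]) (s.arr 1 (s.arr 6 i))
        (by simp [Expr.eval, a1]) g2 ?_
      rw [innerEnd, if_pos]
      · simp
      · by_contra hcon
        simp [Expr.eval, Op.eval, a0, a1, a5, hcon] at hc
    · refine Ok.set hB₂ rfl (by simp [Expr.Safe, Expr.eval, a2, g3]) (s.arr 2 (s.arr 6 i))
        (by simp [Expr.eval, a2]) g3 ?_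
      rw [innerEnd, if_neg]
      · simp
      · intro hcon
        simp [Expr.eval, Op.eval, a0, a1, a5, hcon] at hc
    have hxi := hx i hi
    have r5 : s₃.reg 5 = i := by
      rw [hA₃.1 5 (by decide)]
      simp [hx₁]
    have hT₃ : TableAt n (InSet Ls) s₃ :=
      TableAt.agree (s := s₁.set 6 (s.arr 6 i)) (by simpa [TableAt] using hT) hA₃ rfl
    have r3 : s₃.reg 3 = Ls.length := by
      rw [hA₃.1 3 (by decide)]
      simp [hI1]
    have r2 : s₃.reg 2 ≤ Ls.flatten.length := by
      rw [hA₃.1 2 (by decide)]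
      simpa using hI2
    have r1 : s₃.reg 1 = n + 1 := by
      rw [hA₃.1 1 (by decide)]
      simp [hA₁.1 1 (by decide), hr1]
    have a12 : ∀ k < i, s₃.arr 12 k = innerEnd s k := by
      rw [hA₃.2 12 (by decide)]
      exact hI4
    refine Ok.put_seq hB₃ rfl trivial trivial i (innerEnd s i) r5 hr7 (by omega) fun hB₄ => ?_
    have hQi := hQ i hi
    have hEQ' : Ls.length + Ls.flatten.length + (encodeSets (A (innerEnd s i))).length ≤ (i + 1) * Q := by
      rw [Nat.succ_mul]
      omega
    have hiE : (i + 1) * Q ≤ E * Q := Nat.mul_le_mul_right _ hi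
    have hEE : E * Q ≤ (E + 1) * Q := Nat.mul_le_mul_right _ (Nat.le_succ E)
    have hfl := flatten_length_le (A (innerEnd s i))
    refine Ok.seq (R := fun s' => ∀ j, s'.arr 7 j =
      (encodeSets (A (innerEnd s i))).getD j (s₃.arr 7 j)) (Ok.query hB₄ rfl trivial (innerEnd s i)
      (by simp [Expr.eval, hr7]) (htime i hi) (by omega) (fun k hk => ?_) fun j => ?_)
      fun s₅ hB₅ hA₅ h7 => ?_
    · rcases mem_encodeSets hk with hk | ⟨L, hL, hk⟩
      · omega
      · exact (hA i hi L hL k hk).le.trans hnW.le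
    · simp [State.write, answerArray]
    · refine (answerProg_ok (K := K) (n := n) (A := A (innerEnd s i)) (Ls := Ls) hB₅
        (TableAt.agree (s := s₃.put 12 i (innerEnd s i)) (by simpa [TableAt] using hT₃) hA₅ rfl)
        ?_ ?_ ?_ hnW hBW (hA i hi) (by omega) (by omega) _ h7).mono (by omega) ?_
      · rw [hA₅.1 3 (by decide)]
        simp [r3]
      · rw [hA₅.1 2 (by decide)]
        simpa using r2
      · rw [hA₅.1 1 (by decide)]
        simp [r1]
      · rintro s₆ hB₆ hA₆ ⟨k1, k2, k3⟩
        refine ⟨_, ?_, k1, k2, k3, ?_, fun k hk => ?_⟩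
        · rw [List.range_succ, List.flatMap_append, ← hLs]
          simp
        · rw [List.length_append, List.flatten_append, List.length_append]
          omega
        · rw [hA₆.2 12 (by decide), hA₅.2 12 (by decide)]
          simp only [State.arr_put, if_true, Function.update_apply]
          split_ifs with h1
          · rw [h1]
          · exact a12 k (by omega)
  · rintro s' _ _ ⟨⟨Ls, h1, h2, h3, h4, h5, h6⟩, -⟩
    exact ⟨Ls, h1, h2, h3, by omega, by omega, h6⟩

/-! ### The internal edges that are incident to the sets of the family -/

/-- The edges in `I` with `R` have been recorded, with the slots of their ends. -/
structure Recorded (a b sl : ℕ → ℕ) (I : Finset ℕ) (R : ℕ → Prop) (q : ℕ)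
    (id ea eb mark : ℕ → ℕ) : Prop where
  inj : ∀ i < q, ∀ j < q, id i = id j → i = j
  mem : ∀ e, (∃ j < q, id j = e) ↔ R e ∧ e ∈ I
  mark : ∀ e, mark e ≠ 0 ↔ ∃ j < q, id j = e
  ea : ∀ j < q, ea j = sl (a (id j))
  eb : ∀ j < q, eb j = sl (b (id j))

namespace Recorded

variable {a b sl : ℕ → ℕ} {I : Finset ℕ} {R R' : ℕ → Prop} {q : ℕ} {id ea eb mark : ℕ → ℕ}

theorem congr (h : Recorded a b sl I R q id ea eb mark) (hR : ∀ e, R e ↔ R' e) :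
    Recorded a b sl I R' q id ea eb mark := by
  have : R = R' := by ext e; exact hR e
  exact this ▸ h

/-- An edge is passed over either because it is not internal or because it was met before, from its
other end. -/
theorem skip (h : Recorded a b sl I R q id ea eb mark) {e : ℕ} (he : e ∈ I → mark e ≠ 0) :
    Recorded a b sl I (fun e' => R e' ∨ e' = e) q id ea eb mark := by
  refine ⟨h.inj, fun e' => ?_, h.mark, h.ea, h.eb⟩
  rw [h.mem]
  constructor
  · exact fun h' => ⟨Or.inl h'.1, h'.2⟩
  · rintro ⟨h1 | rfl, h2⟩
    · exact ⟨h1, h2⟩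
    · exact (h.mem _).1 ((h.mark _).1 (he h2))

theorem insert (h : Recorded a b sl I R q id ea eb mark) {e : ℕ} (he : e ∈ I) (hm : mark e = 0) :
    Recorded a b sl I (fun e' => R e' ∨ e' = e) (q + 1) (Function.update id q e)
      (Function.update ea q (sl (a e))) (Function.update eb q (sl (b e)))
      (Function.update mark e 1) := by
  have hne : ∀ j < q, id j ≠ e := fun j hj hje => (h.mark e).2 ⟨j, hj, hje⟩ hm
  have hup : ∀ (f : ℕ → ℕ) (v : ℕ), ∀ j < q, Function.update f q v j = f j := fun f v j hj =>
    Function.update_of_ne hj.ne _ _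
  have hex : ∀ e', (∃ j < q + 1, Function.update id q e j = e') ↔ (∃ j < q, id j = e') ∨ e' = e := by
    intro e'
    constructor
    · rintro ⟨j, hj, hje⟩
      rcases Nat.lt_succ_iff_lt_or_eq.1 hj with hj | rfl
      · exact Or.inl ⟨j, hj, by rwa [hup _ _ j hj] at hje⟩
      · right; simpa using hje.symm
    · rintro (⟨j, hj, hje⟩ | rfl)
      · exact ⟨j, by omega, by rwa [hup _ _ j hj]⟩
      · exact ⟨q, by omega, by simp⟩
  refine ⟨fun i hi j hj hij => ?_, fun e' => ?_, fun e' => ?_, fun j hj => ?_, fun j hj => ?_⟩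
  · rcases Nat.lt_succ_iff_lt_or_eq.1 hi with hi | rfl <;>
      rcases Nat.lt_succ_iff_lt_or_eq.1 hj with hj | rfl
    · rw [hup _ _ i hi, hup _ _ j hj] at hij
      exact h.inj i hi j hj hij
    · rw [hup _ _ i hi, Function.update_self] at hij
      exact absurd hij (hne i hi)
    · rw [hup _ _ j hj, Function.update_self] at hij
      exact absurd hij.symm (hne j hj)
    · rfl
  · rw [hex, h.mem]
    constructor
    · rintro (h1 | rfl)
      · exact ⟨Or.inl h1.1, h1.2⟩
      · exact ⟨Or.inr rfl, he⟩
    · rintro ⟨h1 | rfl, h2⟩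
      · exact Or.inl ⟨h1, h2⟩
      · exact Or.inr rfl
  · rw [hex, Function.update_apply, ← h.mark]
    split_ifs with h1 <;> simp [h1]
  · rcases Nat.lt_succ_iff_lt_or_eq.1 hj with hj | rfl
    · rw [hup _ _ j hj, hup _ _ j hj, h.ea j hj]
    · simp
  · rcases Nat.lt_succ_iff_lt_or_eq.1 hj with hj | rfl
    · rw [hup _ _ j hj, hup _ _ j hj, h.eb j hj]
    · simp

end Recorded

/-- The recorded edges in the memory. -/
def RecordedAt (s₀ : State) (I : Finset ℕ) (R : ℕ → Prop) (s : State) : Prop :=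
  Recorded (s₀.arr 1) (s₀.arr 2) (s₀.arr 9) I R (s.reg 4) (s.arr 13) (s.arr 14) (s.arr 15)
    (s.arr 16)

/-- Record the edge in register `17`. -/
def edgeProg : Prog :=
  .ite (.op .mul (.op .mul (.op .eq (.get 5 (.get 1 (.reg 17))) (.get 0 (.lit 9)))
      (.op .eq (.get 5 (.get 2 (.reg 17))) (.get 0 (.lit 9)))) (.op .sub (.lit 1) (.get 16 (.reg 17))))
    (.seq (.put 16 (.reg 17) (.lit 1)) <|
      .seq (.put 13 (.reg 4) (.reg 17)) <|
      .seq (.put 14 (.reg 4) (.get 9 (.get 1 (.reg 17)))) <|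
      .seq (.put 15 (.reg 4) (.get 9 (.get 2 (.reg 17)))) <|
      .set 4 (.op .add (.reg 4) (.lit 1)))
    .skip

theorem edgeProg_ok {I : Finset ℕ} {R : ℕ → Prop} {e : ℕ} (hB : Bdd W s)
    (h : RecordedAt s I R s) (he : s.reg 17 = e) (h09 : s.arr 0 9 ≤ W) (h1 : s.arr 1 e ≤ W)
    (h2 : s.arr 2 e ≤ W) (h51 : s.arr 5 (s.arr 1 e) ≤ W) (h52 : s.arr 5 (s.arr 2 e) ≤ W)
    (h4 : s.reg 4 < W) (heW : e ≤ W)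
    (hI : s.arr 5 (s.arr 1 e) = s.arr 0 9 ∧ s.arr 5 (s.arr 2 e) = s.arr 0 9 ↔ e ∈ I) :
    Ok ans time W B edgeProg s (K + 7) fun s' =>
      RecordedAt s I (fun e' => R e' ∨ e' = e) s' ∧ s'.reg 4 ≤ s.reg 4 + 1 := by
  have hW := hB.ten_le
  refine Ok.ite hB rfl (by simp [Expr.Safe, Expr.eval, he, h1, h2, h51, h52, h09]) (fun hc => ?_)
    fun hc => ?_
  · have hc' : e ∈ I ∧ s.arr 16 e = 0 := by
      rw [← hI]
      simp only [Expr.eval, Op.eval, he, ne_eq, mul_eq_zero, not_or, ite_eq_right_iff,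
        one_ne_zero, imp_false, not_not] at hc
      exact ⟨hc.1, by omega⟩
    have hnew := h.insert hc'.1 hc'.2
    refine Ok.put_seq hB rfl trivial trivial e 1 he rfl (by omega) fun hB => ?_
    refine Ok.put_seq hB rfl trivial trivial (s.reg 4) e (by simp [Expr.eval])
      (by simp [Expr.eval, he]) heW fun hB => ?_
    refine Ok.put_seq hB rfl trivial (by simp [Expr.Safe, Expr.eval, he, h1]) (s.reg 4)
      (s.arr 9 (s.arr 1 e)) (by simp [Expr.eval]) (by simp [Expr.eval, he]) ?_ fun hB => ?_
    · simpa using hB.arr 9 (by omega) (s.arr 1 e)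
    refine Ok.put_seq hB rfl trivial (by simp [Expr.Safe, Expr.eval, he, h2]) (s.reg 4)
      (s.arr 9 (s.arr 2 e)) (by simp [Expr.eval]) (by simp [Expr.eval, he]) ?_ fun hB => ?_
    · simpa using hB.arr 9 (by omega) (s.arr 2 e)
    refine Ok.set hB rfl (Expr.safe_of_inner _ rfl) (s.reg 4 + 1) (by simp [Expr.eval, Op.eval])
      (by omega) ⟨?_, by simp⟩
    simpa [RecordedAt] using hnew
  · refine Ok.skip hB ⟨h.skip fun hmem hm => ?_, by omega⟩
    obtain ⟨g1, g2⟩ := hI.2 hmem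
    simp [Expr.eval, Op.eval, he, g1, g2, hm] at hc

/-- Record the edges that are incident to the vertices with a slot. -/
def recordProg : Prog :=
  .for 13 (.reg 2) <|
    .seq (.set 14 (.get 10 (.op .add (.reg 13) (.lit 1)))) <|
    .seq (.set 15 (.get 3 (.reg 14))) <|
    .seq (.set 18 (.op .sub (.get 3 (.op .add (.reg 14) (.lit 1))) (.reg 15))) <|
    .for 16 (.reg 18) <|
      .seq (.set 17 (.get 4 (.op .add (.reg 15) (.reg 16)))) edgeProg

end Fragment

namespace Fragment

variable {ans : ℕ → List ℕ} {time : ℕ → ℕ} {W B : ℕ} {s : State} {K : ℕ}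

/-- Only the adjacency lists of the `w` vertices with a slot are read, each of length at most `d`,
so at most `w * d` edges are recorded. -/
theorem recordProg_ok {I : Finset ℕ} {m w d : ℕ} (hB : Bdd W s) (hw : s.reg 2 = w)
    (h4 : s.reg 4 = 0) (h16 : ∀ i, s.arr 16 i = 0) (h09 : s.arr 0 9 ≤ W) (hmW : m ≤ W)
    (hends : ∀ e < m, s.arr 1 e ≤ W ∧ s.arr 2 e ≤ W ∧ s.arr 5 (s.arr 1 e) ≤ W ∧
      s.arr 5 (s.arr 2 e) ≤ W)
    (hI : ∀ e < m, (s.arr 5 (s.arr 1 e) = s.arr 0 9 ∧ s.arr 5 (s.arr 2 e) = s.arr 0 9 ↔ e ∈ I))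
    (hadj : ∀ j < w, ∀ v, v = s.arr 10 (j + 1) → s.arr 3 v ≤ W ∧ s.arr 3 (v + 1) ≤ W ∧
      s.arr 3 (v + 1) - s.arr 3 v ≤ d ∧
      ∀ t < s.arr 3 (v + 1) - s.arr 3 v, s.arr 4 (s.arr 3 v + t) < m)
    (hwB : w < B) (hdB : d < B) (hBW : B ≤ W) (hwd : w * d < W) :
    Ok ans time W B recordProg s (K + 19) fun s' => RecordedAt s I (fun e => ∃ j < w,
      ∃ t < s.arr 3 (s.arr 10 (j + 1) + 1) - s.arr 3 (s.arr 10 (j + 1)),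
        s.arr 4 (s.arr 3 (s.arr 10 (j + 1)) + t) = e) s' ∧ s'.reg 4 ≤ w * d := by
  refine Ok.mono (Ok.for (K := K + 14) (N := w) hB rfl (by omega) hwB
    (fun i s' => RecordedAt s I (fun e => ∃ j < i,
      ∃ t < s.arr 3 (s.arr 10 (j + 1) + 1) - s.arr 3 (s.arr 10 (j + 1)),
        s.arr 4 (s.arr 3 (s.arr 10 (j + 1)) + t) = e) s' ∧ s'.reg 4 ≤ i * d)
    ⟨⟨by simp [h4], by simp [h4], by simp [h4, h16], by simp [h4], by simp [h4]⟩, by simp [h4]⟩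
    (fun i s' v hI => by simpa [RecordedAt] using hI)
    (fun s' _ hA => (hA.1 2 (by decide)).trans hw) ?_) (by omega) fun _ _ _ h => h.1
  rintro i hi s₁ hB₁ hA₁ hx₁ ⟨hR, hq⟩
  have a0 : s₁.arr 0 = s.arr 0 := hA₁.2 0 (by decide)
  have a1 : s₁.arr 1 = s.arr 1 := hA₁.2 1 (by decide)
  have a2 : s₁.arr 2 = s.arr 2 := hA₁.2 2 (by decide)
  have a3 : s₁.arr 3 = s.arr 3 := hA₁.2 3 (by decide)
  have a4 : s₁.arr 4 = s.arr 4 := hA₁.2 4 (by decide)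
  have a5 : s₁.arr 5 = s.arr 5 := hA₁.2 5 (by decide)
  have a9 : s₁.arr 9 = s.arr 9 := hA₁.2 9 (by decide)
  have a10 : s₁.arr 10 = s.arr 10 := hA₁.2 10 (by decide)
  obtain ⟨v, hv⟩ : ∃ v, v = s.arr 10 (i + 1) := ⟨_, rfl⟩
  obtain ⟨g1, g2, g3, g4⟩ := hadj i hi v hv
  have hvW : v ≤ W := by
    have := hB.arr 10 (by omega) (i + 1)
    omega
  refine Ok.set_seq hB₁ rfl (Expr.safe_of_inner _ rfl) v
    (by simp [Expr.eval, Op.eval, a10, hx₁, hv]) hvW fun hB₂ => ?_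
  refine Ok.set_seq hB₂ rfl (by simp [Expr.Safe, Expr.eval, a3, g1]) (s.arr 3 v)
    (by simp [Expr.eval, a3]) g1 fun hB₃ => ?_
  refine Ok.set_seq hB₃ rfl (by simp [Expr.Safe, Expr.eval, Op.eval, a3, g2])
    (s.arr 3 (v + 1) - s.arr 3 v) (by simp [Expr.eval, Op.eval, a3]) (by omega) fun hB₄ => ?_
  refine Ok.mono (Ok.for (K := K + 7) (N := s.arr 3 (v + 1) - s.arr 3 v) hB₄ rfl (by omega)
    (by omega)
    (fun t s' => RecordedAt s I (fun e => (∃ j < i,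
      ∃ t < s.arr 3 (s.arr 10 (j + 1) + 1) - s.arr 3 (s.arr 10 (j + 1)),
        s.arr 4 (s.arr 3 (s.arr 10 (j + 1)) + t) = e) ∨ ∃ t' < t, s.arr 4 (s.arr 3 v + t') = e) s' ∧
        s'.reg 4 ≤ i * d + t) ⟨?_, by simpa using hq⟩
    (fun i s' v hI => by simpa [RecordedAt] using hI) (fun s' _ hA => ?_) ?_) (by omega)
    fun s' _ _ h => ?_
  · have := hR.congr (R' := fun e => (∃ j < i,
      ∃ t < s.arr 3 (s.arr 10 (j + 1) + 1) - s.arr 3 (s.arr 10 (j + 1)),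
        s.arr 4 (s.arr 3 (s.arr 10 (j + 1)) + t) = e) ∨
          ∃ t' < 0, s.arr 4 (s.arr 3 v + t') = e) (by simp)
    simpa [RecordedAt] using this
  · simp only [Expr.eval]
    rw [hA.1 18 (by decide)]
    simp
  · rintro t ht s₂ hB₂ hA₂ hx₂ ⟨hR₂, hq₂⟩
    have b0 : s₂.arr 0 = s.arr 0 := (hA₂.2 0 (by decide)).trans a0
    have b1 : s₂.arr 1 = s.arr 1 := (hA₂.2 1 (by decide)).trans a1
    have b2 : s₂.arr 2 = s.arr 2 := (hA₂.2 2 (by decide)).trans a2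
    have b4 : s₂.arr 4 = s.arr 4 := (hA₂.2 4 (by decide)).trans a4
    have b5 : s₂.arr 5 = s.arr 5 := (hA₂.2 5 (by decide)).trans a5
    have b9 : s₂.arr 9 = s.arr 9 := (hA₂.2 9 (by decide)).trans a9
    have r15 : s₂.reg 15 = s.arr 3 v := by
      rw [hA₂.1 15 (by decide)]
      simp
    obtain ⟨e, he⟩ : ∃ e, e = s.arr 4 (s.arr 3 v + t) := ⟨_, rfl⟩
    have hem : e < m := he ▸ g4 t ht
    obtain ⟨f1, f2, f3, f4⟩ := hends e hem
    have hid : i * d + d ≤ w * d := by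
      rw [← Nat.succ_mul]
      exact Nat.mul_le_mul_right _ hi
    refine Ok.set_seq hB₂ rfl ?_ e (by simp [Expr.eval, Op.eval, r15, b4, hx₂, he]) (by omega)
      fun hB₃ => ?_
    · simp only [Expr.Safe, Expr.eval, Op.eval, r15, b4, hx₂, ← he]
      exact ⟨⟨trivial, trivial⟩, fun _ => by omega⟩
    refine Ok.mono (edgeProg_ok (K := K) (I := I) (e := e) hB₃ (R := fun e => (∃ j < i,
      ∃ t < s.arr 3 (s.arr 10 (j + 1) + 1) - s.arr 3 (s.arr 10 (j + 1)),
        s.arr 4 (s.arr 3 (s.arr 10 (j + 1)) + t) = e) ∨ ∃ t' < t, s.arr 4 (s.arr 3 v + t') = e)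
      ?_ (by simp) (by simpa [b0] using h09) (by simpa [b1] using f1) (by simpa [b2] using f2)
      (by simpa [b1, b5] using f3) (by simpa [b2, b5] using f4) ?_ (by omega)
      (by simpa [b0, b1, b2, b5] using hI e hem)) (by omega) ?_
    · simpa [RecordedAt, b1, b2, b9] using hR₂
    · simp
      omega
    · rintro s₄ hB₄ hA₄ ⟨k1, k2⟩
      simp only [RecordedAt, State.arr_set, b1, b2, b9] at k1
      refine ⟨Recorded.congr k1 fun e' => ?_, ?_⟩
      · constructor
        · rintro ((h | ⟨t', ht', h⟩) | rfl)
          · exact Or.inl h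
          · exact Or.inr ⟨t', by omega, h⟩
          · exact Or.inr ⟨t, by omega, he.symm⟩
        · rintro (h | ⟨t', ht', h⟩)
          · exact Or.inl (Or.inl h)
          · rcases Nat.lt_succ_iff_lt_or_eq.1 ht' with ht' | rfl
            · exact Or.inl (Or.inr ⟨t', ht', h⟩)
            · exact Or.inr (by rw [he, h])
      · simp at k2
        omega
  · refine ⟨h.1.1.congr fun e => ?_, ?_⟩
    · constructor
      · rintro (⟨j, hj, h⟩ | h)
        · exact ⟨j, by omega, h⟩
        · exact ⟨i, by omega, hv ▸ h⟩
      · rintro ⟨j, hj, h'⟩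
        rcases Nat.lt_succ_iff_lt_or_eq.1 hj with hj | rfl
        · exact Or.inl ⟨j, hj, h'⟩
        · exact Or.inr (hv ▸ h')
    · rw [Nat.succ_mul]
      exact h.1.2.trans (by omega)

/-! ### The output -/

/-- List the recorded edges whose ends are separated. -/
def outputProg : Prog :=
  .seq (.for 40 (.reg 4) <|
    .ite (.cell (.op .mul (.lit 2) (.get 14 (.reg 40))) (.get 15 (.reg 40)))
      (.seq (.set 41 (.op .add (.reg 41) (.lit 1))) <| .put 8 (.reg 41) (.get 13 (.reg 40)))
      .skip) <|
  .put 8 (.lit 0) (.reg 41)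

theorem segment_succ (f : ℕ → ℕ) (i l : ℕ) : segment f i (l + 1) = segment f i l ++ [f (i + l)] := by
  simp [segment, List.range_succ]

theorem segment_congr {f g : ℕ → ℕ} {i l : ℕ} (h : ∀ j < l, f (i + j) = g (i + j)) :
    segment f i l = segment g i l :=
  List.map_congr_left fun j hj => h j (List.mem_range.1 hj)

theorem mem_segment {f : ℕ → ℕ} {i l e : ℕ} : e ∈ segment f i l ↔ ∃ j < l, f (i + j) = e := by
  simp [segment]

/-- An edge is listed when the matrix marks the slots of its ends as separated. Cell `0` is written
last, with the final count, and distinct identifiers make the list free of repetitions. -/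
theorem outputProg_ok {q N : ℕ} (hB : Bdd W s) (hq : s.reg 4 = q) (hr1 : s.reg 1 = N)
    (hqB : q < B) (hBW : B ≤ W) (h41 : s.reg 41 = 0)
    (hinj : ∀ i < q, ∀ j < q, s.arr 13 i = s.arr 13 j → i = j) :
    Ok ans time W B outputProg s (K + 10) fun s' =>
      (segment (s'.arr 8) 1 (s'.arr 8 0)).Nodup ∧ ∀ e, e ∈ segment (s'.arr 8) 1 (s'.arr 8 0) ↔
        ∃ j < q, s.arr 13 j = e ∧ s.arr 11 (2 * s.arr 14 j * N + s.arr 15 j) ≠ 0 := by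
  rw [outputProg]
  refine Ok.seq (Ok.for (K := K + 4) (N := q) hB rfl (by omega) hqB
    (fun i s' => s'.reg 41 ≤ i ∧ (segment (s'.arr 8) 1 (s'.reg 41)).Nodup ∧
      ∀ e, e ∈ segment (s'.arr 8) 1 (s'.reg 41) ↔
        ∃ j < i, s.arr 13 j = e ∧ s.arr 11 (2 * s.arr 14 j * N + s.arr 15 j) ≠ 0)
    (by simp [h41, segment]) (fun i s' v hI => by simpa using hI)
    (fun s' _ hA => (hA.1 4 (by decide)).trans hq) ?_) ?_
  · rintro i hi s₁ hB₁ hA₁ hx₁ ⟨hI1, hI2, hI3⟩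
    have a11 : s₁.arr 11 = s.arr 11 := hA₁.2 11 (by decide)
    have a13 : s₁.arr 13 = s.arr 13 := hA₁.2 13 (by decide)
    have a14 : s₁.arr 14 = s.arr 14 := hA₁.2 14 (by decide)
    have a15 : s₁.arr 15 = s.arr 15 := hA₁.2 15 (by decide)
    have r1 : s₁.reg 1 = N := (hA₁.1 1 (by decide)).trans hr1
    refine Ok.ite hB₁ rfl (Expr.safe_of_inner _ rfl) (fun hc => ?_) fun hc => ?_
    · simp only [Expr.cell, Expr.eval, Op.eval, a11, a14, a15, hx₁, r1] at hc
      have h13 : s.arr 13 i ≤ W := hB.arr 13 (by omega) i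
      refine Ok.set_seq hB₁ rfl (Expr.safe_of_inner _ rfl) (s₁.reg 41 + 1) rfl (by omega)
        fun hB₂ => ?_
      refine Ok.put hB₂ rfl trivial (Expr.safe_of_inner _ rfl) (s₁.reg 41 + 1) (s.arr 13 i)
        (by simp [Expr.eval]) (by simp [Expr.eval, a13, hx₁]) h13 ?_
      have hseg : segment (Function.update (s₁.arr 8) (s₁.reg 41 + 1) (s.arr 13 i)) 1
          (s₁.reg 41 + 1) = segment (s₁.arr 8) 1 (s₁.reg 41) ++ [s.arr 13 i] := by
        rw [segment_succ, segment_congr (g := s₁.arr 8), Nat.add_comm 1, Function.update_self]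
        exact fun j hj => Function.update_of_ne (by omega) _ _
      simp only [State.arr_put, if_true, State.arr_set, State.reg_put, State.reg_set, hseg]
      refine ⟨by omega, ?_, fun e => ?_⟩
      · rw [List.nodup_append]
        refine ⟨hI2, by simp, fun x hx y hy hxy => ?_⟩
        obtain ⟨j, hj, hj', -⟩ := (hI3 x).1 hx
        have hyi := List.mem_singleton.1 hy
        have := hinj j (by omega) i hi (by rw [hj', hxy, hyi])
        omega
      · rw [List.mem_append, hI3, List.mem_singleton]
        constructor
        · rintro (⟨j, hj, h⟩ | rfl)
          · exact ⟨j, by omega, h⟩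
          · exact ⟨i, by omega, rfl, hc⟩
        · rintro ⟨j, hj, h1, h2⟩
          rcases Nat.lt_succ_iff_lt_or_eq.1 hj with hj | rfl
          · exact Or.inl ⟨j, hj, h1, h2⟩
          · exact Or.inr h1.symm
    · simp only [Expr.cell, Expr.eval, Op.eval, a11, a14, a15, hx₁, r1] at hc
      refine Ok.skip hB₁ ⟨by omega, hI2, fun e => (hI3 e).trans ⟨?_, ?_⟩⟩
      · rintro ⟨j, hj, h⟩
        exact ⟨j, by omega, h⟩
      · rintro ⟨j, hj, h1, h2⟩
        rcases Nat.lt_succ_iff_lt_or_eq.1 hj with hj | rfl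
        · exact ⟨j, hj, h1, h2⟩
        · exact absurd hc h2
  · rintro s₁ hB₁ hA₁ ⟨⟨hI1, hI2, hI3⟩, -⟩
    refine Ok.put hB₁ rfl trivial trivial 0 (s₁.reg 41) rfl rfl (by omega) ?_
    have hseg : segment (Function.update (s₁.arr 8) 0 (s₁.reg 41)) 1 (s₁.reg 41) =
        segment (s₁.arr 8) 1 (s₁.reg 41) :=
      segment_congr fun j hj => Function.update_of_ne (by omega) _ _
    simp only [State.arr_put, if_true, Function.update_self, hseg]
    exact ⟨hI2, hI3⟩

end Fragment

/-! ### From the memory layout of the input to the graph, and the whole program. -/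

namespace Fragment

open scoped Graph

variable {W B : ℕ} {s : State} {K : ℕ}

/-- An edge that is not recorded has both ends in one slot, so the preimage of a set of slots does
not separate it; the recorded edges correspond bijectively to the indices below `q`. -/
theorem Recorded.cut_eq {a b sl : ℕ → ℕ} {I : Finset ℕ} {R : ℕ → Prop} {q : ℕ}
    {id ea eb mark : ℕ → ℕ} (h : Recorded a b sl I R q id ea eb mark)
    (hR : ∀ e ∈ I, ¬ R e → sl (a e) = sl (b e)) (S : Set ℕ) :
    cut I a b (sl ⁻¹' S) = cut (Finset.range q) ea eb S := by
  classical
  have h1 : cut (Finset.range q) ea eb S =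
      ∑ e ∈ (Finset.range q).image id, if sl (a e) ∈ S ↔ sl (b e) ∈ S then 0 else 1 := by
    rw [Finset.sum_image fun i hi j hj hij =>
      h.inj i (Finset.mem_range.1 hi) j (Finset.mem_range.1 hj) hij]
    refine Finset.sum_congr rfl fun j hj => ?_
    rw [← h.ea j (Finset.mem_range.1 hj), ← h.eb j (Finset.mem_range.1 hj)]
  have h2 : ∀ e, e ∈ (Finset.range q).image id ↔ R e ∧ e ∈ I := by
    intro e
    rw [← h.mem]
    simp
  rw [h1]
  symm
  refine (Finset.sum_subset (fun e he => ((h2 e).1 he).2) fun e he hne => ?_).trans ?_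
  · rw [if_pos]
    rw [hR e he fun hRe => hne ((h2 e).2 ⟨hRe, he⟩)]
  · refine Finset.sum_congr rfl fun e _ => ?_
    by_cases hp : sl (a e) ∈ S ↔ sl (b e) ∈ S <;> simp only [Set.mem_preimage, hp, if_true, if_false]

section Input

variable {G : Graph ℕ ℕ} {n m : ℕ} {P : Finpartition (Finset.range n)} {C : Finset ℕ}
  {lmax ν b : ℕ} {δ : ℚ}

theorem IsInput.end_lt (h : IsInput s G n m P C lmax ν b δ) (hV : V(G) = Set.Iio n) {e : ℕ}
    (he : e < m) : s.arr 1 e < n ∧ s.arr 2 e < n := by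
  have := h.ends e he
  have h1 := this.left_mem
  have h2 := this.right_mem
  rw [hV] at h1 h2
  exact ⟨h1, h2⟩

theorem IsInput.setting (h : IsInput s G n m P C lmax ν b δ) (hV : V(G) = Set.Iio n)
    (hE : E(G) = Set.Iio m) (hC : C ∈ P.parts) :
    Setting G n m C (s.arr 1) (s.arr 2) (s.arr 6) (innerEnd s) := by
  have hmem : ∀ e, (∃ k < boundary G C, s.arr 6 k = e) ↔ e ∈ edgesBetween G C (V(G) \ C) := by
    intro e
    rw [← h.boundary_mem, mem_segment]
    simp
  refine ⟨hV, hE, P.le hC, P.nonempty_of_mem_parts hC, h.ends, fun k hk k' hk' hkk' => ?_, hmem,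
    fun k hk => ?_⟩
  · exact List.inj_on_of_nodup_map h.boundary_nodup (List.mem_range.2 hk) (List.mem_range.2 hk')
      (by simpa using hkk')
  · obtain ⟨u, hu, v, ⟨-, hv⟩, hlink⟩ := (hmem _).1 ⟨k, hk, rfl⟩
    have he : s.arr 6 k < m := by simpa [hE] using hlink.edge_mem
    obtain ⟨h1, h2⟩ := h.end_lt hV he
    have hname := h.name_C _ h1
    rw [innerEnd]
    split_ifs with hc
    · exact ⟨hname.1 hc, Or.inl rfl⟩
    · refine ⟨?_, Or.inr rfl⟩
      rcases hlink.eq_and_eq_or_eq_and_eq (h.ends _ he) with ⟨rfl, rfl⟩ | ⟨rfl, rfl⟩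
      · exact absurd (hname.2 hu) hc
      · exact hu

theorem IsInput.degree_eq (h : IsInput s G n m P C lmax ν b δ) {v : ℕ} (hv : v < n) :
    s.arr 3 (v + 1) - s.arr 3 v = (G.incidenceSet v).ncard := by
  have h1 : (G.incidenceSet v) =
      ((segment (s.arr 4) (s.arr 3 v) (s.arr 3 (v + 1) - s.arr 3 v)).toFinset : Set ℕ) := by
    ext e
    rw [List.coe_toFinset, Set.mem_ofPred_eq, h.incident v hv]
    rfl
  rw [h1, Set.ncard_coe_finset, List.toFinset_card_of_nodup (h.incident_nodup v hv)]
  simp [segment]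

theorem IsInput.incident_lt (h : IsInput s G n m P C lmax ν b δ) (hE : E(G) = Set.Iio m) {v t : ℕ}
    (hv : v < n) (ht : t < s.arr 3 (v + 1) - s.arr 3 v) : s.arr 4 (s.arr 3 v + t) < m := by
  have h1 := ((h.incident v hv _).1 (mem_segment.2 ⟨t, ht, rfl⟩)).edge_mem
  rw [hE] at h1
  exact h1

/-- Offsets are partial sums of degrees, each at most `m`; the bound is needed for them to fit into
words. -/
theorem IsInput.offset_le (h : IsInput s G n m P C lmax ν b δ) (hE : E(G) = Set.Iio m) {v : ℕ}
    (hv : v ≤ n) : s.arr 3 v ≤ n * m := by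
  have key : ∀ v ≤ n, s.arr 3 v ≤ v * m := by
    intro v
    induction v with
    | zero => simp [h.offset_zero]
    | succ v ih =>
      intro hv
      have h1 := ih (by omega)
      have h2 : (G.incidenceSet v).ncard ≤ m := by
        have hsub : G.incidenceSet v ⊆ ((Finset.range m : Finset ℕ) : Set ℕ) := by
          intro e he
          have := Graph.Inc.edge_mem he
          rw [hE] at this
          simpa using this
        simpa [Set.ncard_coe_finset] using Set.ncard_le_ncard hsub (Finset.finite_toSet _)
      have h3 := h.degree_eq (v := v) (by omega)
      rw [Nat.succ_mul]
      omega
  exact (key v hv).trans (Nat.mul_le_mul_right m hv)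

theorem IsInput.mem_internal (h : IsInput s G n m P C lmax ν b δ) (hV : V(G) = Set.Iio n) {e : ℕ}
    (he : e < m) : (s.arr 5 (s.arr 1 e) = s.arr 0 9 ∧ s.arr 5 (s.arr 2 e) = s.arr 0 9) ↔
      e ∈ internal m (s.arr 1) (s.arr 2) C := by
  obtain ⟨h1, h2⟩ := h.end_lt hV he
  rw [h.name_C _ h1, h.name_C _ h2, internal, Finset.mem_filter, Finset.mem_range]
  tauto

theorem IsInput.params_eq (h : IsInput s G n m P C lmax ν b δ) :
    s.arr 0 0 = n ∧ s.arr 0 2 = lmax ∧ s.arr 0 5 = δ.num.toNat ∧ s.arr 0 6 = δ.den ∧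
      s.arr 0 8 = boundary G C := by
  have key : ∀ i < 9, s.arr 0 i =
      [n, m, lmax, ν, b, δ.num.toNat, δ.den, C.card, boundary G C].getD i 0 := by
    intro i hi
    rw [← h.params, List.getD_eq_getElem _ _ (by simpa [segment] using hi)]
    simp [segment]
  exact ⟨key 0 (by omega), key 2 (by omega), key 5 (by omega), key 6 (by omega), key 8 (by omega)⟩

end Input

/-- The fragmenting algorithm. -/
def fragmentProg : Prog :=
  .seq (.set 0 (.get 0 (.lit 8))) <|
  .seq (.set 1 (.op .add (.get 0 (.lit 0)) (.lit 1))) <|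
  .seq (.set 30 (.get 0 (.lit 5))) <|
  .seq (.set 31 (.get 0 (.lit 6))) <|
  .seq (.set 32 (.get 0 (.lit 2))) <|
  .seq familyProg <| .seq recordProg <| .seq netProg outputProg

end Fragment

/-! ### Correctness of the whole program. -/

namespace Fragment

open scoped Graph

variable {W B : ℕ} {s : State} {K : ℕ} {G : Graph ℕ ℕ} {n m : ℕ}
  {P : Finpartition (Finset.range n)} {C : Finset ℕ} {lmax lmin ν b : ℕ} {δ : ℚ}

theorem num_toNat_eq (hδ : 0 < δ) : ((δ.num.toNat : ℕ) : ℝ) = (δ : ℝ) * δ.den := by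
  have h2 : ((δ.num.toNat : ℕ) : ℤ) = δ.num := Int.toNat_of_nonneg (Rat.num_pos.2 hδ).le
  have h3 : (((δ.num.toNat : ℕ) : ℤ) : ℚ) = δ * δ.den := by rw [h2, Rat.mul_den_eq_num]
  exact_mod_cast h3

/-- The comparison of `c` with `δ * lmax / 5` after clearing denominators, as the machine performs
it. -/
theorem close_iff (hδ : 0 < δ) (c : ℕ) :
    5 * c * δ.den ≤ δ.num.toNat * lmax ↔ (c : ℝ) ≤ (δ : ℝ) * lmax / 5 := by
  have hd : (0 : ℝ) < δ.den := by exact_mod_cast δ.den_pos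
  rw [← Nat.cast_le (α := ℝ)]
  push_cast
  rw [num_toNat_eq hδ, le_div_iff₀ (by norm_num : (0 : ℝ) < 5)]
  constructor
  · intro h
    refine le_of_mul_le_mul_right ?_ hd
    linarith
  · intro h
    nlinarith

/-- The bounds on `B` control, in turn, the number of queries, the length of an answer, the numbers
of slots and of sets, the number of recorded edges, and the length of an adjacency list. Only `W`,
which bounds words and not time, has to dominate `n`, `m` and the offsets. -/
theorem fragmentProg_ok (I : LocalKCut (intracluster G P) lmax ν b)
    (hV : V(G) = Set.Iio n) (hE : E(G) = Set.Iio m) (hC : C ∈ P.parts)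
    (h1 : 1 ≤ lmax) (hl1 : 0 < lmin) (hl6 : 5 * lmax ≤ 6 * lmin) (hδ : 0 < δ)
    (hδ1 : (δ : ℝ) ≤ 0.04)
    (hmin : ∀ T : Finset ℕ, T.Nonempty → T ⊂ C → lmin ≤ boundary (G.induce C) T)
    (hlb : lmax ≤ b * lmin) (hbd : boundary G C ≤ 6 * lmax) (hs : IsInput s G n m P C lmax ν b δ)
    {Q : ℕ} (hQ : ∀ v < n, I.time v ≤ Q) (hB1 : 6 * lmax + 2 < B) (hB2 : Q < B)
    (hB3 : 6 * lmax * Q + 2 < B) (hB4 : 6 * lmax * Q * (ν + 6 * lmax) + 2 < B)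
    (hB5 : ν + 6 * lmax < B) (hW1 : 30 * B ≤ W) (hW2 : n + 10 < W) (hW3 : n * m ≤ W) (hW4 : m ≤ W)
    (hW5 : δ.den ≤ W) :
    Ok (fun v => encodeSets (I.answer v)) I.time W B fragmentProg s (K + 60) fun s' =>
      ∃ D : Finpartition C, IsOutput s' G D ∧
      (∀ S : Finset ℕ, S ⊆ C → vol G S ≤ ν → boundary (G.induce C) S ≤ lmax →
        ∃ 𝒜 : Finpartition D.parts, ∀ A ∈ 𝒜.parts,
          ¬ BoundarySparse G δ (A.sup id) (S ∩ A.sup id)) ∧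
      ((D.parts.card : ℝ) ≤ 466560 * ((δ : ℝ) ^ 2)⁻¹ * (1 + Real.log C.card) ^ 2) ∧
      (∀ A ∈ D.parts, boundary G A ≤ boundary G C) := by
  obtain ⟨p0, p2, p5, p6, p8⟩ := hs.params_eq
  have hset := hs.setting hV hE hC
  have hmc := hset.minCut hmin
  have hδR : (0 : ℝ) < (δ : ℝ) := by exact_mod_cast hδ
  obtain ⟨E, hEd⟩ : ∃ E, E = boundary G C := ⟨_, rfl⟩
  have hB : Bdd W s := ⟨by omega, by simp [hs.reg_zero], fun a ha i => by simp [hs.arr_zero a ha]⟩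
  have hnum : δ.num.toNat ≤ W := by
    refine le_trans ?_ hW5
    rw [← Nat.cast_le (α := ℝ), num_toNat_eq hδ]
    have hd : (0 : ℝ) ≤ δ.den := Nat.cast_nonneg _
    nlinarith
  have hEQ : E * Q ≤ 6 * lmax * Q := Nat.mul_le_mul_right _ (by omega)
  have hxC : ∀ k < E, innerEnd s k ∈ C := fun k hk => (hset.x_mem k (by omega)).1
  have hxn : ∀ k < E, innerEnd s k < n := fun k hk => Finset.mem_range.1 (hset.sub (hxC k hk))
  have hgm : ∀ k < E, s.arr 6 k < m := fun k hk => by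
    have := ((hset.g_mem _).1 ⟨k, by omega, rfl⟩)
    obtain ⟨u, -, v, -, hlink⟩ := this
    simpa [hE] using hlink.edge_mem
  have hname : s.arr 0 9 ≤ W := by
    obtain ⟨u, hu⟩ := hset.ne
    have hu' := Finset.mem_range.1 (hset.sub hu)
    have e1 := (hs.name_C u hu').2 hu
    have e2 := hs.name_lt u hu'
    omega
  have hends : ∀ e < m, s.arr 1 e ≤ W ∧ s.arr 2 e ≤ W ∧ s.arr 5 (s.arr 1 e) ≤ W ∧
      s.arr 5 (s.arr 2 e) ≤ W := by
    intro e he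
    obtain ⟨e1, e2⟩ := hs.end_lt hV he
    have e3 := hs.name_lt _ e1
    have e4 := hs.name_lt _ e2
    exact ⟨by omega, by omega, by omega, by omega⟩
  rw [fragmentProg]
  refine Ok.set_seq hB rfl (by simp [Expr.Safe, Expr.eval, p8]; omega) E
    (by simp [Expr.eval, p8, hEd]) (by omega) fun hB => ?_
  refine Ok.set_seq hB rfl (by simp [Expr.Safe, Expr.eval, p0]; omega) (n + 1)
    (by simp [Expr.eval, Op.eval, p0]) (by omega) fun hB => ?_
  refine Ok.set_seq hB rfl (by simp [Expr.Safe, Expr.eval, p5]; omega) δ.num.toNat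
    (by simp [Expr.eval, p5]) hnum fun hB => ?_
  refine Ok.set_seq hB rfl (by simp [Expr.Safe, Expr.eval, p6]; omega) δ.den
    (by simp [Expr.eval, p6]) hW5 fun hB => ?_
  refine Ok.set_seq hB rfl (by simp [Expr.Safe, Expr.eval, p2]; omega) lmax
    (by simp [Expr.eval, p2]) (by omega) fun hB => ?_
  generalize hs₁ : ((((s.set 0 E).set 1 (n + 1)).set 30 δ.num.toNat).set 31 δ.den).set 32 lmax = s₁
    at hB ⊢
  have harr : s₁.arr = s.arr := by subst hs₁; rfl
  have hz : ∀ r, r ≠ 0 → r ≠ 1 → r ≠ 30 → r ≠ 31 → r ≠ 32 → s₁.reg r = 0 := by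
    intro r g1 g2 g3 g4 g5
    subst hs₁
    simp [g1, g2, g3, g4, g5, hs.reg_zero]
  have r0 : s₁.reg 0 = E := by subst hs₁; simp
  have r1 : s₁.reg 1 = n + 1 := by subst hs₁; simp
  have r30 : s₁.reg 30 = δ.num.toNat := by subst hs₁; simp
  have r31 : s₁.reg 31 = δ.den := by subst hs₁; simp
  have r32 : s₁.reg 32 = lmax := by subst hs₁; simp
  have hinner : innerEnd s₁ = innerEnd s := by funext k; simp only [innerEnd, harr]
  have hsound : ∀ k < E, ∀ L ∈ I.answer (innerEnd s k), (∀ u ∈ L, u ∈ C) ∧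
      cut (internal m (s.arr 1) (s.arr 2) C) (s.arr 1) (s.arr 2) {u | u ∈ L} ≤ lmax ∧
      ∀ u ∈ L, (G.incidenceSet u).ncard ≤ ν + boundary G C :=
    fun k hk L hL => hset.answer_sound hC I (hxC k hk) hL
  have hnC : ∀ u ∈ C, u < n := fun u hu => Finset.mem_range.1 (hset.sub hu)
  refine Ok.seq (familyProg_ok (K := K + 14) (n := n) (E := E) (Q := Q) (A := I.answer) hB (by omega)
    (by omega) r0 (by omega) r1 (hz 2 (by omega) (by omega) (by omega) (by omega) (by omega))
    (hz 3 (by omega) (by omega) (by omega) (by omega) (by omega))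
    (by rw [harr]; exact hs.arr_zero 9 (by omega)) (by rw [harr]; exact hs.arr_zero 11 (by omega))
    (by rw [harr]; exact hname) (fun k hk => ?_) (fun k hk => ?_) (fun k hk L hL v hv => ?_)
    (fun k hk => ?_) (fun k hk => ?_) hB2 (by rw [Nat.succ_mul]; omega))
    fun s₂ hB₂ hA₂ ⟨Ls, hLs, hT, hnf, hw, hnf', hvx⟩ => ?_
  · rw [harr]
    obtain ⟨e1, e2, e3, e4⟩ := hends _ (hgm k hk)
    have := hgm k hk
    exact ⟨by omega, e1, e2, e3⟩
  · rw [hinner]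
    exact (hQ _ (hxn k hk)).trans hB2.le
  · rw [hinner] at hL
    exact hnC v ((hsound k hk L hL).1 v hv)
  · rw [hinner]; exact hxn k hk
  · rw [hinner]
    exact (I.writes _ (by rw [show V(intracluster G P) = V(G) from rfl, hV]; exact hxn k hk)).trans
      (hQ _ (hxn k hk))
  rw [hinner] at hLs hvx
  have hLs' : ∀ (f : ℕ) (L : List ℕ), Ls[f]? = some L → ∃ k < E, L ∈ I.answer (innerEnd s k) := by
    intro f L hf
    have := List.mem_of_getElem? hf
    rw [hLs, List.mem_flatMap] at this
    obtain ⟨k, hk, hL⟩ := this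
    exact ⟨k, List.mem_range.1 hk, hL⟩
  have hin : ∀ f v, InSet Ls f v → v ∈ C ∧ (G.incidenceSet v).ncard ≤ ν + boundary G C := by
    rintro f v ⟨L, hL, hv⟩
    obtain ⟨k, hk, hL'⟩ := hLs' f L hL
    obtain ⟨e1, -, e3⟩ := hsound k hk L hL'
    exact ⟨e1 v hv, e3 v hv⟩
  have i0 : s₂.arr 0 = s.arr 0 := (hA₂.2 0 (by decide)).trans (by rw [harr])
  have i1 : s₂.arr 1 = s.arr 1 := (hA₂.2 1 (by decide)).trans (by rw [harr])
  have i2 : s₂.arr 2 = s.arr 2 := (hA₂.2 2 (by decide)).trans (by rw [harr])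
  have i3 : s₂.arr 3 = s.arr 3 := (hA₂.2 3 (by decide)).trans (by rw [harr])
  have i4 : s₂.arr 4 = s.arr 4 := (hA₂.2 4 (by decide)).trans (by rw [harr])
  have i5 : s₂.arr 5 = s.arr 5 := (hA₂.2 5 (by decide)).trans (by rw [harr])
  obtain ⟨w, hwd⟩ : ∃ w, w = s₂.reg 2 := ⟨_, rfl⟩
  obtain ⟨sl, hsl⟩ : ∃ sl, sl = s₂.arr 9 := ⟨_, rfl⟩
  obtain ⟨vt, hvt⟩ : ∃ vt, vt = s₂.arr 10 := ⟨_, rfl⟩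
  rw [TableAt, ← hwd, ← hsl, ← hvt] at hT
  rw [← hwd] at hw
  have hwn := hT.w_le
  have hvtC : ∀ j < w, vt (j + 1) ∈ C ∧ (G.incidenceSet (vt (j + 1))).ncard ≤ ν + E := by
    intro j hj
    have e1 := hT.sl_vt (j + 1) (by omega) (by omega)
    obtain ⟨f, hf⟩ := (hT.sl_ne (vt (j + 1))).1 (by omega)
    rw [hEd]
    exact hin f _ hf
  have hwd' : w * (ν + E) ≤ 6 * lmax * Q * (ν + 6 * lmax) :=
    Nat.mul_le_mul (hw.trans hEQ) (by omega)
  refine Ok.seq (recordProg_ok (K := K + 34) (I := internal m (s.arr 1) (s.arr 2) C) (m := m) (w := w)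
    (d := ν + E) hB₂ hwd.symm ?_ ?_ (by rw [i0]; exact hname) hW4 (by rw [i1, i2, i5]; exact hends)
    (fun e he => ?_) (fun j hj v hv => ?_) (by omega) (by omega) (by omega) (by omega))
    fun s₃ hB₃ hA₃ ⟨hR, hq⟩ => ?_
  · rw [hA₂.1 4 (by decide)]
    exact hz 4 (by omega) (by omega) (by omega) (by omega) (by omega)
  · rw [hA₂.2 16 (by decide), harr]
    exact hs.arr_zero 16 (by omega)
  · rw [i0, i1, i2, i5]
    exact hs.mem_internal hV he
  · rw [← hvt] at hv
    obtain ⟨g1, g2⟩ := hvtC j hj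
    rw [← hv] at g1 g2
    have hvn := hnC v g1
    rw [i3, i4]
    exact ⟨(hs.offset_le hE hvn.le).trans hW3, (hs.offset_le hE hvn).trans hW3,
      (hs.degree_eq hvn).trans_le g2, fun t ht => hs.incident_lt hE hvn ht⟩
  rw [i3, i4, ← hvt, RecordedAt, i1, i2, ← hsl] at hR
  obtain ⟨R, hRd⟩ : ∃ R : ℕ → Prop, R = fun e => ∃ j < w,
      ∃ t < s.arr 3 (vt (j + 1) + 1) - s.arr 3 (vt (j + 1)), s.arr 4 (s.arr 3 (vt (j + 1)) + t) = e :=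
    ⟨_, rfl⟩
  rw [← hRd] at hR
  have hinc : ∀ e v, v < n → sl v ≠ 0 → G.Inc e v → R e := by
    intro e v hvn hv hev
    have e1 := hT.vt_sl v hv
    have e2 := hT.sl_le v
    obtain ⟨t, ht, ht'⟩ := mem_segment.1 ((hs.incident v hvn e).2 hev)
    rw [hRd]
    refine ⟨sl v - 1, by omega, ?_⟩
    rw [Nat.sub_add_cancel (by omega), e1]
    exact ⟨t, ht, ht'⟩
  -- If neither end has a slot of its own, both are in slot `0`.
  have hRall : ∀ e ∈ internal m (s.arr 1) (s.arr 2) C, ¬ R e →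
      sl (s.arr 1 e) = sl (s.arr 2 e) := by
    intro e he hRe
    have hem := Finset.mem_range.1 (Finset.mem_filter.1 he).1
    obtain ⟨e1, e2⟩ := hs.end_lt hV hem
    have hlink := hs.ends e hem
    have z1 : sl (s.arr 1 e) = 0 := by
      by_contra hne
      exact hRe (hinc e _ e1 hne hlink.inc_left)
    have z2 : sl (s.arr 2 e) = 0 := by
      by_contra hne
      exact hRe (hinc e _ e2 hne hlink.inc_right)
    rw [z1, z2]
  obtain ⟨q, hqd⟩ : ∃ q, q = s₃.reg 4 := ⟨_, rfl⟩
  rw [← hqd] at hR hq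
  let D : Slots := ⟨n + 1, w, Ls.length, q, E, s₃.arr 14, s₃.arr 15, s₃.arr 12, sl⟩
  have hD : Holds W B D s₃ := by
    refine ⟨?_, ?_, ?_, ?_, hqd.symm, rfl, rfl, rfl, ?_, fun j hj => ?_, fun j hj => ?_, hT.sl_le,
      ?_, ?_, ?_, ?_, ?_, hW1⟩
    · exact (hA₃.1 0 (by decide)).trans ((hA₂.1 0 (by decide)).trans r0)
    · exact (hA₃.1 1 (by decide)).trans ((hA₂.1 1 (by decide)).trans r1)
    · exact (hA₃.1 2 (by decide)).trans hwd.symm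
    · exact (hA₃.1 3 (by decide)).trans hnf
    · exact (hA₃.2 9 (by decide)).trans hsl.symm
    · exact (hR.ea j hj).trans_le (hT.sl_le _)
    · exact (hR.eb j hj).trans_le (hT.sl_le _)
    · exact Nat.lt_succ_of_le hwn
    · show E < B
      omega
    · show w + 1 < B
      omega
    · show Ls.length < B
      omega
    · show q < B
      omega
  have a11 : s₃.arr 11 = s₂.arr 11 := hA₃.2 11 (by decide)
  have hq' : q < B := hD.q_lt
  refine Ok.seq (netProg_ok (K := K + 12) (D := D) (η := (δ : ℝ) * lmax / 5) hB₃ hD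
    (fun x z hz => ?_) (fun x hx z hz => ?_) ?_ ?_ (by positivity) (fun c => ?_))
    fun s₄ hB₄ hA₄ ⟨J, Y, hN, hY⟩ => ?_
  · rw [a11]
    exact hT.le_one x z (le_trans hz hwn)
  · have hz' : z ≤ n := le_trans hz hwn
    have e1 := hT.le_one (2 * x) z hz'
    have e2 := hT.eq_one (2 * x) z hz'
    rw [a11]
    show s₂.arr 11 (2 * x * (n + 1) + z) = 0
    by_contra hne
    obtain ⟨f, v, hf, -⟩ := e2.1 (by omega)
    omega
  · rw [hA₃.2 17 (by decide), hA₂.2 17 (by decide), harr]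
    exact hs.arr_zero 17 (by omega)
  · rw [hA₃.2 18 (by decide), hA₂.2 18 (by decide), harr]
    exact hs.arr_zero 18 (by omega)
  · rw [hA₃.1 30 (by decide), hA₃.1 31 (by decide), hA₃.1 32 (by decide), hA₂.1 30 (by decide),
      hA₂.1 31 (by decide), hA₂.1 32 (by decide), r30, r31, r32]
    exact close_iff hδ c
  have a13 : s₄.arr 13 = s₃.arr 13 := hA₄.2 13 (by decide)
  refine (outputProg_ok (K := K + 42) (q := q) (N := n + 1) hB₄ ?_ ?_ hq' (by omega) ?_
    (by rw [a13]; exact hR.inj)).mono le_rfl fun s₅ hB₅ hA₅ ⟨hO1, hO2⟩ => ?_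
  · rw [hA₄.1 4 (by decide), hqd]
  · rw [hA₄.1 1 (by decide), hA₃.1 1 (by decide), hA₂.1 1 (by decide), r1]
  · rw [hA₄.1 41 (by decide), hA₃.1 41 (by decide), hA₂.1 41 (by decide)]
    exact hz 41 (by omega) (by omega) (by omega) (by omega) (by omega)
  -- Pulling back along `sl` is legitimate: cuts agree because the missing edges lie within slot
  -- `0`, masses agree by construction, and each member of the family is the preimage of its row.
  have hN' := hN.preimage (I' := internal m (s.arr 1) (s.arr 2) C) (a' := s.arr 1) (b' := s.arr 2)
    (X' := Finset.range (boundary G C)) (x' := innerEnd s) (σ := sl)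
    (F' := fun f => {v | InSet Ls f v}) (hR.cut_eq hRall) (fun S => ?_) hT.sl_le le_rfl
    (fun f hf => ?_)
  · have hFcut : ∀ f < Ls.length,
        cut (internal m (s.arr 1) (s.arr 2) C) (s.arr 1) (s.arr 2) {v | InSet Ls f v} ≤ lmax := by
      intro f hf
      have hL : Ls[f]? = some (Ls[f]'hf) := List.getElem?_eq_getElem hf
      obtain ⟨k, hk, hL'⟩ := hLs' f _ hL
      refine le_trans (le_of_eq (congrArg _ (Set.ext fun u => ?_))) (hsound k hk _ hL').2.1
      simp [InSet, hL]
    have hcomp : ∀ S : Finset ℕ, S ⊂ C → vol G S ≤ ν → boundary (G.induce C) S ≤ lmax →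
        (∃ k < boundary G C, innerEnd s k ∈ S) → ∃ f < Ls.length, {v | InSet Ls f v} = ↑S := by
      rintro S hS hvol hSb ⟨k, hk, hkS⟩
      obtain ⟨L, hL, hLS⟩ := hset.exists_answer hC I hmc (by omega) hlb hS hkS hvol hSb
      have hmem : L ∈ Ls := by
        rw [hLs, List.mem_flatMap]
        exact ⟨k, List.mem_range.2 (by omega), hL⟩
      obtain ⟨f, hf, hfL⟩ := List.getElem_of_mem hmem
      refine ⟨f, hf, Set.ext fun u => ?_⟩
      rw [← hLS, List.coe_toFinset]
      simp [InSet, List.getElem?_eq_getElem hf, hfL]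
    obtain ⟨D', d1, d2, d3, d4, d5⟩ := hset.exists_fragmentation (ν := ν) hδR hδ1 hl1 hl6 hbd hmc
      hN' hFcut hcomp
    refine ⟨D', ⟨d1, hO1, fun e => ?_⟩, d3, d4, d5⟩
    rw [d2]
    refine (hO2 e).trans ?_
    have a14 : s₄.arr 14 = s₃.arr 14 := hA₄.2 14 (by decide)
    have a15 : s₄.arr 15 = s₃.arr 15 := hA₄.2 15 (by decide)
    rw [a13, a14, a15]
    constructor
    · rintro ⟨j, hj, rfl, hne⟩
      refine ⟨((hR.mem _).1 ⟨j, hj, rfl⟩).2, ?_⟩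
      have := (hY _ (hD.ea_le j hj) _ (hD.eb_le j hj)).1 hne
      rwa [show D.ea j = sl (s.arr 1 (s₃.arr 13 j)) from hR.ea j hj,
        show D.eb j = sl (s.arr 2 (s₃.arr 13 j)) from hR.eb j hj] at this
    · rintro ⟨he, i, hi, hsep⟩
      have hRe : R e := by
        by_contra hRe
        have := hRall e he hRe
        simp only [Set.mem_preimage, this, not_true_eq_false] at hsep
      obtain ⟨j, hj, rfl⟩ := (hR.mem e).2 ⟨hRe, he⟩
      refine ⟨j, hj, rfl, (hY _ (hD.ea_le j hj) _ (hD.eb_le j hj)).2 ⟨i, hi, ?_⟩⟩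
      rwa [show D.ea j = sl (s.arr 1 (s₃.arr 13 j)) from hR.ea j hj,
        show D.eb j = sl (s.arr 2 (s₃.arr 13 j)) from hR.eb j hj]
  · rw [← hEd]
    refine Finset.sum_congr rfl fun k hk => ?_
    have : D.vx k = innerEnd s k := by
      show s₃.arr 12 k = _
      rw [hA₃.2 12 (by decide)]
      exact hvx k (Finset.mem_range.1 hk)
    rw [← this]
    rfl
  · ext v
    have hv := le_trans (hT.sl_le v) hwn
    have e1 := hT.eq_one (2 * f + 1) (sl v) hv
    show InSet Ls f v ↔ s₃.arr 11 ((2 * f + 1) * (n + 1) + sl v) = 1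
    rw [a11, e1]
    constructor
    · exact fun hfv => ⟨f, v, rfl, hfv, rfl⟩
    · rintro ⟨f', v', e2, e3, e4⟩
      -- A nonzero slot belongs to a single vertex, so equality of slots gives `v = v'`.
      have e5 : sl v' ≠ 0 := (hT.sl_ne v').2 ⟨f', e3⟩
      have e6 := hT.vt_sl v' e5
      rw [e4] at e5 e6
      rw [hT.vt_sl v e5] at e6
      obtain rfl : f = f' := by omega
      rwa [e6]

end Fragment

/-! ### Comparison of the running time with the bound for a query. -/

namespace Fragment

/-- Since `b ≤ 2 ^ b ≤ u ^ b`, the factors `u ^ 2` and `b ^ 2` are each at most `u ^ (2 * b)`. The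
base is therefore at most a constant times `u ^ ((k₀ + 4) * b) * L ^ k₀`, and a fixed power `p` of
it keeps the required form. -/
theorem pow_le_queryBound {k₀ b c p : ℕ} {u L q : ℝ} (hb : 1 ≤ b) (hu : 2 ≤ u) (hL : 1 ≤ L)
    (hq0 : 0 ≤ q) (hq : q ≤ k₀ * (b : ℝ) ^ 2 * u ^ (k₀ * b) * L ^ k₀) {k : ℕ}
    (hk : k = (c * (k₀ + 1)) ^ p) (hk₀ : p * (k₀ + 4) ≤ k) :
    (c * u ^ 2 * (q + 1)) ^ p ≤ k * (b : ℝ) ^ 2 * u ^ (k * b) * L ^ k := by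
  have hu1 : 1 ≤ u := by linarith
  have hu0 : 0 ≤ u := by linarith
  have hL0 : 0 ≤ L := by linarith
  have hbR : (1 : ℝ) ≤ b := by exact_mod_cast hb
  have hbu : (b : ℝ) ≤ u ^ b := by
    have h1 : (b : ℝ) ≤ 2 ^ b := by exact_mod_cast Nat.lt_two_pow_self.le
    exact h1.trans (pow_le_pow_left₀ (by norm_num) hu b)
  have hp1 : 1 ≤ (b : ℝ) ^ 2 * u ^ (k₀ * b) * L ^ k₀ :=
    one_le_mul_of_one_le_of_one_le (one_le_mul_of_one_le_of_one_le (one_le_pow₀ hbR)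
      (one_le_pow₀ hu1)) (one_le_pow₀ hL)
  have h1 : q + 1 ≤ (k₀ + 1) * ((b : ℝ) ^ 2 * u ^ (k₀ * b) * L ^ k₀) := by
    have : (k₀ : ℝ) * (b : ℝ) ^ 2 * u ^ (k₀ * b) * L ^ k₀ =
      k₀ * ((b : ℝ) ^ 2 * u ^ (k₀ * b) * L ^ k₀) := by ring
    linarith
  have h2 : (b : ℝ) ^ 2 ≤ u ^ (2 * b) := by
    rw [mul_comm, pow_mul]
    exact pow_le_pow_left₀ (by positivity) hbu 2
  have h2' : u ^ 2 ≤ u ^ (2 * b) := pow_le_pow_right₀ hu1 (by omega)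
  have h3 : u ^ 2 * ((b : ℝ) ^ 2 * u ^ (k₀ * b)) ≤ u ^ ((k₀ + 4) * b) := by
    calc u ^ 2 * ((b : ℝ) ^ 2 * u ^ (k₀ * b))
        ≤ u ^ (2 * b) * (u ^ (2 * b) * u ^ (k₀ * b)) :=
          mul_le_mul h2' (mul_le_mul_of_nonneg_right h2 (pow_nonneg hu0 _)) (by positivity)
            (pow_nonneg hu0 _)
      _ = u ^ ((k₀ + 4) * b) := by
          rw [← pow_add, ← pow_add]
          congr 1
          ring
  have h4 : c * u ^ 2 * (q + 1) ≤ (c * ((k₀ : ℝ) + 1)) * (u ^ ((k₀ + 4) * b) * L ^ k₀) := by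
    calc c * u ^ 2 * (q + 1)
        ≤ c * u ^ 2 * ((k₀ + 1) * ((b : ℝ) ^ 2 * u ^ (k₀ * b) * L ^ k₀)) :=
          mul_le_mul_of_nonneg_left h1 (by positivity)
      _ = (c * ((k₀ : ℝ) + 1)) * (u ^ 2 * ((b : ℝ) ^ 2 * u ^ (k₀ * b)) * L ^ k₀) := by
          simp only [mul_assoc, mul_left_comm]
      _ ≤ (c * ((k₀ : ℝ) + 1)) * (u ^ ((k₀ + 4) * b) * L ^ k₀) :=
          mul_le_mul_of_nonneg_left (mul_le_mul_of_nonneg_right h3 (pow_nonneg hL0 _))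
            (by positivity)
  have hkR : (k : ℝ) = (c * ((k₀ : ℝ) + 1)) ^ p := by
    rw [hk, Nat.cast_pow, Nat.cast_mul, Nat.cast_add, Nat.cast_one]
  have h5 : u ^ ((k₀ + 4) * b * p) ≤ u ^ (k * b) := by
    refine pow_le_pow_right₀ hu1 ?_
    rw [mul_comm _ p, ← mul_assoc]
    exact Nat.mul_le_mul_right b hk₀
  have h6 : L ^ (k₀ * p) ≤ L ^ k := by
    refine pow_le_pow_right₀ hL (le_trans ?_ hk₀)
    rw [mul_comm]
    exact Nat.mul_le_mul_left p (by omega)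
  calc (c * u ^ 2 * (q + 1)) ^ p
      ≤ ((c * ((k₀ : ℝ) + 1)) * (u ^ ((k₀ + 4) * b) * L ^ k₀)) ^ p :=
        pow_le_pow_left₀ (by positivity) h4 p
    _ = k * (u ^ ((k₀ + 4) * b * p) * L ^ (k₀ * p)) := by
        rw [hkR, mul_pow, mul_pow (u ^ _), ← pow_mul, ← pow_mul]
    _ ≤ k * (u ^ (k * b) * L ^ k) :=
        mul_le_mul_of_nonneg_left (mul_le_mul h5 h6 (pow_nonneg hL0 _) (pow_nonneg hu0 _))
          (Nat.cast_nonneg k)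
    _ ≤ k * (b : ℝ) ^ 2 * u ^ (k * b) * L ^ k := by
        have h7 : (0 : ℝ) ≤ k * (u ^ (k * b) * L ^ k) := by positivity
        have h8 := mul_le_mul_of_nonneg_right (one_le_pow₀ (n := 2) hbR) h7
        linarith

/-- A single `k` has to serve as coefficient and as exponent: it is the `p`-th power of the constant
in the base, and it dominates the exponents `p * (k₀ + 4)`. -/
theorem exists_queryBound_constant (k₀ p c : ℕ) (hp : 3 ≤ p) (hpc : 4 * p ≤ c ^ 3)
    (hc : 0 < c) : ∃ k, k = (c * (k₀ + 1)) ^ p ∧ c ^ 3 ≤ k ∧ p * (k₀ + 4) ≤ k := by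
  refine ⟨_, rfl, ?_⟩
  have h1 : (c * (k₀ + 1)) ^ 3 ≤ (c * (k₀ + 1)) ^ p :=
    Nat.pow_le_pow_right (Nat.mul_pos hc (by omega)) hp
  have h2 : c ^ 3 * (k₀ + 1) ≤ (c * (k₀ + 1)) ^ 3 := by
    rw [mul_pow]
    exact Nat.mul_le_mul_left _ (Nat.le_self_pow (by omega) _)
  have h3 : c ^ 3 * 1 ≤ c ^ 3 * (k₀ + 1) := Nat.mul_le_mul_left _ (by omega)
  have h4 : 4 * p * (k₀ + 1) ≤ c ^ 3 * (k₀ + 1) := Nat.mul_le_mul_right _ hpc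
  have h5 : p * (k₀ + 4) ≤ 4 * p * (k₀ + 1) := by nlinarith
  omega

end Fragment

theorem mainTheorem5 :
    ∃ algorithm : Fragment.Prog, ∀ k₀ : ℕ, ∃ k : ℕ,
      ∀ (n m : ℕ) (G : Graph ℕ ℕ) (P : Finpartition (Finset.range n)) (C : Finset ℕ)
        (lmax lmin ν b : ℕ) (δ : ℚ)
        (I : Fragment.LocalKCut (Fragment.intracluster G P) lmax ν b)
        (s : Fragment.State),
        -- the graph `G` and the cluster `C`
        G.vertexSet = Set.Iio n → G.edgeSet = Set.Iio m → G.Loopless → C ∈ P.parts →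
        -- the parameters
        1 ≤ lmax → lmax < ν → 1 ≤ b → (lmax : ℝ) ≤ 1.2 * lmin → 0 < δ → (δ : ℝ) ≤ 0.04 →
        -- the minimum cut of `G[C]` is at least `lmin`, and `lmin ≥ lmax / b`
        (∀ T : Finset ℕ, T.Nonempty → T ⊂ C → lmin ≤ Fragment.boundary (G.induce C) T) →
        (lmax : ℝ) / b ≤ lmin →
        Fragment.boundary G C ≤ 6 * lmax →
        -- the query time of the LocalKCut data structure
        (∀ v < n, (I.time v : ℝ) ≤ Fragment.queryBound k₀ n m lmax ν b) →
        Fragment.IsInput s G n m P C lmax ν b δ →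
        ∃ (M t : ℕ) (s' : Fragment.State) (D : Finpartition C),
          -- the algorithm decomposes `C` into the parts of `D`
          Fragment.Exec (fun v => Fragment.encodeSets (I.answer v)) I.time M algorithm s s' t ∧
          Fragment.IsOutput s' G D ∧
          -- the groupings
          (∀ S : Finset ℕ, S ⊆ C → Fragment.vol G S ≤ ν →
            Fragment.boundary (G.induce C) S ≤ lmax →
            ∃ 𝒜 : Finpartition D.parts, ∀ A ∈ 𝒜.parts,
              ¬ Fragment.BoundarySparse G δ (A.sup id) (S ∩ A.sup id)) ∧
          -- the number of clusters and their boundaries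
          (D.parts.card : ℝ) ≤ k * ((δ : ℝ) ^ 2)⁻¹ * (1 + Real.log C.card) ^ k ∧
          (∀ A ∈ D.parts, Fragment.boundary G A ≤ Fragment.boundary G C) ∧
          -- the running time, and the size of the words
          (t : ℝ) ≤ ((δ : ℝ) ^ 2)⁻¹ * Fragment.queryBound k n m lmax ν b ∧
          (M : ℝ) ≤
            (n + m + δ.den + ((δ : ℝ) ^ 2)⁻¹ * Fragment.queryBound k n m lmax ν b) ^ k := by
  -- The nesting exponent of `fragmentProg_ok` with `K = 0`.
  obtain ⟨p, hp⟩ : ∃ p, p = 60 := ⟨_, rfl⟩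
  obtain ⟨c, hc⟩ : ∃ c, c = 100 := ⟨_, rfl⟩
  refine ⟨Fragment.fragmentProg, fun k₀ => ?_⟩
  obtain ⟨k, hk, hk1, hk2⟩ := Fragment.exists_queryBound_constant k₀ p c (by omega)
    (by subst hp hc; norm_num) (by omega)
  replace hk1 : 466560 ≤ k := le_trans (by subst hc; norm_num) hk1
  refine ⟨k, ?_⟩
  intro n m G P C lmax lmin ν b δ I s hV hE _ hC h1 hlν hb hll hδ hδ1 hmin hlb hbd htime hs
  have hbR : (0 : ℝ) < b := by exact_mod_cast hb
  have hl6 : 5 * lmax ≤ 6 * lmin := by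
    have : (5 : ℝ) * lmax ≤ 6 * lmin := by linarith
    exact_mod_cast this
  have hlb' : lmax ≤ b * lmin := by
    rw [div_le_iff₀ hbR, mul_comm] at hlb
    exact_mod_cast hlb
  have hset := hs.setting hV hE hC
  have hC1 : 1 ≤ C.card := hset.ne.card_pos
  have hn1 : 1 ≤ n := by
    obtain ⟨u, hu⟩ := hset.ne
    have := Finset.mem_range.1 (hset.sub hu)
    omega
  have hL : 1 ≤ 1 + Real.log ((n : ℝ) + m) := by
    have h2 : (1 : ℝ) ≤ (n : ℝ) + m := by exact_mod_cast (by omega : 1 ≤ n + m)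
    linarith [Real.log_nonneg h2]
  obtain ⟨U, hU⟩ : ∃ U, U = ν * lmax := ⟨_, rfl⟩
  have hUν : ν ≤ U := hU ▸ Nat.le_mul_of_pos_right ν h1
  have hUl : lmax ≤ U := hU ▸ Nat.le_mul_of_pos_left lmax (by omega)
  have hU2 : 2 ≤ U := by omega
  have hUR : ((ν : ℝ) * lmax) = U := by rw [hU]; push_cast; ring
  obtain ⟨Q, hQ⟩ : ∃ Q, Q = ⌊Fragment.queryBound k₀ n m lmax ν b⌋₊ := ⟨_, rfl⟩
  have hqb0 : 0 ≤ Fragment.queryBound k₀ n m lmax ν b := by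
    rw [Fragment.queryBound]
    positivity
  have hQR : (Q : ℝ) ≤ Fragment.queryBound k₀ n m lmax ν b := hQ ▸ Nat.floor_le hqb0
  -- The largest quantity to be covered is the number of recorded edges, of order `lmax * Q * (ν +
  -- lmax)`, which is at most `42 * U ^ 2 * Q`.
  obtain ⟨B, hBd⟩ : ∃ B, B = c * U ^ 2 * (Q + 1) := ⟨_, rfl⟩
  have hBq : (B : ℝ) ^ p ≤ Fragment.queryBound k n m lmax ν b := by
    rw [Fragment.queryBound, hUR] at hQR ⊢
    rw [hBd, Nat.cast_mul, Nat.cast_mul, Nat.cast_pow, Nat.cast_add, Nat.cast_one]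
    exact Fragment.pow_le_queryBound hb (by exact_mod_cast hU2) hL (Nat.cast_nonneg Q) hQR hk hk2
  rw [hc] at hBd
  have hUU : 2 * U ≤ U ^ 2 := by nlinarith
  have hB1 : 100 * U ^ 2 ≤ B := by rw [hBd]; exact Nat.le_mul_of_pos_right _ (by omega)
  have hB2 : 100 * U ^ 2 * Q + 100 * U ^ 2 = B := by rw [hBd]; ring
  have hlQ : 6 * lmax * Q ≤ 6 * U * Q := Nat.mul_le_mul_right _ (by omega)
  have hlQ2 : 6 * U * Q ≤ 100 * U ^ 2 * Q := Nat.mul_le_mul_right _ (by omega)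
  have hlQ3 : 6 * lmax * Q * (ν + 6 * lmax) ≤ 100 * U ^ 2 * Q := by
    calc 6 * lmax * Q * (ν + 6 * lmax) ≤ 6 * U * Q * (7 * U) := Nat.mul_le_mul hlQ (by omega)
      _ = 42 * (U ^ 2 * Q) := by ring
      _ ≤ 100 * (U ^ 2 * Q) := Nat.mul_le_mul_right _ (by omega)
      _ = 100 * U ^ 2 * Q := by ring
  have hQ2 : Q ≤ 100 * U ^ 2 * Q := Nat.le_mul_of_pos_left Q (by omega)
  -- The square makes room for the offsets, which can be as large as `n * m`.
  obtain ⟨W, hW⟩ : ∃ W, W = 30 * B + (n + m + δ.den + 11) ^ 2 := ⟨_, rfl⟩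
  have hsq : n + m + δ.den + 11 ≤ (n + m + δ.den + 11) ^ 2 := Nat.le_self_pow (by omega) _
  have hnm : n * m ≤ (n + m + δ.den + 11) ^ 2 := by
    rw [sq]
    exact Nat.mul_le_mul (by omega) (by omega)
  obtain ⟨s', t, e1, e2, -, D, e3, e4, e5, e6⟩ := Fragment.fragmentProg_ok (K := 0) (B := B) (W := W) I
    hV hE hC h1 (by omega) hl6 hδ hδ1 hmin hlb' hbd hs (Q := Q)
    (fun v hv => hQ ▸ Nat.le_floor (htime v hv)) (by omega) (by omega) (by omega) (by omega)
    (by omega) (by omega) (by omega) (by omega) (by omega) (by omega) (by omega)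
  have hδR : (0 : ℝ) < δ := by exact_mod_cast hδ
  have hδi : 1 ≤ ((δ : ℝ) ^ 2)⁻¹ := (one_le_inv₀ (by positivity)).2 (by nlinarith)
  have hqk0 : 0 ≤ Fragment.queryBound k n m lmax ν b := le_trans (by positivity) hBq
  have hqk : Fragment.queryBound k n m lmax ν b ≤
      ((δ : ℝ) ^ 2)⁻¹ * Fragment.queryBound k n m lmax ν b := le_mul_of_one_le_left hqk0 hδi
  refine ⟨W ^ 8, t, s', D, e1, e3, e4, e5.trans ?_, e6, ?_, ?_⟩
  · have hlog : 1 ≤ 1 + Real.log C.card := by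
      have : (1 : ℝ) ≤ C.card := by exact_mod_cast hC1
      linarith [Real.log_nonneg this]
    have hkR : (466560 : ℝ) ≤ k := by exact_mod_cast hk1
    gcongr
    omega
  · have : (t : ℝ) ≤ (B : ℝ) ^ p := by
      rw [hp]
      exact_mod_cast e2
    exact this.trans (hBq.trans hqk)
  · obtain ⟨Y, hY⟩ : ∃ Y : ℝ, Y = n + m + δ.den +
      ((δ : ℝ) ^ 2)⁻¹ * Fragment.queryBound k n m lmax ν b := ⟨_, rfl⟩
    rw [← hY]
    have hB100 : (100 : ℝ) ≤ B := by exact_mod_cast (by omega : 100 ≤ B)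
    have hBB : (B : ℝ) ≤ (B : ℝ) ^ p := le_self_pow₀ (by linarith) (by omega)
    have hn0 : (0 : ℝ) ≤ n := Nat.cast_nonneg n
    have hm0 : (0 : ℝ) ≤ m := Nat.cast_nonneg m
    have hd0 : (0 : ℝ) ≤ δ.den := Nat.cast_nonneg _
    have hYB : (n : ℝ) + m + δ.den + B ≤ Y := by linarith
    have hY100 : 100 ≤ Y := by linarith
    have hWR : (W : ℝ) = 30 * B + ((n : ℝ) + m + δ.den + 11) ^ 2 := by rw [hW]; push_cast; ring
    -- Words within `W ^ 8` are then within `Y ^ 24`, and `24 ≤ k`.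
    have hWY : (W : ℝ) ≤ Y ^ 3 := by
      have g1 : ((n : ℝ) + m + δ.den + 11) ^ 2 ≤ Y ^ 2 :=
        pow_le_pow_left₀ (by positivity) (by linarith) 2
      rw [hWR]
      nlinarith
    push_cast
    calc (W : ℝ) ^ 8 ≤ (Y ^ 3) ^ 8 := pow_le_pow_left₀ (Nat.cast_nonneg W) hWY 8
      _ = Y ^ 24 := by ring
      _ ≤ Y ^ k := pow_le_pow_right₀ (by linarith) (by omega)
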